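/- **Setting.** Let $\Bbbk$ be a field with an involutive automorphism $z\mapsto\bar z$, put $\mathbb U=\{z\in\Bbbk:\bar z z=1\}$, and let $(\mathcal G,+)$, $(\mathsf Z,+)$ be abelian groups. All categories are $\Bbbk$-linear monoidal with $\Bbbk$-bilinear tensor product and $\operatorname{End}(\mathbb I)=\Bbbk$; associativity and unit isomorphisms are suppressed. A *pivotal* category has objects $V^*$ and maps $\overrightarrow{\mathrm{coev}}_V:\mathbb I\to V\otimes V^*$, $\overrightarrow{\mathrm{ev}}_V:V^*\otimes V\to\mathbb I$, $\overleftarrow{\mathrm{coev}}_V:\mathbb I\to V^*\otimes V$, $\overleftarrow{\mathrm{ev}}_V:V\otimes V^*\to\mathbb I$ forming two dualities with the same dual morphisms and the same comparison isomorphisms $W^*\otimes V^*\to(V\otimes W)^*$. It is *Hermitian pivotal* if it has an antilinear involution $f\mapsto f^\dagger$, $\operatorname{Hom}(V,W)\to\operatorname{Hom}(W,V)$, with $(fg)^\dagger=g^\dagger f^\dagger$, $(f\otimes g)^\dagger=f^\dagger\otimes g^\dagger$, $f^{\dagger\dagger}=f$, $\overrightarrow{\mathrm{coev}}{}_V^\dagger=\overleftarrow{\mathrm{ev}}_V$,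 $\overrightarrow{\mathrm{ev}}{}_V^\dagger=\overleftarrow{\mathrm{coev}}_V$, and unitary associativity and unit isomorphisms. It is *Hermitian ribbon* if moreover it has a braiding $c$ with $c_{V,W}^\dagger=c_{V,W}^{-1}$ whose left and right partial traces on $V\otimes V$ give the same endomorphism, the twist $\theta_V$. An object $V$ is *simple* if $\operatorname{End}(V)=\Bbbk\,\mathrm{Id}_V$ and $V\neq0$. A category is *semisimple* if every object is a finite direct sum of simple objects and there is no nonzero map between non-isomorphic simple objects. A *$\mathcal G$-grading* consists of nonzero full subcategories $\mathcal C_g$, closed under isomorphism, such that $\mathbb I\in\mathcal C_0$, every object is a finite direct sum of objects of distinct $\mathcal C_g$'s, $\mathcal C_g\otimes\mathcal C_h\subset\mathcal C_{g+h}$, and $\operatorname{Hom}(\mathcal C_g,\mathcal C_h)=0$ for $g\ne h$. Let $\mathcal X\subset\mathcal G$ be *symmetric* ($-\mathcal X=\mathcal X$) and *small* (no finite union of translates of $\mathcal X$ is $\mathcal G$). A graded category is *generically (finitely) semisimple* if $\mathcal C_g$ is semisimple (with finitely many classes of simple objects) for all $g\in\mathcal G\setminus\mathcal X$; simple objects of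 such $\mathcal C_g$ are *generic simple*, and form the class $\mathsf A$. An *m-trace* is a family of linear maps $\mathsf t_V:\operatorname{End}(V)\to\Bbbk$, $V$ projective, with $\mathsf t_V(gf)=\mathsf t_U(fg)$ for $f:V\to U$, $g:U\to V$, $U,V$ projective, and, for $U$ projective and any $W$, $\mathsf t_{U\otimes W}(f)=\mathsf t_U(\mathrm{ptr}_R f)$ and $\mathsf t_{W\otimes U}(f)=\mathsf t_U(\mathrm{ptr}_L f)$, where $\mathrm{ptr}_R$ and $\mathrm{ptr}_L$ are the partial traces over the right and left tensor factor $W$; it is *real* if $\mathsf t(f^\dagger)=\overline{\mathsf t(f)}$. A *relative Hermitian-premodular category* is a generically semisimple Hermitian ribbon category $(\mathcal C,\mathcal G,\mathcal X)$ with a nonzero real m-trace and a monoidal functor $\sigma:\mathsf Z\to\mathcal C_0$ with unitary structure isomorphisms $\sigma_\lambda\otimes\sigma_\mu\cong\sigma_{\lambda+\mu}$, $\mathbb I\cong\sigma_0$ (suppressed below), such that $\theta_{\sigma_\lambda}=\mathrm{Id}$; $V\otimes\sigma_\lambda\not\cong V$ for $V$ simple and $\lambda\neq0$; for each $g\notin\mathcal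 X$ there is a finite set $\Theta_g\subset\mathcal C_g$ of simple projective objects with epic $\overrightarrow{\mathrm{ev}}$ such that the identity of every object of $\mathcal C_g$ is a linear combination of maps factoring through objects $V\otimes\sigma_\lambda$, $V\in\Theta_g$; and there is a bilinear $\psi:\mathcal G\times\mathsf Z\to\Bbbk^*$ with $c_{\sigma_\lambda,V}c_{V,\sigma_\lambda}=\psi(g,\lambda)\mathrm{Id}$ for $V\in\mathcal C_g$. A *b-map* on a graded pivotal category is a map $\mathsf b:\mathsf A\to\Bbbk^*$, invariant under isomorphism and under $V\mapsto V^*$, such that for all $g_1,g_2,g_1+g_2\in\mathcal G\setminus\mathcal X$ and all simple $V\in\mathcal C_{g_1+g_2}$ $$\mathsf b(V)=\sum_{V_1\in irr(\mathcal C_{g_1}),\,V_2\in irr(\mathcal C_{g_2})}\mathsf b(V_1)\,\mathsf b(V_2)\dim_\Bbbk\operatorname{Hom}(V,V_1\otimes V_2),$$ where $irr(\mathcal C_g)$ is a (finite) representing set of the isomorphism classes of simple objects of $\mathcal C_g$. A *relative Hermitian-spherical category* is a generically finitely semisimple Hermitian pivotal category $(\mathcal C,\mathcal G,\mathcal X)$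 having a real m-trace for which generic simple objects $V$ are projective with $\mathsf d(V)=\mathsf t_V(\mathrm{Id}_V)\neq0$, and having a b-map. **Theorem.** Let $\mathcal C$ be a relative Hermitian-premodular category. Assume that there is a bilinear map $\sqrt\psi:\mathcal G\times\mathsf Z\to\mathbb U$ with $\sqrt\psi^{\,2}=\psi$, and that $c_{\sigma_\lambda,\sigma_\mu}=\mathrm{Id}_{\sigma_{\lambda+\mu}}$ for all $\lambda,\mu\in\mathsf Z$. Let $\mathsf X_{V,\sigma_\lambda}=\sqrt\psi(g,\lambda)^{-1}c_{V,\sigma_\lambda}$ for $V\in\mathcal C_g$, extended to direct sums, and let $\mathcal C^{\mathsf Z}$ have the objects of $\mathcal C$, with their degrees, and the morphisms $$\operatorname{Hom}_{\mathcal C^{\mathsf Z}}(V,W)=\bigoplus_{\lambda\in\mathsf Z}\operatorname{Hom}_{\mathcal C}(V,\sigma_\lambda\otimes W),\qquad (g\circ f)_\lambda=\sum_{\lambda'+\lambda''=\lambda}(\mathrm{Id}_{\sigma_{\lambda'}}\otimes g_{\lambda''})f_{\lambda'}.$$ Its tensor product is that of $\mathcal C$ on objects and, for $f:V_1\to V_2$,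 $h:V_3\to V_4$, $$(f\otimes h)_\lambda=\sum_{\lambda'+\lambda''=\lambda}(\mathrm{Id}_{\sigma_{\lambda'}}\otimes\mathsf X_{V_2,\sigma_{\lambda''}}\otimes\mathrm{Id}_{V_4})(f_{\lambda'}\otimes h_{\lambda''});$$ its structure isomorphisms, dual objects, evaluations and coevaluations are those of $\mathcal C$ (in degree zero), and $$(f^\dagger)_\lambda=(\mathrm{Id}_{\sigma_\lambda}\otimes(f_{-\lambda})^\dagger)\circ(\kappa_\lambda\otimes\mathrm{Id}_{V_2}):V_2\to\sigma_\lambda\otimes V_1,$$ with $\kappa_\lambda:\mathbb I\to\sigma_\lambda\otimes\sigma_{-\lambda}$ the structure isomorphism. If $\mathcal C^{\mathsf Z}$ has a b-map, then with these operations $\mathcal C^{\mathsf Z}$ is a relative Hermitian-spherical category (with the same $\mathcal G$ and $\mathcal X$). -/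

import Mathlib

open CategoryTheory MonoidalCategory
open scoped DirectSum

set_option linter.unusedSectionVars false

universe u v w x y

namespace HermCat

/-! ### Tensor, pivotal and Hermitian categories

The structures carry raw operations (`MonoidalCategoryStruct`, `PivotalStruct`, `DaggerStruct`);
the laws are collected in propositions, so that they can be asserted of a given set of operations.
Everything is written for not necessarily strict monoidal categories. -/

/-- `C`, with the given tensor product, is a tensor `k`-category: the monoidal category axioms hold,
the tensor product of morphisms is `k`-bilinear and `k → End(𝟙)` is bijective. -/
structure IsTensorCategory (k : Type w) [Field k] (C : Type u) [Category.{v} C] [Preadditive C]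
    [Linear k C] [S : MonoidalCategoryStruct C] : Prop where
  monoidal : ∃ M : MonoidalCategory C, M.toMonoidalCategoryStruct = S ∧
    ∃ P : @MonoidalPreadditive C _ _ M, @MonoidalLinear k _ C _ _ _ M P
  end_unit : Function.Bijective (fun a : k => a • 𝟙 (𝟙_ C))

/-- Dual objects with both families of duality morphisms: `coevR`, `evR` are the ones usually
decorated with a right arrow, `coevL`, `evL` those decorated with a left arrow. -/
class PivotalStruct (C : Type u) [Category.{v} C] [MonoidalCategoryStruct C] where
  dual : C → C
  coevR : ∀ V : C, 𝟙_ C ⟶ V ⊗ dual V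
  evR : ∀ V : C, dual V ⊗ V ⟶ 𝟙_ C
  coevL : ∀ V : C, 𝟙_ C ⟶ dual V ⊗ V
  evL : ∀ V : C, V ⊗ dual V ⟶ 𝟙_ C

/-- An additive conjugation `f ↦ f†`, reversing the direction of morphisms. -/
class DaggerStruct (C : Type u) [Category.{v} C] [Preadditive C] where
  dag : ∀ {V W : C}, (V ⟶ W) →+ (W ⟶ V)

open PivotalStruct DaggerStruct

section Pivotal

variable {C : Type u} [Category.{v} C] [MonoidalCategoryStruct C] [PivotalStruct C]

/-- The dual morphism `f^* : W^* ⟶ V^*` built from `coevR` and `evR`. -/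
def dualR {V W : C} (f : V ⟶ W) : dual W ⟶ dual V :=
  (ρ_ (dual W)).inv ≫ dual W ◁ coevR V ≫ dual W ◁ (f ▷ dual V) ≫
    (α_ (dual W) W (dual V)).inv ≫ evR W ▷ dual V ≫ (λ_ (dual V)).hom

/-- The dual morphism `^*f : W^* ⟶ V^*` built from `coevL` and `evL`. -/
def dualL {V W : C} (f : V ⟶ W) : dual W ⟶ dual V :=
  (λ_ (dual W)).inv ≫ coevL V ▷ dual W ≫ (dual V ◁ f) ▷ dual W ≫
    (α_ (dual V) W (dual W)).hom ≫ dual V ◁ evL W ≫ (ρ_ (dual V)).hom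

/-- The nested evaluation `(W^* ⊗ V^*) ⊗ (V ⊗ W) ⟶ 𝟙`. -/
def nestedEvR (V W : C) : (dual W ⊗ dual V) ⊗ (V ⊗ W) ⟶ 𝟙_ C :=
  (α_ (dual W) (dual V) (V ⊗ W)).hom ≫
    dual W ◁ ((α_ (dual V) V W).inv ≫ evR V ▷ W ≫ (λ_ W).hom) ≫ evR W

/-- The nested evaluation `(V ⊗ W) ⊗ (W^* ⊗ V^*) ⟶ 𝟙`. -/
def nestedEvL (V W : C) : (V ⊗ W) ⊗ (dual W ⊗ dual V) ⟶ 𝟙_ C :=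
  (α_ V W (dual W ⊗ dual V)).hom ≫
    V ◁ ((α_ W (dual W) (dual V)).inv ≫ evL W ▷ dual V ≫ (λ_ (dual V)).hom) ≫ evL V

/-- The comparison `W^* ⊗ V^* ⟶ (V ⊗ W)^*` built from `coevR` and `evR`. -/
def dualTensorR (V W : C) : dual W ⊗ dual V ⟶ dual (V ⊗ W) :=
  (ρ_ (dual W ⊗ dual V)).inv ≫ (dual W ⊗ dual V) ◁ coevR (V ⊗ W) ≫
    (α_ (dual W ⊗ dual V) (V ⊗ W) (dual (V ⊗ W))).inv ≫
    nestedEvR V W ▷ dual (V ⊗ W) ≫ (λ_ (dual (V ⊗ W))).hom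

/-- The comparison `W^* ⊗ V^* ⟶ (V ⊗ W)^*` built from `coevL` and `evL`. -/
def dualTensorL (V W : C) : dual W ⊗ dual V ⟶ dual (V ⊗ W) :=
  (λ_ (dual W ⊗ dual V)).inv ≫ coevL (V ⊗ W) ▷ (dual W ⊗ dual V) ≫
    (α_ (dual (V ⊗ W)) (V ⊗ W) (dual W ⊗ dual V)).hom ≫
    dual (V ⊗ W) ◁ nestedEvL V W ≫ (ρ_ (dual (V ⊗ W))).hom

/-- Left partial trace of an endomorphism of `V ⊗ W`. -/
def ptrL {V W : C} (f : V ⊗ W ⟶ V ⊗ W) : W ⟶ W :=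
  (λ_ W).inv ≫ coevL V ▷ W ≫ (α_ (dual V) V W).hom ≫ dual V ◁ f ≫
    (α_ (dual V) V W).inv ≫ evR V ▷ W ≫ (λ_ W).hom

/-- Right partial trace of an endomorphism of `V ⊗ W`. -/
def ptrR {V W : C} (f : V ⊗ W ⟶ V ⊗ W) : V ⟶ V :=
  (ρ_ V).inv ≫ V ◁ coevR W ≫ (α_ V W (dual W)).inv ≫ f ▷ dual W ≫
    (α_ V W (dual W)).hom ≫ V ◁ evL W ≫ (ρ_ V).hom

end Pivotal

/-- Pivotal `k`-categories: left and right dualities whose dual objects, dual morphisms and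
comparison maps `W^* ⊗ V^* ⟶ (V ⊗ W)^*` coincide. -/
structure IsPivotalCategory (k : Type w) [Field k] (C : Type u) [Category.{v} C] [Preadditive C]
    [Linear k C] [MonoidalCategoryStruct C] [PivotalStruct C] : Prop
    extends IsTensorCategory k C where
  zigzagR : ∀ V : C, (λ_ V).inv ≫ coevR V ▷ V ≫ (α_ V (dual V) V).hom ≫ V ◁ evR V ≫
    (ρ_ V).hom = 𝟙 V
  zigzagR_dual : ∀ V : C, (ρ_ (dual V)).inv ≫ dual V ◁ coevR V ≫
    (α_ (dual V) V (dual V)).inv ≫ evR V ▷ dual V ≫ (λ_ (dual V)).hom = 𝟙 (dual V)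
  zigzagL : ∀ V : C, (ρ_ V).inv ≫ V ◁ coevL V ≫ (α_ V (dual V) V).inv ≫ evL V ▷ V ≫
    (λ_ V).hom = 𝟙 V
  zigzagL_dual : ∀ V : C, (λ_ (dual V)).inv ≫ coevL V ▷ dual V ≫
    (α_ (dual V) V (dual V)).hom ≫ dual V ◁ evL V ≫ (ρ_ (dual V)).hom = 𝟙 (dual V)
  dual_eq : ∀ {V W : C} (f : V ⟶ W), dualR f = dualL f
  dualTensor_eq : ∀ V W : C, dualTensorR V W = dualTensorL V W

/-- Hermitian pivotal categories. In a strict monoidal category the last three conditions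
say nothing. -/
structure IsHermitianPivotal (k : Type w) [Field k] [StarRing k] (C : Type u) [Category.{v} C]
    [Preadditive C] [Linear k C] [MonoidalCategoryStruct C] [PivotalStruct C] [DaggerStruct C] :
    Prop extends IsPivotalCategory k C where
  dag_smul : ∀ {V W : C} (a : k) (f : V ⟶ W), dag (a • f) = star a • dag f
  dag_comp : ∀ {U V W : C} (f : U ⟶ V) (g : V ⟶ W), dag (f ≫ g) = dag g ≫ dag f
  dag_tensor : ∀ {V V' W W' : C} (f : V ⟶ V') (g : W ⟶ W'), dag (f ⊗ₘ g) = dag f ⊗ₘ dag g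
  dag_dag : ∀ {V W : C} (f : V ⟶ W), dag (dag f) = f
  dag_coevR : ∀ V : C, dag (coevR V) = evL V
  dag_evR : ∀ V : C, dag (evR V) = coevL V
  dag_coevL : ∀ V : C, dag (coevL V) = evR V
  dag_evL : ∀ V : C, dag (evL V) = coevR V
  dag_associator : ∀ U V W : C, dag (α_ U V W).hom = (α_ U V W).inv
  dag_leftUnitor : ∀ V : C, dag (λ_ V).hom = (λ_ V).inv
  dag_rightUnitor : ∀ V : C, dag (ρ_ V).hom = (ρ_ V).inv

section Ribbon

variable {C : Type u} [Category.{v} C] [MonoidalCategory C] [BraidedCategory C] [PivotalStruct C]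

/-- The twist, as the right partial trace of the braiding. -/
def twistR (V : C) : V ⟶ V := ptrR (β_ V V).hom

/-- The twist, as the left partial trace of the braiding. -/
def twistL (V : C) : V ⟶ V := ptrL (β_ V V).hom

end Ribbon

/-- Hermitian ribbon categories. -/
structure IsHermitianRibbon (k : Type w) [Field k] [StarRing k] (C : Type u) [Category.{v} C]
    [Preadditive C] [Linear k C] [MonoidalCategory C] [BraidedCategory C] [PivotalStruct C]
    [DaggerStruct C] : Prop extends IsHermitianPivotal k C where
  ribbon : ∀ V : C, twistR V = twistL V
  dag_braiding : ∀ V W : C, dag (β_ V W).hom = (β_ V W).inv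

/-! ### Simple objects, gradings, semisimplicity -/

/-- `V` is simple: `End(V) = k · id` (in particular `V ≠ 0`). -/
def IsSimpleObj (k : Type w) [Field k] {C : Type u} [Category.{v} C] [Preadditive C]
    [Linear k C] (V : C) : Prop :=
  Function.Bijective (fun a : k => a • 𝟙 V)

/-- `V` is a finite direct sum of simple objects having the property `P`. -/
def IsSumOfSimples (k : Type w) [Field k] {C : Type u} [Category.{v} C] [Preadditive C]
    [Linear k C] (P : ObjectProperty C) (V : C) : Prop :=
  ∃ (n : ℕ) (S : Fin n → C) (i : ∀ j, S j ⟶ V) (p : ∀ j, V ⟶ S j),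
    (∀ j, IsSimpleObj k (S j) ∧ P (S j)) ∧ (∀ j, i j ≫ p j = 𝟙 (S j)) ∧
    (∀ j l, j ≠ l → i j ≫ p l = 0) ∧ ∑ j, p j ≫ i j = 𝟙 V

/-- The full subcategory of objects with the property `P` is semisimple: its objects are finite
direct sums of simple ones and there are no nonzero maps between nonisomorphic simple ones. -/
structure IsSemisimple (k : Type w) [Field k] {C : Type u} [Category.{v} C] [Preadditive C]
    [Linear k C] (P : ObjectProperty C) : Prop where
  sum_of_simples : ∀ V : C, P V → IsSumOfSimples k P V
  hom_eq_zero : ∀ S T : C, P S → P T → IsSimpleObj k S → IsSimpleObj k T →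
    IsEmpty (S ≅ T) → ∀ f : S ⟶ T, f = 0

/-- `R` is a (finite) representing set of the isomorphism classes of simple objects with the
property `P`. -/
structure IsRepresentingSet (k : Type w) [Field k] {C : Type u} [Category.{v} C] [Preadditive C]
    [Linear k C] (P : ObjectProperty C) (R : Finset C) : Prop where
  mem : ∀ V ∈ R, IsSimpleObj k V ∧ P V
  eq_of_iso : ∀ V ∈ R, ∀ W ∈ R, Nonempty (V ≅ W) → V = W
  exists_iso : ∀ V : C, IsSimpleObj k V → P V → ∃ W ∈ R, Nonempty (V ≅ W)

/-- A decomposition of `V` as a finite direct sum of homogeneous objects of distinct degrees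
(`component`, `incl` and `proj` are only relevant on the finite set `degrees`). -/
structure HomogDecomp {C : Type u} [Category.{v} C] [Preadditive C] {G : Type x}
    (deg : G → ObjectProperty C) (V : C) where
  degrees : Finset G
  component : G → C
  incl : ∀ g, component g ⟶ V
  proj : ∀ g, V ⟶ component g
  deg_component : ∀ g ∈ degrees, deg g (component g)
  incl_proj : ∀ g ∈ degrees, incl g ≫ proj g = 𝟙 (component g)
  incl_proj_ne : ∀ g ∈ degrees, ∀ h ∈ degrees, g ≠ h → incl g ≫ proj h = 0
  total : ∑ g ∈ degrees, proj g ≫ incl g = 𝟙 V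

/-- `C` is graded by the abelian group `G`, with homogeneous full subcategories given by `deg`. -/
structure IsGraded {C : Type u} [Category.{v} C] [Preadditive C] [MonoidalCategoryStruct C]
    {G : Type x} [AddCommGroup G] (deg : G → ObjectProperty C) : Prop where
  of_iso : ∀ (g : G) {V W : C}, (V ≅ W) → deg g V → deg g W
  exists_nonzero : ∀ g : G, ∃ V : C, deg g V ∧ 𝟙 V ≠ 0
  unit : deg 0 (𝟙_ C)
  decomp : ∀ V : C, Nonempty (HomogDecomp deg V)
  tensor : ∀ (g h : G) (V W : C), deg g V → deg h W → deg (g + h) (V ⊗ W)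
  hom_eq_zero : ∀ (g h : G) (V W : C), deg g V → deg h W → g ≠ h → ∀ f : V ⟶ W, f = 0

/-- A symmetric small subset of `G`: finitely many translates never cover `G`. -/
structure IsSymmetricSmall {G : Type x} [AddCommGroup G] (X : Set G) : Prop where
  symmetric : ∀ g ∈ X, -g ∈ X
  small : ∀ s : Finset G, ∃ g : G, ∀ h ∈ s, ∀ a ∈ X, g ≠ h + a

/-- Generically semisimple pivotal categories `(C, G, X)`. -/
structure IsGenericallySemisimple (k : Type w) [Field k] {C : Type u} [Category.{v} C]
    [Preadditive C] [Linear k C] [MonoidalCategoryStruct C] {G : Type x} [AddCommGroup G]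
    (X : Set G) (deg : G → ObjectProperty C) : Prop where
  graded : IsGraded deg
  small : IsSymmetricSmall X
  semisimple : ∀ g ∉ X, IsSemisimple k (deg g)

/-- Generic simple objects: simple objects of degree outside `X`. -/
def IsGenericSimple (k : Type w) [Field k] {C : Type u} [Category.{v} C] [Preadditive C]
    [Linear k C] {G : Type x} (X : Set G) (deg : G → ObjectProperty C) (V : C) : Prop :=
  IsSimpleObj k V ∧ ∃ g ∉ X, deg g V

/-! ### Modified traces -/

/-- Modified traces on the projective objects (the values of `t` on endomorphisms of
non-projective objects are irrelevant). -/
structure IsModifiedTrace (k : Type w) [Field k] {C : Type u} [Category.{v} C] [Preadditive C]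
    [Linear k C] [MonoidalCategoryStruct C] [PivotalStruct C]
    (t : ∀ V : C, (V ⟶ V) →ₗ[k] k) : Prop where
  right : ∀ U W : C, Projective U → ∀ f : U ⊗ W ⟶ U ⊗ W, t (U ⊗ W) f = t U (ptrR f)
  left : ∀ U W : C, Projective U → ∀ f : W ⊗ U ⟶ W ⊗ U, t (W ⊗ U) f = t U (ptrL f)
  cyclic : ∀ U V : C, Projective U → Projective V → ∀ (f : V ⟶ U) (g : U ⟶ V),
    t V (f ≫ g) = t U (g ≫ f)

/-- The trace is real: `t(f†)` is the conjugate of `t(f)`. -/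
def IsRealTrace {k : Type w} [Field k] [StarRing k] {C : Type u} [Category.{v} C] [Preadditive C]
    [Linear k C] [DaggerStruct C] (t : ∀ V : C, (V ⟶ V) →ₗ[k] k) : Prop :=
  ∀ V : C, Projective V → ∀ f : V ⟶ V, t V (dag f) = star (t V f)

/-! ### Relative Hermitian-premodular categories -/

section Premodular

variable {C : Type u} [Category.{v} C] [MonoidalCategory C] {Z : Type y} [AddCommGroup Z]
  (σ : Discrete Z ⥤ C) [σ.Monoidal]

/-- The structure isomorphism `σ_a ⊗ σ_b ≅ σ_{a+b}`. -/
def mulIso (a b : Z) : σ.obj ⟨a⟩ ⊗ σ.obj ⟨b⟩ ≅ σ.obj ⟨a + b⟩ :=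
  Functor.Monoidal.μIso σ ⟨a⟩ ⟨b⟩

/-- The structure isomorphism `𝟙 ≅ σ_0`. -/
def unitIso : 𝟙_ C ≅ σ.obj ⟨0⟩ :=
  Functor.Monoidal.εIso σ

/-- The identification `σ_a ⟶ σ_b` for `a = b`. -/
def castHom {a b : Z} (h : a = b) : σ.obj ⟨a⟩ ⟶ σ.obj ⟨b⟩ :=
  eqToHom (by rw [h])

end Premodular

/-- Bilinear maps `G × Z → kˣ`. -/
structure IsBilinear {k : Type w} [Field k] {G : Type x} [AddCommGroup G] {Z : Type y}
    [AddCommGroup Z] (ψ : G → Z → kˣ) : Prop where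
  add_left : ∀ g h a, ψ (g + h) a = ψ g a * ψ h a
  add_right : ∀ g a b, ψ g (a + b) = ψ g a * ψ g b

/-- `σ` is a free realization of `Z` in degree `0` of the ribbon category `C` (with dagger);
its monoidal structure isomorphisms are unitary, a condition that says nothing if `σ` is strict. -/
structure IsFreeRealization (k : Type w) [Field k] {C : Type u} [Category.{v} C] [Preadditive C]
    [Linear k C] [MonoidalCategory C] [BraidedCategory C] [PivotalStruct C] [DaggerStruct C]
    {G : Type x} [AddCommGroup G] {Z : Type y} [AddCommGroup Z] (deg : G → ObjectProperty C)
    (σ : Discrete Z ⥤ C) [σ.Monoidal] : Prop where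
  deg_zero : ∀ a : Z, deg 0 (σ.obj ⟨a⟩)
  twist : ∀ a : Z, twistR (σ.obj ⟨a⟩) = 𝟙 _
  free : ∀ (a : Z) (V : C), IsSimpleObj k V → Nonempty (V ⊗ σ.obj ⟨a⟩ ≅ V) → a = 0
  dag_mul : ∀ a b : Z, dag (mulIso σ a b).hom = (mulIso σ a b).inv
  dag_unit : dag (unitIso σ).hom = (unitIso σ).inv

/-- Relative Hermitian-premodular categories, with grading group `G`, singular set `X`,
translation group `Z`, free realization `σ`, compatibility map `ψ` and modified trace `t`. -/
structure IsRelativeHermitianPremodular (k : Type w) [Field k] [StarRing k] {C : Type u}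
    [Category.{v} C] [Preadditive C] [Linear k C] [MonoidalCategory C] [BraidedCategory C]
    [PivotalStruct C] [DaggerStruct C] {G : Type x} [AddCommGroup G] {Z : Type y} [AddCommGroup Z]
    (X : Set G) (deg : G → ObjectProperty C) (σ : Discrete Z ⥤ C) [σ.Monoidal]
    (ψ : G → Z → kˣ) (t : ∀ V : C, (V ⟶ V) →ₗ[k] k) : Prop
    extends IsHermitianRibbon k C, IsGenericallySemisimple k X deg where
  freeRealization : IsFreeRealization k deg σ
  trace : IsModifiedTrace k t
  trace_real : IsRealTrace t
  trace_ne_zero : ∃ V : C, Projective V ∧ t V ≠ 0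
  /-- Finitely many orbits: the generic `C_g` is dominated by `Θ ⊗ σ(Z)` with `Θ` finite. -/
  finite_orbits : ∀ g ∉ X, ∃ Θ : Finset C,
    (∀ V ∈ Θ, deg g V ∧ IsSimpleObj k V ∧ Projective V ∧ Epi (evR V)) ∧
    ∀ W : C, deg g W → 𝟙 W ∈ Submodule.span k
      {f : W ⟶ W | ∃ V ∈ Θ, ∃ (a : Z) (r : W ⟶ V ⊗ σ.obj ⟨a⟩) (s : V ⊗ σ.obj ⟨a⟩ ⟶ W), f = r ≫ s}
  bilinear : IsBilinear ψ
  compatibility : ∀ (g : G) (a : Z) (V : C), deg g V →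
    (β_ V (σ.obj ⟨a⟩)).hom ≫ (β_ (σ.obj ⟨a⟩) V).hom = (ψ g a : k) • 𝟙 (V ⊗ σ.obj ⟨a⟩)

/-- A bilinear square root of `ψ` with values in `{z | z̄ z = 1}`. -/
structure IsUnitSquareRoot {k : Type w} [Field k] [StarRing k] {G : Type x} [AddCommGroup G]
    {Z : Type y} [AddCommGroup Z] (ψ χ : G → Z → kˣ) : Prop where
  bilinear : IsBilinear χ
  unit : ∀ g a, star (χ g a : k) * (χ g a : k) = 1
  sq : ∀ g a, χ g a ^ 2 = ψ g a

/-- The free realization braids trivially: `c_{σ_a, σ_b}` is the identity of `σ_{a+b}`. -/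
def BraidsTrivially {C : Type u} [Category.{v} C] [MonoidalCategory C] [BraidedCategory C]
    {Z : Type y} [AddCommGroup Z] (σ : Discrete Z ⥤ C) [σ.Monoidal] : Prop :=
  ∀ a b : Z, (β_ (σ.obj ⟨a⟩) (σ.obj ⟨b⟩)).hom ≫ (mulIso σ b a).hom =
    (mulIso σ a b).hom ≫ castHom σ (add_comm a b)

/-! ### Relative Hermitian-spherical categories -/

/-- The conditions on the map `b : 𝖠 → kˣ` (only its values on the class `𝖠` of generic simple
objects are relevant). -/
structure IsBMap (k : Type w) [Field k] {C : Type u} [Category.{v} C] [Preadditive C]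
    [Linear k C] [MonoidalCategoryStruct C] [PivotalStruct C] {G : Type x} [AddCommGroup G]
    (X : Set G) (deg : G → ObjectProperty C) (b : C → k) : Prop where
  ne_zero : ∀ V, IsGenericSimple k X deg V → b V ≠ 0
  dual_eq : ∀ V, IsGenericSimple k X deg V → b (dual V) = b V
  iso : ∀ V W, IsGenericSimple k X deg V → IsGenericSimple k X deg W → Nonempty (V ≅ W) →
    b V = b W
  identity : ∀ g₁ g₂ : G, g₁ ∉ X → g₂ ∉ X → g₁ + g₂ ∉ X → ∀ R₁ R₂ : Finset C,
    IsRepresentingSet k (deg g₁) R₁ → IsRepresentingSet k (deg g₂) R₂ →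
    ∀ V : C, IsSimpleObj k V → deg (g₁ + g₂) V →
      b V = ∑ V₁ ∈ R₁, ∑ V₂ ∈ R₂, b V₁ * b V₂ * (Module.finrank k (V ⟶ V₁ ⊗ V₂) : k)

/-- Relative `G`-Hermitian-spherical categories. -/
structure IsRelativeHermitianSpherical (k : Type w) [Field k] [StarRing k] {C : Type u}
    [Category.{v} C] [Preadditive C] [Linear k C] [MonoidalCategoryStruct C] [PivotalStruct C]
    [DaggerStruct C] {G : Type x} [AddCommGroup G] (X : Set G) (deg : G → ObjectProperty C) : Prop
    extends IsHermitianPivotal k C, IsGenericallySemisimple k X deg where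
  finite : ∀ g ∉ X, ∃ R : Finset C, IsRepresentingSet k (deg g) R
  exists_trace : ∃ t : ∀ V : C, (V ⟶ V) →ₗ[k] k, IsModifiedTrace k t ∧ IsRealTrace t ∧
    ∀ V, IsGenericSimple k X deg V → Projective V ∧ t V (𝟙 V) ≠ 0
  exists_b : ∃ b : C → k, IsBMap k X deg b

/-! ### The category `C^Z` -/

section Twist

variable {k : Type w} [Field k] {C : Type u} [Category.{v} C] [Preadditive C] [Linear k C]
  {G : Type x} (deg : G → ObjectProperty C)

open Classical in
/-- The endomorphism of `V` acting by the scalar `c g` on the component of degree `g`. -/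
noncomputable def degreeScalar (c : G → k) (V : C) : V ⟶ V :=
  if h : Nonempty (HomogDecomp deg V) then
    ∑ g ∈ h.some.degrees, c g • (h.some.proj g ≫ h.some.incl g)
  else 0

variable [MonoidalCategory C] [BraidedCategory C] {Z : Type y} (χ : G → Z → kˣ) (σ : Discrete Z ⥤ C)

/-- The half braiding `X_{V, σ_a} : V ⊗ σ_a ⟶ σ_a ⊗ V`, which on the component of degree `g` of `V`
is `χ(g, a)⁻¹ c_{V, σ_a}`. -/
noncomputable def halfBraiding (V : C) (a : Z) : V ⊗ σ.obj ⟨a⟩ ⟶ σ.obj ⟨a⟩ ⊗ V :=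
  degreeScalar deg (fun g => ((χ g a)⁻¹ : kˣ) : G → k) V ▷ σ.obj ⟨a⟩ ≫ (β_ V (σ.obj ⟨a⟩)).hom

end Twist

/-- The objects of `C^Z` are those of `C`. -/
structure TransCat {k : Type w} [Field k] {C : Type u} [Category.{v} C] {G : Type x} {Z : Type y}
    (deg : G → ObjectProperty C) (χ : G → Z → kˣ) (σ : Discrete Z ⥤ C) where
  base : C

namespace TransCat

section Homogeneous

variable {C : Type u} [Category.{v} C] [Preadditive C] [MonoidalCategory C]
  [MonoidalPreadditive C] {Z : Type y} [AddCommGroup Z] (σ : Discrete Z ⥤ C) [σ.Monoidal]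

/-- `Hom(V, W)` in `C^Z` is the direct sum over `a` of `Hom(V, σ_a ⊗ W)`. -/
abbrev GrHom (V W : C) : Type (max y v) := ⨁ a : Z, (V ⟶ σ.obj ⟨a⟩ ⊗ W)

variable {σ}

/-- Composition of homogeneous morphisms. -/
def homComp {U V W : C} {a b : Z} (f : U ⟶ σ.obj ⟨a⟩ ⊗ V) (g : V ⟶ σ.obj ⟨b⟩ ⊗ W) :
    U ⟶ σ.obj ⟨a + b⟩ ⊗ W :=
  f ≫ σ.obj ⟨a⟩ ◁ g ≫ (α_ _ _ _).inv ≫ (mulIso σ a b).hom ▷ W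

/-- `homComp` as a biadditive map. -/
def homCompHom (U V W : C) (a b : Z) :
    (U ⟶ σ.obj ⟨a⟩ ⊗ V) →+ (V ⟶ σ.obj ⟨b⟩ ⊗ W) →+ (U ⟶ σ.obj ⟨a + b⟩ ⊗ W) :=
  AddMonoidHom.mk' (fun f => AddMonoidHom.mk' (fun g => homComp f g)
    (by intro g g'; simp [homComp]))
    (by intro f f'; ext g; simp [homComp])

lemma castHom_eq_map {a b : Z} (h : a = b) (f : (⟨a⟩ : Discrete Z) ⟶ ⟨b⟩) :
    castHom σ h = σ.map f := by
  subst h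
  rw [Subsingleton.elim f (𝟙 _)]
  simp [castHom]

lemma unit_mul (b : Z) : (unitIso σ).hom ▷ σ.obj ⟨b⟩ ≫
    (mulIso σ 0 b).hom ≫ castHom σ (zero_add b) = (λ_ _).hom := by
  rw [castHom_eq_map (zero_add b) (λ_ (⟨b⟩ : Discrete Z)).hom]
  exact (Functor.LaxMonoidal.left_unitality σ ⟨b⟩).symm

lemma mul_unit (a : Z) : σ.obj ⟨a⟩ ◁ (unitIso σ).hom ≫
    (mulIso σ a 0).hom ≫ castHom σ (add_zero a) = (ρ_ _).hom := by
  rw [castHom_eq_map (add_zero a) (ρ_ (⟨a⟩ : Discrete Z)).hom]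
  exact (Functor.LaxMonoidal.right_unitality σ ⟨a⟩).symm

lemma mul_assoc_eq (a b c : Z) : (mulIso σ a b).hom ▷ σ.obj ⟨c⟩ ≫ (mulIso σ (a + b) c).hom ≫
    castHom σ (add_assoc a b c) =
    (α_ _ _ _).hom ≫ σ.obj ⟨a⟩ ◁ (mulIso σ b c).hom ≫ (mulIso σ a (b + c)).hom := by
  rw [castHom_eq_map (add_assoc a b c) (α_ (⟨a⟩ : Discrete Z) ⟨b⟩ ⟨c⟩).hom]
  exact Functor.LaxMonoidal.associativity σ ⟨a⟩ ⟨b⟩ ⟨c⟩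

variable [DecidableEq Z]

/-- Composition in `C^Z`. -/
noncomputable def grComp (U V W : C) : GrHom σ U V →+ GrHom σ V W →+ GrHom σ U W :=
  DirectSum.toAddMonoid fun a => AddMonoidHom.flip <| DirectSum.toAddMonoid fun b =>
    AddMonoidHom.flip <| (DirectSum.of (fun c : Z => (U ⟶ σ.obj ⟨c⟩ ⊗ W)) (a + b)).compHom.comp <|
      homCompHom U V W a b

@[simp]
lemma grComp_of_of {U V W : C} {a b : Z} (f : U ⟶ σ.obj ⟨a⟩ ⊗ V) (g : V ⟶ σ.obj ⟨b⟩ ⊗ W) :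
    grComp U V W (DirectSum.of (fun c : Z => (U ⟶ σ.obj ⟨c⟩ ⊗ V)) a f)
      (DirectSum.of (fun c : Z => (V ⟶ σ.obj ⟨c⟩ ⊗ W)) b g) =
    DirectSum.of (fun c : Z => (U ⟶ σ.obj ⟨c⟩ ⊗ W)) (a + b) (homComp f g) := by
  simp [grComp, homCompHom]
  rfl

/-- A morphism of `C`, as a homogeneous morphism of degree zero. -/
def homEmbed {V W : C} (f : V ⟶ W) : V ⟶ σ.obj ⟨0⟩ ⊗ W :=
  f ≫ (λ_ W).inv ≫ (unitIso σ).hom ▷ W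

lemma of_eq_of {V W : C} {a b : Z} (h : a = b) (f : V ⟶ σ.obj ⟨a⟩ ⊗ W) (g : V ⟶ σ.obj ⟨b⟩ ⊗ W)
    (hfg : f ≫ castHom σ h ▷ W = g) :
    DirectSum.of (fun c : Z => (V ⟶ σ.obj ⟨c⟩ ⊗ W)) a f =
      DirectSum.of (fun c : Z => (V ⟶ σ.obj ⟨c⟩ ⊗ W)) b g := by
  subst h
  simp only [castHom, eqToHom_refl, id_whiskerRight, Category.comp_id] at hfg
  rw [hfg]

lemma homEmbed_comp {V W U : C} {b : Z} (f : V ⟶ W) (g : W ⟶ σ.obj ⟨b⟩ ⊗ U) :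
    homComp (homEmbed f) g ≫ castHom σ (zero_add b) ▷ U = f ≫ g := by
  have h : (unitIso σ).hom ▷ (σ.obj ⟨b⟩ ⊗ U) ≫ (α_ _ _ _).inv ≫ (mulIso σ 0 b).hom ▷ U ≫
      castHom σ (zero_add b) ▷ U = (λ_ _).hom := by
    have := congrArg (fun q => (α_ _ _ _).inv ≫ q ▷ U) (unit_mul (σ := σ) b)
    simpa [-Functor.LaxMonoidal.left_unitality, -Functor.LaxMonoidal.right_unitality] using this
  simp only [homComp, homEmbed, Category.assoc]
  rw [← whisker_exchange_assoc, h]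
  simp

lemma comp_homEmbed {V W U : C} {a : Z} (f : V ⟶ σ.obj ⟨a⟩ ⊗ W) (g : W ⟶ U) :
    homComp f (homEmbed g) ≫ castHom σ (add_zero a) ▷ U = f ≫ σ.obj ⟨a⟩ ◁ g := by
  have h : σ.obj ⟨a⟩ ◁ (λ_ U).inv ≫ σ.obj ⟨a⟩ ◁ ((unitIso σ).hom ▷ U) ≫ (α_ _ _ _).inv ≫
      (mulIso σ a 0).hom ▷ U ≫ castHom σ (add_zero a) ▷ U = 𝟙 _ := by
    have := congrArg (fun q => σ.obj ⟨a⟩ ◁ (λ_ U).inv ≫ (α_ _ _ _).inv ≫ q ▷ U)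
      (mul_unit (σ := σ) a)
    simpa [-Functor.LaxMonoidal.left_unitality, -Functor.LaxMonoidal.right_unitality] using this
  simp only [homComp, homEmbed, Category.assoc, MonoidalCategory.whiskerLeft_comp]
  rw [h]
  simp

lemma homComp_assoc {U V W T : C} {a b c : Z} (f : U ⟶ σ.obj ⟨a⟩ ⊗ V) (g : V ⟶ σ.obj ⟨b⟩ ⊗ W)
    (h : W ⟶ σ.obj ⟨c⟩ ⊗ T) :
    homComp (homComp f g) h ≫ castHom σ (add_assoc a b c) ▷ T = homComp f (homComp g h) := by
  have key : (mulIso σ a b).hom ▷ (σ.obj ⟨c⟩ ⊗ T) ≫ (α_ _ _ _).inv ≫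
      (mulIso σ (a + b) c).hom ▷ T ≫ castHom σ (add_assoc a b c) ▷ T =
      (α_ _ _ _).inv ≫ (α_ _ _ _).hom ▷ T ≫ (σ.obj ⟨a⟩ ◁ (mulIso σ b c).hom) ▷ T ≫
        (mulIso σ a (b + c)).hom ▷ T := by
    have := congrArg (fun q => (α_ _ _ _).inv ≫ q ▷ T) (mul_assoc_eq (σ := σ) a b c)
    simpa [-Functor.LaxMonoidal.left_unitality, -Functor.LaxMonoidal.right_unitality] using this
  simp only [homComp, Category.assoc, MonoidalCategory.whiskerLeft_comp]
  rw [← whisker_exchange_assoc, key]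
  simp

/-- Identity morphisms in `C^Z`. -/
noncomputable def grId (V : C) : GrHom σ V V :=
  DirectSum.of (fun c : Z => (V ⟶ σ.obj ⟨c⟩ ⊗ V)) 0 (homEmbed (𝟙 V))

lemma grId_comp {V W : C} (f : GrHom σ V W) : grComp V V W (grId V) f = f := by
  suffices grComp V V W (grId V) = AddMonoidHom.id (GrHom σ V W) from DFunLike.congr_fun this f
  apply DirectSum.addHom_ext
  intro b g
  rw [grId, grComp_of_of]
  exact of_eq_of (zero_add b) _ _ (by rw [homEmbed_comp, Category.id_comp])

lemma grComp_id {V W : C} (f : GrHom σ V W) : grComp V W W f (grId W) = f := by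
  suffices (grComp V W W).flip (grId W) = AddMonoidHom.id (GrHom σ V W) from
    DFunLike.congr_fun this f
  apply DirectSum.addHom_ext
  intro a f
  rw [AddMonoidHom.flip_apply, grId, grComp_of_of]
  exact of_eq_of (add_zero a) _ _ (by rw [comp_homEmbed]; simp)

lemma grComp_assoc {U V W T : C} (f : GrHom σ U V) (g : GrHom σ V W) (h : GrHom σ W T) :
    grComp U W T (grComp U V W f g) h = grComp U V T f (grComp V W T g h) := by
  induction f using DirectSum.induction_on with
  | zero => simp
  | add f f' hf hf' => simp [hf, hf']
  | of a f =>
    induction g using DirectSum.induction_on with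
    | zero => simp
    | add g g' hg hg' => simp only [map_add, AddMonoidHom.add_apply, hg, hg']
    | of b g =>
      induction h using DirectSum.induction_on with
      | zero => simp
      | add h h' hh hh' => simp only [map_add, hh, hh']
      | of c h =>
        simp only [grComp_of_of]
        exact of_eq_of (add_assoc a b c) _ _ (homComp_assoc f g h)

lemma grComp_embed {U V W : C} (f : U ⟶ V) (g : V ⟶ W) :
    grComp U V W (DirectSum.of (fun c : Z => (U ⟶ σ.obj ⟨c⟩ ⊗ V)) 0 (homEmbed f))
      (DirectSum.of (fun c : Z => (V ⟶ σ.obj ⟨c⟩ ⊗ W)) 0 (homEmbed g)) =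
    DirectSum.of (fun c : Z => (U ⟶ σ.obj ⟨c⟩ ⊗ W)) 0 (homEmbed (f ≫ g)) := by
  rw [grComp_of_of]
  exact of_eq_of (zero_add 0) _ _ (by rw [homEmbed_comp]; simp [homEmbed])

end Homogeneous

section Linear

variable {k : Type w} [Field k] {C : Type u} [Category.{v} C] [Preadditive C] [Linear k C]
  [MonoidalCategory C] [MonoidalPreadditive C] [MonoidalLinear k C] {Z : Type y} [AddCommGroup Z]
  {σ : Discrete Z ⥤ C} [σ.Monoidal] [DecidableEq Z]

lemma smul_of (r : k) {V W : C} {a : Z} (f : V ⟶ σ.obj ⟨a⟩ ⊗ W) :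
    r • DirectSum.of (fun c : Z => (V ⟶ σ.obj ⟨c⟩ ⊗ W)) a f =
      DirectSum.of (fun c : Z => (V ⟶ σ.obj ⟨c⟩ ⊗ W)) a (r • f) :=
  ((DirectSum.lof k Z (fun c : Z => (V ⟶ σ.obj ⟨c⟩ ⊗ W)) a).map_smul r f).symm

lemma smul_grComp (r : k) {U V W : C} (f : GrHom σ U V) (g : GrHom σ V W) :
    grComp U V W (r • f) g = r • grComp U V W f g := by
  induction f using DirectSum.induction_on with
  | zero => simp
  | add f f' hf hf' => simp only [smul_add, map_add, AddMonoidHom.add_apply, hf, hf']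
  | of a f =>
    induction g using DirectSum.induction_on with
    | zero => simp
    | add g g' hg hg' => simp only [smul_add, map_add, hg, hg']
    | of b g =>
      rw [smul_of, grComp_of_of, grComp_of_of, smul_of]
      simp [homComp]

lemma grComp_smul (r : k) {U V W : C} (f : GrHom σ U V) (g : GrHom σ V W) :
    grComp U V W f (r • g) = r • grComp U V W f g := by
  induction f using DirectSum.induction_on with
  | zero => simp
  | add f f' hf hf' => simp only [smul_add, map_add, AddMonoidHom.add_apply, hf, hf']
  | of a f =>
    induction g using DirectSum.induction_on with
    | zero => simp
    | add g g' hg hg' => simp only [smul_add, map_add, hg, hg']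
    | of b g =>
      rw [smul_of, grComp_of_of, grComp_of_of, smul_of]
      simp [homComp]

end Linear

section Instances

variable {k : Type w} [Field k] {C : Type u} [Category.{v} C] [Preadditive C] [Linear k C]
  [MonoidalCategory C] [MonoidalPreadditive C] [MonoidalLinear k C]
  {G : Type x} {Z : Type y} [AddCommGroup Z] [DecidableEq Z]
  {deg : G → ObjectProperty C} {χ : G → Z → kˣ} {σ : Discrete Z ⥤ C} [σ.Monoidal]

noncomputable instance : Category.{max y v} (TransCat deg χ σ) where
  Hom V W := GrHom σ V.base W.base
  id V := grId V.base
  comp {U V W} f g := grComp U.base V.base W.base f g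
  id_comp := grId_comp
  comp_id := grComp_id
  assoc := grComp_assoc

noncomputable instance : Preadditive (TransCat deg χ σ) where
  homGroup V W := inferInstanceAs (AddCommGroup (GrHom σ V.base W.base))
  add_comp U V W f f' g :=
    DFunLike.congr_fun ((grComp (σ := σ) U.base V.base W.base).map_add f f') g
  comp_add U V W f g g' := (grComp (σ := σ) U.base V.base W.base f).map_add g g'

noncomputable instance : Linear k (TransCat deg χ σ) where
  homModule V W := inferInstanceAs (Module k (GrHom σ V.base W.base))
  smul_comp _ _ _ r f g := smul_grComp r f g
  comp_smul _ _ _ f r g := grComp_smul r f g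

/-- The homogeneous morphism of degree `a` given by `f : V ⟶ σ_a ⊗ W`. -/
noncomputable def homOf {V W : TransCat deg χ σ} (a : Z) : (V.base ⟶ σ.obj ⟨a⟩ ⊗ W.base) →+ (V ⟶ W) :=
  DirectSum.of (fun c : Z => (V.base ⟶ σ.obj ⟨c⟩ ⊗ W.base)) a

/-- The embedding `C ⥤ C^Z` onto the morphisms of degree zero. -/
noncomputable def embed (deg : G → ObjectProperty C) (χ : G → Z → kˣ) (σ : Discrete Z ⥤ C)
    [σ.Monoidal] : C ⥤ TransCat deg χ σ where
  obj V := ⟨V⟩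
  map {V W} f := homOf (V := ⟨V⟩) (W := ⟨W⟩) 0 (homEmbed f)
  map_comp f g := (grComp_embed f g).symm

section Tensor

variable [BraidedCategory C]

/-- The tensor product of homogeneous morphisms. -/
noncomputable def homTensor (deg : G → ObjectProperty C) (χ : G → Z → kˣ) {V₁ V₂ V₃ V₄ : C}
    {a b : Z} (f : V₁ ⟶ σ.obj ⟨a⟩ ⊗ V₂) (h : V₃ ⟶ σ.obj ⟨b⟩ ⊗ V₄) :
    V₁ ⊗ V₃ ⟶ σ.obj ⟨a + b⟩ ⊗ (V₂ ⊗ V₄) :=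
  (f ⊗ₘ h) ≫ (α_ _ _ _).hom ≫
    σ.obj ⟨a⟩ ◁ ((α_ _ _ _).inv ≫ halfBraiding deg χ σ V₂ b ▷ V₄ ≫ (α_ _ _ _).hom) ≫
    (α_ _ _ _).inv ≫ (mulIso σ a b).hom ▷ (V₂ ⊗ V₄)

/-- `homTensor` as a biadditive map. -/
noncomputable def homTensorHom (deg : G → ObjectProperty C) (χ : G → Z → kˣ) (σ : Discrete Z ⥤ C)
    [σ.Monoidal] (V₁ V₂ V₃ V₄ : C) (a b : Z) :
    (V₁ ⟶ σ.obj ⟨a⟩ ⊗ V₂) →+ (V₃ ⟶ σ.obj ⟨b⟩ ⊗ V₄) →+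
      (V₁ ⊗ V₃ ⟶ σ.obj ⟨a + b⟩ ⊗ (V₂ ⊗ V₄)) :=
  AddMonoidHom.mk' (fun f => AddMonoidHom.mk' (fun h => homTensor deg χ f h)
    (by intro h h'; simp [homTensor, MonoidalPreadditive.tensor_add]))
    (by intro f f'; ext h; simp [homTensor, MonoidalPreadditive.add_tensor])

/-- The tensor product of morphisms of `C^Z`. -/
noncomputable def tensor (V₁ V₂ V₃ V₄ : TransCat deg χ σ) :
    (V₁ ⟶ V₂) →+ (V₃ ⟶ V₄) →+ ((⟨V₁.base ⊗ V₃.base⟩ : TransCat deg χ σ) ⟶ ⟨V₂.base ⊗ V₄.base⟩) :=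
  DirectSum.toAddMonoid fun a => AddMonoidHom.flip <| DirectSum.toAddMonoid fun b =>
    AddMonoidHom.flip <| (homOf (V := (⟨V₁.base ⊗ V₃.base⟩ : TransCat deg χ σ))
      (W := ⟨V₂.base ⊗ V₄.base⟩) (a + b)).compHom.comp <|
        homTensorHom deg χ σ V₁.base V₂.base V₃.base V₄.base a b

noncomputable instance : MonoidalCategoryStruct (TransCat deg χ σ) where
  tensorObj V W := ⟨V.base ⊗ W.base⟩
  whiskerLeft V _ _ f := tensor V V _ _ (𝟙 V) f
  whiskerRight f W := tensor _ _ W W f (𝟙 W)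
  tensorHom f g := tensor _ _ _ _ f g
  tensorUnit := ⟨𝟙_ C⟩
  associator U V W := (embed deg χ σ).mapIso (α_ U.base V.base W.base)
  leftUnitor V := (embed deg χ σ).mapIso (λ_ V.base)
  rightUnitor V := (embed deg χ σ).mapIso (ρ_ V.base)

noncomputable instance [PivotalStruct C] : PivotalStruct (TransCat deg χ σ) where
  dual V := ⟨dual V.base⟩
  coevR V := (embed deg χ σ).map (coevR V.base)
  evR V := (embed deg χ σ).map (evR V.base)
  coevL V := (embed deg χ σ).map (coevL V.base)
  evL V := (embed deg χ σ).map (evL V.base)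

end Tensor

section Dagger

variable [DaggerStruct C]

/-- The left coevaluation `𝟙 ⟶ σ_{-a} ⊗ σ_a`, where `σ_{-a}` is identified with the dual of `σ_a` in the
canonical way, for which all (co)evaluations become structure isomorphisms of `σ`. -/
def coevTrans (σ : Discrete Z ⥤ C) [σ.Monoidal] (a : Z) : 𝟙_ C ⟶ σ.obj ⟨-a⟩ ⊗ σ.obj ⟨a⟩ :=
  (unitIso σ).hom ≫ castHom σ (neg_add_cancel a).symm ≫ (mulIso σ (-a) a).inv

/-- The dagger of a homogeneous morphism of degree `a`, which has degree `-a`. -/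
def homDag {V W : C} {a : Z} (f : V ⟶ σ.obj ⟨a⟩ ⊗ W) : W ⟶ σ.obj ⟨-a⟩ ⊗ V :=
  (λ_ W).inv ≫ coevTrans σ a ▷ W ≫ (α_ _ _ _).hom ≫ σ.obj ⟨-a⟩ ◁ dag f

/-- `homDag` as an additive map. -/
def homDagHom (σ : Discrete Z ⥤ C) [σ.Monoidal] (V W : C) (a : Z) :
    (V ⟶ σ.obj ⟨a⟩ ⊗ W) →+ (W ⟶ σ.obj ⟨-a⟩ ⊗ V) :=
  AddMonoidHom.mk' (fun f => homDag f) (by intro f g; simp [homDag])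

noncomputable instance : DaggerStruct (TransCat deg χ σ) where
  dag {V W} := DirectSum.toAddMonoid fun a =>
    (homOf (V := W) (W := V) (-a)).comp (homDagHom σ V.base W.base a)

end Dagger

/-- The grading of `C^Z`: the homogeneous objects are those of `C`. -/
def degree (deg : G → ObjectProperty C) (χ : G → Z → kˣ) (σ : Discrete Z ⥤ C) [σ.Monoidal] :
    G → ObjectProperty (TransCat deg χ σ) :=
  fun g V => deg g V.base

end Instances

end TransCat

end HermCat

/-! In `C^Z` every translation object becomes a copy of the unit. The inverse right unitor of σ_a,
read as a morphism σ_a → 𝟙 of degree a, is invertible (`transIso`), and so is the identity of σ_a ⊗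
W, read as a morphism to W of degree a (`shiftIso`). Every homogeneous morphism is a morphism of `C`
followed by such a shift (`homOf_eq_incl_comp`). All operations are additive, so an axiom has to be
checked only on morphisms of `C`, where it is known, and on shifts.

Monoidal structure: the half braiding is natural and multiplicative in both variables
(`halfBraiding_tensor`, `halfBraiding_add`), by the two hexagons and the bilinearity of χ. The
interchange law `homWhisker_exchange` moreover needs a crossing of σ_a with σ_b to disappear, which
is the triviality of the braiding on the realization.

Dagger and duality: shifts are unitary by the very definition of the dagger. Since χ has modulus one
and the braiding is unitary, half braidings are unitary, so the dagger respects left whiskering of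
shifts. The two duals of a shift agree because σ_a has dimension one (`IsCentral.dimR_trans`), a
consequence of its trivial twist and trivial self-braiding (`HasZigzags.dual_eq_of_iso`).

Semisimplicity and finiteness: for S generic simple, σ_a ⊗ S is simple and, for a ≠ 0, not
isomorphic to S by freeness; hence S acquires no new endomorphisms in `C^Z`. Objects of one Z-orbit
become isomorphic, so the finite sets Θ_g represent all generic simple objects. The unit need not be
generic; there the vanishing of Hom(𝟙, σ_a) follows by tensoring with an object of Θ_g, whose
evaluation is epic (`unit_hom_trans_eq_zero`).

Trace: take t of the component of degree zero. Cyclicity for shifts says that t on σ_a ⊗ V of σ_a ◁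
f is t of f, again because σ_a has dimension one (`zeroTrace_shift`). Generic objects are projective
by a separation argument with linear functionals (`IsSemisimple.projective`). Their dimensions do
not vanish: by orbits it suffices to treat V in Θ_g, and if t vanished on 𝟙 V then every projective
P, being a retract of V^* ⊗ V ⊗ P, would have zero trace (`trace_id_ne_zero_of_epi`). The b-map is
part of the data. -/

namespace HermCat

open PivotalStruct DaggerStruct

/-! ### Scalars depending on the degree -/

section DegreeScalar

variable {k : Type w} [Field k] {C : Type u} [Category.{v} C] [Preadditive C] [Linear k C]
  [MonoidalCategory C] {G : Type x} [AddCommGroup G] {deg : G → ObjectProperty C}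

lemma IsGraded.hom_ext (h : IsGraded deg) {V W : C} {f f' : V ⟶ W}
    (hf : ∀ (g : G) (A : C), deg g A → ∀ x : A ⟶ V, x ≫ f = x ≫ f') : f = f' := by
  obtain ⟨d⟩ := h.decomp V
  rw [← Category.id_comp f, ← Category.id_comp f', ← d.total, Preadditive.sum_comp,
    Preadditive.sum_comp]
  refine Finset.sum_congr rfl fun g hg => ?_
  rw [Category.assoc, Category.assoc, hf g _ (d.deg_component g hg)]

/-- Only the component of degree g receives maps from an object of degree g. This describes the
endomorphism independently of the chosen decomposition, and the later identities rest on it. -/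
lemma comp_degreeScalar_of_deg (h : IsGraded deg) (c : G → k) {A V : C} {g : G} (hA : deg g A)
    (x : A ⟶ V) : x ≫ degreeScalar deg c V = c g • x := by
  have hV := h.decomp V
  rw [degreeScalar, dif_pos hV, Preadditive.comp_sum]
  conv_rhs => rw [← Category.comp_id x, ← hV.some.total, Preadditive.comp_sum, Finset.smul_sum]
  refine Finset.sum_congr rfl fun g' hg' => ?_
  by_cases hgg : g = g'
  · subst hgg
    simp
  · rw [Linear.comp_smul, ← Category.assoc,
      h.hom_eq_zero g g' _ _ hA (hV.some.deg_component g' hg') hgg (x ≫ hV.some.proj g')]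
    simp

lemma degreeScalar_of_deg (h : IsGraded deg) (c : G → k) {V : C} {g : G} (hV : deg g V) :
    degreeScalar deg c V = c g • 𝟙 V := by
  rw [← Category.id_comp (degreeScalar deg c V), comp_degreeScalar_of_deg h c hV]

lemma degreeScalar_unique (h : IsGraded deg) (c : G → k) {V : C} (y : V ⟶ V)
    (hy : ∀ (g : G) (A : C), deg g A → ∀ x : A ⟶ V, x ≫ y = c g • x) :
    y = degreeScalar deg c V :=
  h.hom_ext fun g A hA x => by rw [hy g A hA, comp_degreeScalar_of_deg h c hA]

lemma degreeScalar_naturality (h : IsGraded deg) (c : G → k) {V W : C} (f : V ⟶ W) :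
    degreeScalar deg c V ≫ f = f ≫ degreeScalar deg c W :=
  h.hom_ext fun g A hA x => by
    rw [← Category.assoc, ← Category.assoc, comp_degreeScalar_of_deg h c hA,
      comp_degreeScalar_of_deg h c hA, Linear.smul_comp]

lemma degreeScalar_one (h : IsGraded deg) (V : C) :
    degreeScalar deg (fun _ => (1 : k)) V = 𝟙 V :=
  (degreeScalar_unique h _ _ fun g A hA x => by simp).symm

lemma degreeScalar_mul (h : IsGraded deg) (c d : G → k) (V : C) :
    degreeScalar deg c V ≫ degreeScalar deg d V = degreeScalar deg (fun g => c g * d g) V :=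
  degreeScalar_unique h _ _ fun g A hA x => by
    rw [← Category.assoc, comp_degreeScalar_of_deg h c hA, Linear.smul_comp,
      comp_degreeScalar_of_deg h d hA, smul_smul]

variable [MonoidalPreadditive C] [MonoidalLinear k C]

/-- Decompositions of the two factors together decompose the tensor product, so nothing need be
known about the decomposition chosen for V ⊗ W itself. -/
lemma IsGraded.tensor_hom_ext (h : IsGraded deg) {V W T : C} {f f' : V ⊗ W ⟶ T}
    (hf : ∀ (g g' : G) (A B : C), deg g A → deg g' B → ∀ (x : A ⟶ V) (y : B ⟶ W),
      (x ⊗ₘ y) ≫ f = (x ⊗ₘ y) ≫ f') : f = f' := by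
  obtain ⟨d⟩ := h.decomp V
  obtain ⟨e⟩ := h.decomp W
  have key : 𝟙 (V ⊗ W) = ∑ g ∈ d.degrees, ∑ g' ∈ e.degrees,
      (d.proj g ⊗ₘ e.proj g') ≫ (d.incl g ⊗ₘ e.incl g') := by
    rw [← id_tensorHom_id, ← d.total, ← e.total, sum_tensor]
    refine Finset.sum_congr rfl fun g _ => ?_
    rw [tensor_sum]
    exact Finset.sum_congr rfl fun g' _ => (tensorHom_comp_tensorHom ..).symm
  rw [← Category.id_comp f, ← Category.id_comp f', key]
  simp only [Preadditive.sum_comp, Category.assoc]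
  refine Finset.sum_congr rfl fun g hg => Finset.sum_congr rfl fun g' hg' => ?_
  rw [hf g g' _ _ (d.deg_component g hg) (e.deg_component g' hg')]

lemma degreeScalar_tensor (h : IsGraded deg) (c : G → k) (hc : ∀ g g', c (g + g') = c g * c g')
    (V W : C) :
    degreeScalar deg c (V ⊗ W) = degreeScalar deg c V ⊗ₘ degreeScalar deg c W :=
  h.tensor_hom_ext fun g g' A B hA hB x y => by
    rw [comp_degreeScalar_of_deg h c (h.tensor g g' A B hA hB), tensorHom_comp_tensorHom,
      comp_degreeScalar_of_deg h c hA, comp_degreeScalar_of_deg h c hB, hc,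
      ← smul_smul, MonoidalCategory.tensorHom_def, MonoidalCategory.tensorHom_def (c g • x),
      MonoidalLinear.smul_whiskerRight, MonoidalLinear.whiskerLeft_smul, Linear.comp_smul,
      Linear.smul_comp, smul_comm]

end DegreeScalar

section Dag

variable {k : Type w} [Field k] [StarRing k] {C : Type u} [Category.{v} C] [Preadditive C]
  [Linear k C] [MonoidalCategory C] [PivotalStruct C] [DaggerStruct C]
  {G : Type x} [AddCommGroup G] {deg : G → ObjectProperty C}

lemma IsHermitianPivotal.dag_id (hC : IsHermitianPivotal k C) (V : C) : dag (𝟙 V) = 𝟙 V := by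
  have := hC.dag_comp (dag (𝟙 V)) (𝟙 V)
  rw [Category.comp_id, hC.dag_dag, Category.comp_id] at this
  exact this.symm

/-- Under the dagger and naturality the scalar moves to a homogeneous object, where it is a number;
antilinearity conjugates it. -/
lemma dag_degreeScalar (hC : IsHermitianPivotal k C) (h : IsGraded deg) (c : G → k) (V : C) :
    dag (degreeScalar deg c V) = degreeScalar deg (fun g => star (c g)) V :=
  degreeScalar_unique h _ _ fun g A hA x => by
    rw [← hC.dag_dag x, ← hC.dag_comp, degreeScalar_naturality h, degreeScalar_of_deg h _ hA,
      Linear.comp_smul, Category.comp_id, hC.dag_smul]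

end Dag

/-! ### The half braidings with the translation objects -/

section HalfBraiding

variable {k : Type w} [Field k] {C : Type u} [Category.{v} C] [Preadditive C] [Linear k C]
  [MonoidalCategory C] [MonoidalPreadditive C] [MonoidalLinear k C] [BraidedCategory C]
  {G : Type x} [AddCommGroup G] {deg : G → ObjectProperty C}
  {Z : Type y} [AddCommGroup Z] {χ : G → Z → kˣ} {σ : Discrete Z ⥤ C}

lemma halfBraiding_naturality (h : IsGraded deg) {V W : C} (f : V ⟶ W) (a : Z) :
    f ▷ σ.obj ⟨a⟩ ≫ halfBraiding deg χ σ W a = halfBraiding deg χ σ V a ≫ σ.obj ⟨a⟩ ◁ f := by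
  rw [halfBraiding, halfBraiding, Category.assoc, ← BraidedCategory.braiding_naturality_left,
    ← comp_whiskerRight_assoc, ← comp_whiskerRight_assoc, degreeScalar_naturality h]

lemma IsBilinear.zero_left (hχ : IsBilinear χ) (a : Z) : χ 0 a = 1 := by
  have := hχ.add_left 0 0 a
  simpa using this

lemma IsBilinear.zero_right (hχ : IsBilinear χ) (g : G) : χ g 0 = 1 := by
  have := hχ.add_right g 0 0
  simpa using this

/-- Bilinearity forces χ(0, a) = 1. This is applied to the unit and to the translation objects. -/
lemma halfBraiding_of_deg_zero (h : IsGraded deg) (hχ : IsBilinear χ) {V : C} (hV : deg 0 V)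
    (a : Z) : halfBraiding deg χ σ V a = (β_ V (σ.obj ⟨a⟩)).hom := by
  rw [halfBraiding, degreeScalar_of_deg h _ hV, hχ.zero_left]
  simp

/-- One hexagon of the braiding, combined with additivity of χ in the degree. -/
lemma halfBraiding_tensor (h : IsGraded deg) (hχ : IsBilinear χ) (V W : C) (a : Z) :
    halfBraiding deg χ σ (V ⊗ W) a = (α_ _ _ _).hom ≫ V ◁ halfBraiding deg χ σ W a ≫
      (α_ _ _ _).inv ≫ halfBraiding deg χ σ V a ▷ W ≫ (α_ _ _ _).hom := by
  rw [halfBraiding, degreeScalar_tensor h _ (fun g g' => by rw [hχ.add_left, mul_inv, Units.val_mul]),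
    tensorHom_def', BraidedCategory.braiding_tensor_left_hom]
  simp only [halfBraiding, comp_whiskerRight, MonoidalCategory.whiskerLeft_comp, Category.assoc]
  rw [associator_naturality_left_assoc, ← whisker_exchange_assoc,
    ← associator_inv_naturality_left_assoc, ← associator_naturality_middle_assoc]

variable [σ.Monoidal]

/-- The other hexagon, combined with additivity of χ in the translation; the scalar for b slides
past the crossing of V with σ_a by naturality. -/
lemma halfBraiding_add (h : IsGraded deg) (hχ : IsBilinear χ) (V : C) (a b : Z) :
    V ◁ (mulIso σ a b).hom ≫ halfBraiding deg χ σ V (a + b) =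
      (α_ _ _ _).inv ≫ halfBraiding deg χ σ V a ▷ σ.obj ⟨b⟩ ≫ (α_ _ _ _).hom ≫
        σ.obj ⟨a⟩ ◁ halfBraiding deg χ σ V b ≫ (α_ _ _ _).inv ≫ (mulIso σ a b).hom ▷ V := by
  have : (fun g => (((χ g (a + b))⁻¹ : kˣ) : k)) = fun g =>
      (((χ g a)⁻¹ : kˣ) : k) * (((χ g b)⁻¹ : kˣ) : k) := by
    funext g
    rw [hχ.add_right, mul_inv, Units.val_mul]
  rw [halfBraiding, this, ← degreeScalar_mul h, whisker_exchange_assoc,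
    BraidedCategory.braiding_naturality_right, BraidedCategory.braiding_tensor_right_hom]
  simp only [halfBraiding, comp_whiskerRight, MonoidalCategory.whiskerLeft_comp, Category.assoc]
  rw [associator_inv_naturality_left_assoc, associator_inv_naturality_left_assoc,
    ← comp_whiskerRight_assoc (degreeScalar deg (fun g => (((χ g b)⁻¹ : kˣ) : k)) V ▷ _),
    BraidedCategory.braiding_naturality_left, comp_whiskerRight_assoc,
    associator_naturality_middle_assoc]

lemma halfBraiding_zero (h : IsGraded deg) (hχ : IsBilinear χ) (V : C) :
    V ◁ (unitIso σ).hom ≫ halfBraiding deg χ σ V 0 =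
      (ρ_ V).hom ≫ (λ_ V).inv ≫ (unitIso σ).hom ▷ V := by
  have : (fun g => (((χ g 0)⁻¹ : kˣ) : k)) = fun g => 1 := by
    funext g
    rw [hχ.zero_right]; simp
  rw [halfBraiding, this, degreeScalar_one h, id_whiskerRight, Category.id_comp,
    BraidedCategory.braiding_naturality_right]
  simp

end HalfBraiding

/-! ### Whiskering of homogeneous morphisms and the interchange law -/

namespace TransCat

section Whisker

variable {k : Type w} [Field k] {C : Type u} [Category.{v} C] [Preadditive C] [Linear k C]
  [MonoidalCategory C] [MonoidalPreadditive C] [MonoidalLinear k C] [BraidedCategory C]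
  {G : Type x} {Z : Type y} [AddCommGroup Z]

/-- Right whiskering of a homogeneous morphism. -/
def homWhiskerRight {σ : Discrete Z ⥤ C} {V V' : C} {a : Z} (f : V ⟶ σ.obj ⟨a⟩ ⊗ V') (W : C) :
    V ⊗ W ⟶ σ.obj ⟨a⟩ ⊗ (V' ⊗ W) :=
  f ▷ W ≫ (α_ _ _ _).hom

/-- Left whiskering of a homogeneous morphism. -/
noncomputable def homWhiskerLeft (deg : G → ObjectProperty C) (χ : G → Z → kˣ)
    {σ : Discrete Z ⥤ C} (V : C) {W W' : C} {b : Z} (g : W ⟶ σ.obj ⟨b⟩ ⊗ W') :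
    V ⊗ W ⟶ σ.obj ⟨b⟩ ⊗ (V ⊗ W') :=
  V ◁ g ≫ (α_ _ _ _).inv ≫ halfBraiding deg χ σ V b ▷ W' ≫ (α_ _ _ _).hom

variable [AddCommGroup G] {deg : G → ObjectProperty C} {χ : G → Z → kˣ} {σ : Discrete Z ⥤ C}
  [σ.Monoidal]

/-- Splits the tensor product into a right whiskering, which involves no crossing, and a left one,
which carries the half braiding. The monoidal axioms can then be checked in one variable at a time.
-/
lemma homTensor_eq_homComp {V₁ V₂ V₃ V₄ : C} {a b : Z} (f : V₁ ⟶ σ.obj ⟨a⟩ ⊗ V₂)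
    (h : V₃ ⟶ σ.obj ⟨b⟩ ⊗ V₄) :
    homTensor deg χ f h = homComp (homWhiskerRight f V₃) (homWhiskerLeft deg χ V₂ h) := by
  simp [homTensor, homComp, homWhiskerRight, homWhiskerLeft, MonoidalCategory.tensorHom_def]

lemma homWhiskerRight_homComp {U V T : C} {a b : Z} (f : U ⟶ σ.obj ⟨a⟩ ⊗ V)
    (g : V ⟶ σ.obj ⟨b⟩ ⊗ T) (W : C) :
    homWhiskerRight (homComp f g) W = homComp (homWhiskerRight f W) (homWhiskerRight g W) := by
  simp only [homWhiskerRight, homComp]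
  monoidal

lemma homWhiskerRight_homEmbed {V V' : C} (f : V ⟶ V') (W : C) :
    homWhiskerRight (homEmbed (σ := σ) f) W = homEmbed (f ▷ W) := by
  simp [homWhiskerRight, homEmbed]

lemma homWhiskerRight_whiskerRight {U U' : C} {a : Z} (f : U ⟶ σ.obj ⟨a⟩ ⊗ U') (V W : C) :
    homWhiskerRight (homWhiskerRight f V) W ≫ σ.obj ⟨a⟩ ◁ (α_ _ _ _).hom =
      (α_ _ _ _).hom ≫ homWhiskerRight f (V ⊗ W) := by
  simp [homWhiskerRight]

lemma homWhiskerRight_rightUnitor {V V' : C} {a : Z} (f : V ⟶ σ.obj ⟨a⟩ ⊗ V') :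
    homWhiskerRight f (𝟙_ C) ≫ σ.obj ⟨a⟩ ◁ (ρ_ V').hom = (ρ_ V).hom ≫ f := by
  simp [homWhiskerRight]

lemma homWhiskerRight_whiskerLeft (U : C) {V V' : C} {b : Z} (g : V ⟶ σ.obj ⟨b⟩ ⊗ V') (W : C) :
    homWhiskerRight (homWhiskerLeft deg χ U g) W ≫ σ.obj ⟨b⟩ ◁ (α_ _ _ _).hom =
      (α_ _ _ _).hom ≫ homWhiskerLeft deg χ U (homWhiskerRight g W) := by
  simp only [homWhiskerRight, homWhiskerLeft]
  monoidal

lemma homWhiskerLeft_homEmbed (hG : IsGraded deg) (hχ : IsBilinear χ) (V : C) {W W' : C}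
    (f : W ⟶ W') : homWhiskerLeft deg χ V (homEmbed (σ := σ) f) = homEmbed (V ◁ f) := by
  simp only [homWhiskerLeft, homEmbed, MonoidalCategory.whiskerLeft_comp, Category.assoc]
  rw [associator_inv_naturality_middle_assoc, ← comp_whiskerRight_assoc,
    halfBraiding_zero hG hχ]
  simp

/-- Crossing σ_a and then σ_b amounts to crossing σ_{a+b}, which is `halfBraiding_add`; the rest is
the interchange law of `C`. -/
lemma homWhiskerLeft_homComp (hG : IsGraded deg) (hχ : IsBilinear χ) (V : C) {U W T : C} {a b : Z}
    (f : U ⟶ σ.obj ⟨a⟩ ⊗ W) (g : W ⟶ σ.obj ⟨b⟩ ⊗ T) :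
    homWhiskerLeft deg χ V (homComp f g) =
      homComp (homWhiskerLeft deg χ V f) (homWhiskerLeft deg χ V g) := by
  calc _ = V ◁ f ⊗≫ V ◁ σ.obj ⟨a⟩ ◁ g ⊗≫
        (V ◁ (mulIso σ a b).hom ≫ halfBraiding deg χ σ V (a + b)) ▷ T ⊗≫ 𝟙 _ := by
        simp only [homComp, homWhiskerLeft]; monoidal
    _ = V ◁ f ⊗≫ ((V ⊗ σ.obj ⟨a⟩) ◁ g ≫ halfBraiding deg χ σ V a ▷ _) ⊗≫
        σ.obj ⟨a⟩ ◁ halfBraiding deg χ σ V b ▷ T ⊗≫ (mulIso σ a b).hom ▷ V ▷ T ⊗≫ 𝟙 _ := by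
        rw [halfBraiding_add hG hχ]; monoidal
    _ = _ := by
        rw [whisker_exchange]
        simp only [homComp, homWhiskerLeft]; monoidal

lemma homWhiskerLeft_whiskerLeft (hG : IsGraded deg) (hχ : IsBilinear χ) (U V : C) {W W' : C}
    {c : Z} (h : W ⟶ σ.obj ⟨c⟩ ⊗ W') :
    homWhiskerLeft deg χ (U ⊗ V) h ≫ σ.obj ⟨c⟩ ◁ (α_ _ _ _).hom =
      (α_ _ _ _).hom ≫ homWhiskerLeft deg χ U (homWhiskerLeft deg χ V h) := by
  simp only [homWhiskerLeft, halfBraiding_tensor hG hχ]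
  monoidal

lemma homWhiskerLeft_leftUnitor (hG : IsGraded deg) (hχ : IsBilinear χ) {V V' : C} {a : Z}
    (f : V ⟶ σ.obj ⟨a⟩ ⊗ V') :
    homWhiskerLeft deg χ (𝟙_ C) f ≫ σ.obj ⟨a⟩ ◁ (λ_ V').hom = (λ_ V).hom ≫ f := by
  simp only [homWhiskerLeft, halfBraiding_of_deg_zero hG hχ hG.unit, braiding_tensorUnit_left]
  monoidal

/-- The two orders of whiskering differ by a crossing of σ_a with σ_b, and the multiplication σ_a ⊗
σ_b ≅ σ_{a+b} absorbs it because the realization braids trivially. -/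
lemma homWhisker_exchange (hG : IsGraded deg) (hχ : IsBilinear χ) (h0 : ∀ a, deg 0 (σ.obj ⟨a⟩))
    (hσ : BraidsTrivially σ) {V V' W W' : C} {a b : Z} (f : V ⟶ σ.obj ⟨a⟩ ⊗ V')
    (h : W ⟶ σ.obj ⟨b⟩ ⊗ W') :
    homComp (homWhiskerLeft deg χ V h) (homWhiskerRight f W') =
      homComp (homWhiskerRight f W) (homWhiskerLeft deg χ V' h) ≫
        castHom σ (add_comm a b) ▷ _ := by
  -- Naturality moves the crossing with σ_b below f, where it becomes a crossing with σ_a ⊗ V'. It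
  -- splits in two, and the part with σ_a is a plain braiding since σ_a has degree zero.
  have key : halfBraiding deg χ σ V b ≫ σ.obj ⟨b⟩ ◁ f =
      f ▷ σ.obj ⟨b⟩ ≫ (α_ _ _ _).hom ≫ σ.obj ⟨a⟩ ◁ halfBraiding deg χ σ V' b ≫ (α_ _ _ _).inv ≫
        (β_ (σ.obj ⟨a⟩) (σ.obj ⟨b⟩)).hom ▷ V' ≫ (α_ _ _ _).hom := by
    rw [← halfBraiding_naturality hG, halfBraiding_tensor hG hχ,
      halfBraiding_of_deg_zero hG hχ (h0 a)]
  calc _ = V ◁ h ⊗≫ (halfBraiding deg χ σ V b ≫ σ.obj ⟨b⟩ ◁ f) ▷ W' ⊗≫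
        (mulIso σ b a).hom ▷ V' ▷ W' ⊗≫ 𝟙 _ := by
        simp only [homComp, homWhiskerLeft, homWhiskerRight]; monoidal
    _ = (V ◁ h ≫ f ▷ _) ⊗≫ σ.obj ⟨a⟩ ◁ halfBraiding deg χ σ V' b ▷ W' ⊗≫
        ((β_ (σ.obj ⟨a⟩) (σ.obj ⟨b⟩)).hom ≫ (mulIso σ b a).hom) ▷ V' ▷ W' ⊗≫ 𝟙 _ := by
        rw [key]; monoidal
    _ = _ := by
        rw [hσ, whisker_exchange]
        simp only [homComp, homWhiskerLeft, homWhiskerRight]; monoidal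

end Whisker

end TransCat

/-! ### The monoidal category `C^Z` -/

namespace TransCat

/-- The conditions under which the half braidings make `C^Z` a monoidal category. -/
structure IsCentral {k : Type w} [Field k] {C : Type u} [Category.{v} C] [Preadditive C]
    [MonoidalCategory C] [BraidedCategory C] {G : Type x} [AddCommGroup G] {Z : Type y}
    [AddCommGroup Z] (deg : G → ObjectProperty C) (χ : G → Z → kˣ) (σ : Discrete Z ⥤ C)
    [σ.Monoidal] : Prop where
  graded : IsGraded deg
  bilinear : IsBilinear χ
  deg_zero : ∀ a, deg 0 (σ.obj ⟨a⟩)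
  braids : BraidsTrivially σ

section Calculus

variable {k : Type w} [Field k] {C : Type u} [Category.{v} C] [Preadditive C] [Linear k C]
  [MonoidalCategory C] [MonoidalPreadditive C] [MonoidalLinear k C]
  {G : Type x} {Z : Type y} [AddCommGroup Z] [DecidableEq Z]
  {deg : G → ObjectProperty C} {χ : G → Z → kˣ} {σ : Discrete Z ⥤ C} [σ.Monoidal]

/-- A morphism of `C`, as a morphism of `C^Z`. -/
noncomputable def incl {V W : TransCat deg χ σ} (f : V.base ⟶ W.base) : V ⟶ W :=
  homOf 0 (homEmbed f)

lemma incl_eq {V W : TransCat deg χ σ} (f : V.base ⟶ W.base) : incl f = homOf 0 (homEmbed f) := rfl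

lemma hom_induction {V W : TransCat deg χ σ} {P : (V ⟶ W) → Prop} (f : V ⟶ W) (h0 : P 0)
    (ha : ∀ f g, P f → P g → P (f + g))
    (h : ∀ (a : Z) (f : V.base ⟶ σ.obj ⟨a⟩ ⊗ W.base), P (homOf a f)) : P f :=
  DirectSum.induction_on f h0 h ha

lemma homOf_comp_homOf {U V W : TransCat deg χ σ} {a b : Z} (f : U.base ⟶ σ.obj ⟨a⟩ ⊗ V.base)
    (g : V.base ⟶ σ.obj ⟨b⟩ ⊗ W.base) : homOf a f ≫ homOf b g = homOf (a + b) (homComp f g) :=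
  grComp_of_of f g

lemma homOf_eq {V W : TransCat deg χ σ} {a b : Z} (h : a = b) (f : V.base ⟶ σ.obj ⟨a⟩ ⊗ W.base)
    (g : V.base ⟶ σ.obj ⟨b⟩ ⊗ W.base) (hfg : f ≫ castHom σ h ▷ W.base = g) :
    homOf a f = homOf b g :=
  of_eq_of h f g hfg

lemma incl_comp_homOf {U V W : TransCat deg χ σ} {b : Z} (f : U.base ⟶ V.base)
    (g : V.base ⟶ σ.obj ⟨b⟩ ⊗ W.base) : incl f ≫ homOf b g = homOf b (f ≫ g) := by
  rw [incl, homOf_comp_homOf]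
  exact homOf_eq (zero_add b) _ _ (homEmbed_comp f g)

lemma homOf_comp_incl {U V W : TransCat deg χ σ} {a : Z} (f : U.base ⟶ σ.obj ⟨a⟩ ⊗ V.base)
    (g : V.base ⟶ W.base) : homOf a f ≫ incl g = homOf a (f ≫ σ.obj ⟨a⟩ ◁ g) := by
  rw [incl, homOf_comp_homOf]
  exact homOf_eq (add_zero a) _ _ (comp_homEmbed f g)

lemma incl_comp {U V W : TransCat deg χ σ} (f : U.base ⟶ V.base) (g : V.base ⟶ W.base) :
    (incl (f ≫ g) : U ⟶ W) = (incl f : U ⟶ V) ≫ incl g := by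
  rw [incl_eq g, incl_comp_homOf]
  simp [incl, homEmbed]

lemma incl_id (V : TransCat deg χ σ) : incl (𝟙 V.base) = 𝟙 V := rfl

lemma incl_add {V W : TransCat deg χ σ} (f g : V.base ⟶ W.base) :
    (incl (f + g) : V ⟶ W) = incl f + incl g := by
  simp [incl, homEmbed]

lemma incl_zero {V W : TransCat deg χ σ} : (incl 0 : V ⟶ W) = 0 := by
  simp [incl, homEmbed]

lemma incl_sum {ι : Type*} (s : Finset ι) {V W : TransCat deg χ σ} (f : ι → (V.base ⟶ W.base)) :
    (incl (∑ i ∈ s, f i) : V ⟶ W) = ∑ i ∈ s, incl (f i) :=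
  map_sum (AddMonoidHom.mk' (incl : (V.base ⟶ W.base) → (V ⟶ W)) incl_add) f s

lemma smul_homOf (r : k) {V W : TransCat deg χ σ} {a : Z} (f : V.base ⟶ σ.obj ⟨a⟩ ⊗ W.base) :
    r • (homOf a f : V ⟶ W) = homOf a (r • f) :=
  smul_of r f

lemma incl_smul (r : k) {V W : TransCat deg χ σ} (f : V.base ⟶ W.base) :
    (incl (r • f) : V ⟶ W) = r • incl f := by
  simp [incl, homEmbed, smul_homOf]

/-- The morphism `f` of `C` whose image in `C^Z` is the component of degree zero. -/
noncomputable def zeroComponent {V W : TransCat deg χ σ} : (V ⟶ W) →ₗ[k] (V.base ⟶ W.base) where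
  toFun f := (show GrHom σ V.base W.base from f) 0 ≫ (unitIso σ).inv ▷ W.base ≫ (λ_ W.base).hom
  map_add' f g := by
    rw [← Preadditive.add_comp]
    rfl
  map_smul' r f := by
    rw [RingHom.id_apply, ← Linear.smul_comp]
    rfl

lemma zeroComponent_incl {V W : TransCat deg χ σ} (f : V.base ⟶ W.base) :
    zeroComponent (incl f : V ⟶ W) = f := by
  change DirectSum.of (fun c : Z => (V.base ⟶ σ.obj ⟨c⟩ ⊗ W.base)) 0 (homEmbed f) 0 ≫ _ = f
  rw [DirectSum.of_eq_same]
  simp [homEmbed]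

lemma zeroComponent_homOf_ne {V W : TransCat deg χ σ} {a : Z} (ha : a ≠ 0)
    (f : V.base ⟶ σ.obj ⟨a⟩ ⊗ W.base) : zeroComponent (homOf a f : V ⟶ W) = 0 := by
  change DirectSum.of (fun c : Z => (V.base ⟶ σ.obj ⟨c⟩ ⊗ W.base)) a f 0 ≫ _ = 0
  rw [DirectSum.of_eq_of_ne _ _ _ ha.symm]
  simp

lemma homOf_zero_eq_incl {V W : TransCat deg χ σ} (f : V.base ⟶ σ.obj ⟨0⟩ ⊗ W.base) :
    (homOf 0 f : V ⟶ W) = incl (f ≫ (unitIso σ).inv ▷ W.base ≫ (λ_ W.base).hom) := by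
  simp [incl, homEmbed]

lemma zeroComponent_comp_incl {U V W : TransCat deg χ σ} (f : U ⟶ V) (g : V.base ⟶ W.base) :
    zeroComponent (f ≫ incl g) = zeroComponent f ≫ g := by
  induction f using hom_induction with
  | h0 => simp
  | ha f f' hf hf' =>
    rw [Preadditive.add_comp, map_add, map_add, Preadditive.add_comp, hf, hf']
  | h a f =>
    by_cases ha : a = 0
    · subst ha
      rw [homOf_zero_eq_incl, ← incl_comp, zeroComponent_incl, zeroComponent_incl]
    · rw [homOf_comp_incl, zeroComponent_homOf_ne ha, zeroComponent_homOf_ne ha, Limits.zero_comp]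

/-- Precomposition with a morphism of `C` acts in each degree separately; this is why epimorphisms
of `C` stay epic in `C^Z`. -/
lemma incl_comp_apply {U V W : TransCat deg χ σ} (f : U.base ⟶ V.base) (g : V ⟶ W) (a : Z) :
    (show GrHom σ U.base W.base from incl f ≫ g) a =
      f ≫ (show GrHom σ V.base W.base from g) a := by
  induction g using hom_induction with
  | h0 =>
    rw [Limits.comp_zero]
    exact (Limits.comp_zero (f := f)).symm
  | ha g g' hg hg' =>
    rw [Preadditive.comp_add]
    exact (congrArg₂ (· + ·) hg hg').trans (Preadditive.comp_add _ _ _ _ _ _).symm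
  | h b g =>
    rw [incl_comp_homOf]
    change DirectSum.of (fun c : Z => (U.base ⟶ σ.obj ⟨c⟩ ⊗ W.base)) b (f ≫ g) a =
      f ≫ DirectSum.of (fun c : Z => (V.base ⟶ σ.obj ⟨c⟩ ⊗ W.base)) b g a
    by_cases hab : a = b
    · subst hab
      rw [DirectSum.of_eq_same, DirectSum.of_eq_same]
    · rw [DirectSum.of_eq_of_ne _ _ _ hab, DirectSum.of_eq_of_ne _ _ _ hab, Limits.comp_zero]

lemma incl_injective {V W : TransCat deg χ σ} :
    Function.Injective (incl : (V.base ⟶ W.base) → (V ⟶ W)) :=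
  Function.LeftInverse.injective zeroComponent_incl

section Tensor

variable [BraidedCategory C]

lemma tensorHom_homOf {V₁ V₂ V₃ V₄ : TransCat deg χ σ} {a b : Z}
    (f : V₁.base ⟶ σ.obj ⟨a⟩ ⊗ V₂.base) (h : V₃.base ⟶ σ.obj ⟨b⟩ ⊗ V₄.base) :
    (homOf a f : V₁ ⟶ V₂) ⊗ₘ (homOf b h : V₃ ⟶ V₄) = homOf (a + b) (homTensor deg χ f h) := by
  change tensor V₁ V₂ V₃ V₄ _ _ = _
  refine (DFunLike.congr_fun (DirectSum.toAddMonoid_of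
    (β := fun c : Z => (V₁.base ⟶ σ.obj ⟨c⟩ ⊗ V₂.base)) _ a f) _).trans ?_
  refine (AddMonoidHom.flip_apply _ _ _).trans ?_
  exact DFunLike.congr_fun (DirectSum.toAddMonoid_of
    (β := fun c : Z => (V₃.base ⟶ σ.obj ⟨c⟩ ⊗ V₄.base))
    (γ := (V₁.base ⟶ σ.obj ⟨a⟩ ⊗ V₂.base) →+ (V₁ ⊗ V₃ ⟶ V₂ ⊗ V₄)) _ b h) f

lemma tensorHom_add {V₁ V₂ V₃ V₄ : TransCat deg χ σ} (f : V₁ ⟶ V₂) (h h' : V₃ ⟶ V₄) :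
    f ⊗ₘ (h + h') = f ⊗ₘ h + f ⊗ₘ h' :=
  (tensor V₁ V₂ V₃ V₄ f).map_add h h'

lemma add_tensorHom {V₁ V₂ V₃ V₄ : TransCat deg χ σ} (f f' : V₁ ⟶ V₂) (h : V₃ ⟶ V₄) :
    (f + f') ⊗ₘ h = f ⊗ₘ h + f' ⊗ₘ h :=
  DFunLike.congr_fun ((tensor V₁ V₂ V₃ V₄).map_add f f') h

lemma tensorHom_zero {V₁ V₂ V₃ V₄ : TransCat deg χ σ} (f : V₁ ⟶ V₂) :
    f ⊗ₘ (0 : V₃ ⟶ V₄) = 0 :=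
  (tensor V₁ V₂ V₃ V₄ f).map_zero

lemma zero_tensorHom {V₁ V₂ V₃ V₄ : TransCat deg χ σ} (h : V₃ ⟶ V₄) :
    (0 : V₁ ⟶ V₂) ⊗ₘ h = 0 :=
  DFunLike.congr_fun (tensor V₁ V₂ V₃ V₄).map_zero h

lemma add_whiskerRight {V V' : TransCat deg χ σ} (f f' : V ⟶ V') (W : TransCat deg χ σ) :
    (f + f') ▷ W = f ▷ W + f' ▷ W :=
  add_tensorHom f f' (𝟙 W)

lemma whiskerLeft_add (W : TransCat deg χ σ) {V V' : TransCat deg χ σ} (f f' : V ⟶ V') :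
    W ◁ (f + f') = W ◁ f + W ◁ f' :=
  tensorHom_add (𝟙 W) f f'

lemma zero_whiskerRight {V V' : TransCat deg χ σ} (W : TransCat deg χ σ) :
    (0 : V ⟶ V') ▷ W = 0 :=
  zero_tensorHom (𝟙 W)

lemma whiskerLeft_zero (W : TransCat deg χ σ) {V V' : TransCat deg χ σ} :
    W ◁ (0 : V ⟶ V') = 0 :=
  tensorHom_zero (𝟙 W)

variable [AddCommGroup G]

lemma IsCentral.whiskerRight_homOf (hc : IsCentral deg χ σ) {V V' : TransCat deg χ σ} {a : Z}
    (f : V.base ⟶ σ.obj ⟨a⟩ ⊗ V'.base) (W : TransCat deg χ σ) :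
    (homOf a f : V ⟶ V') ▷ W = homOf a (homWhiskerRight f W.base) := by
  refine (tensorHom_homOf f (homEmbed (𝟙 W.base))).trans ?_
  rw [homTensor_eq_homComp, homWhiskerLeft_homEmbed hc.graded hc.bilinear]
  refine homOf_eq (add_zero a) _ _ ?_
  rw [comp_homEmbed]
  simp

lemma whiskerLeft_homOf (V : TransCat deg χ σ)
    {W W' : TransCat deg χ σ} {b : Z} (g : W.base ⟶ σ.obj ⟨b⟩ ⊗ W'.base) :
    V ◁ (homOf b g : W ⟶ W') = homOf b (homWhiskerLeft deg χ V.base g) := by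
  refine (tensorHom_homOf (homEmbed (𝟙 V.base)) g).trans ?_
  rw [homTensor_eq_homComp, homWhiskerRight_homEmbed]
  refine homOf_eq (zero_add b) _ _ ?_
  rw [homEmbed_comp]
  simp

lemma IsCentral.incl_whiskerRight (hc : IsCentral deg χ σ) {V V' : TransCat deg χ σ}
    (f : V.base ⟶ V'.base) (W : TransCat deg χ σ) :
    (incl f : V ⟶ V') ▷ W = incl (f ▷ W.base) := by
  rw [incl, hc.whiskerRight_homOf, homWhiskerRight_homEmbed]
  rfl

lemma IsCentral.whiskerLeft_incl (hc : IsCentral deg χ σ) (W : TransCat deg χ σ)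
    {V V' : TransCat deg χ σ} (f : V.base ⟶ V'.base) :
    W ◁ (incl f : V ⟶ V') = incl (W.base ◁ f) := by
  rw [incl, whiskerLeft_homOf, homWhiskerLeft_homEmbed hc.graded hc.bilinear]
  rfl

lemma IsCentral.tensorHom_def (hc : IsCentral deg χ σ) {V₁ V₂ V₃ V₄ : TransCat deg χ σ}
    (f : V₁ ⟶ V₂) (h : V₃ ⟶ V₄) : f ⊗ₘ h = f ▷ V₃ ≫ V₂ ◁ h := by
  induction f using hom_induction with
  | h0 => rw [zero_tensorHom, zero_whiskerRight, Limits.zero_comp]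
  | ha f f' hf hf' => rw [add_tensorHom, add_whiskerRight, Preadditive.add_comp, hf, hf']
  | h a f =>
    induction h using hom_induction with
    | h0 => rw [tensorHom_zero, whiskerLeft_zero, Limits.comp_zero]
    | ha h h' hh hh' => rw [tensorHom_add, whiskerLeft_add, Preadditive.comp_add, hh, hh']
    | h b h =>
      rw [tensorHom_homOf, hc.whiskerRight_homOf, whiskerLeft_homOf, homTensor_eq_homComp]
      exact (homOf_comp_homOf _ _).symm

lemma IsCentral.whisker_exchange (hc : IsCentral deg χ σ) {V₁ V₂ V₃ V₄ : TransCat deg χ σ}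
    (f : V₁ ⟶ V₂) (h : V₃ ⟶ V₄) : V₁ ◁ h ≫ f ▷ V₄ = f ▷ V₃ ≫ V₂ ◁ h := by
  induction f using hom_induction with
  | h0 => rw [zero_whiskerRight, zero_whiskerRight, Limits.zero_comp, Limits.comp_zero]
  | ha f f' hf hf' =>
    rw [add_whiskerRight, add_whiskerRight, Preadditive.add_comp, Preadditive.comp_add, hf, hf']
  | h a f =>
    induction h using hom_induction with
    | h0 => rw [whiskerLeft_zero, whiskerLeft_zero, Limits.zero_comp, Limits.comp_zero]
    | ha h h' hh hh' =>
      rw [whiskerLeft_add, whiskerLeft_add, Preadditive.add_comp, Preadditive.comp_add, hh, hh']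
    | h b h =>
      rw [hc.whiskerRight_homOf, whiskerLeft_homOf, hc.whiskerRight_homOf,
        whiskerLeft_homOf]
      refine (homOf_comp_homOf _ _).trans (Eq.trans ?_ (homOf_comp_homOf _ _).symm)
      exact (homOf_eq (add_comm a b) _ _ (homWhisker_exchange hc.graded hc.bilinear hc.deg_zero
        hc.braids f h).symm).symm

lemma IsCentral.comp_whiskerRight (hc : IsCentral deg χ σ) {U V W : TransCat deg χ σ}
    (f : U ⟶ V) (g : V ⟶ W) (T : TransCat deg χ σ) : (f ≫ g) ▷ T = f ▷ T ≫ g ▷ T := by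
  induction f using hom_induction with
  | h0 => rw [zero_whiskerRight, Limits.zero_comp, Limits.zero_comp, zero_whiskerRight]
  | ha f f' hf hf' =>
    rw [Preadditive.add_comp, add_whiskerRight, add_whiskerRight, Preadditive.add_comp, hf, hf']
  | h a f =>
    induction g using hom_induction with
    | h0 => rw [zero_whiskerRight, Limits.comp_zero, Limits.comp_zero, zero_whiskerRight]
    | ha g g' hg hg' =>
      rw [Preadditive.comp_add, add_whiskerRight, add_whiskerRight, Preadditive.comp_add, hg, hg']
    | h b g =>
      rw [homOf_comp_homOf, hc.whiskerRight_homOf, hc.whiskerRight_homOf, hc.whiskerRight_homOf,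
        homWhiskerRight_homComp]
      exact (homOf_comp_homOf _ _).symm

lemma IsCentral.whiskerLeft_comp (hc : IsCentral deg χ σ) (T : TransCat deg χ σ)
    {U V W : TransCat deg χ σ} (f : U ⟶ V) (g : V ⟶ W) : T ◁ (f ≫ g) = T ◁ f ≫ T ◁ g := by
  induction f using hom_induction with
  | h0 => rw [whiskerLeft_zero, Limits.zero_comp, Limits.zero_comp, whiskerLeft_zero]
  | ha f f' hf hf' =>
    rw [Preadditive.add_comp, whiskerLeft_add, whiskerLeft_add, Preadditive.add_comp, hf, hf']
  | h a f =>
    induction g using hom_induction with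
    | h0 => rw [whiskerLeft_zero, Limits.comp_zero, Limits.comp_zero, whiskerLeft_zero]
    | ha g g' hg hg' =>
      rw [Preadditive.comp_add, whiskerLeft_add, whiskerLeft_add, Preadditive.comp_add, hg, hg']
    | h b g =>
      rw [homOf_comp_homOf, whiskerLeft_homOf, whiskerLeft_homOf, whiskerLeft_homOf,
        homWhiskerLeft_homComp hc.graded hc.bilinear]
      exact (homOf_comp_homOf _ _).symm

lemma associator_eq (U V W : TransCat deg χ σ) :
    (α_ U V W).hom = incl (α_ U.base V.base W.base).hom := rfl

lemma associator_inv_eq (U V W : TransCat deg χ σ) :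
    (α_ U V W).inv = incl (α_ U.base V.base W.base).inv := rfl

lemma leftUnitor_eq (V : TransCat deg χ σ) : (λ_ V).hom = incl (λ_ V.base).hom := rfl

lemma leftUnitor_inv_eq (V : TransCat deg χ σ) : (λ_ V).inv = incl (λ_ V.base).inv := rfl

lemma rightUnitor_eq (V : TransCat deg χ σ) : (ρ_ V).hom = incl (ρ_ V.base).hom := rfl

lemma rightUnitor_inv_eq (V : TransCat deg χ σ) : (ρ_ V).inv = incl (ρ_ V.base).inv := rfl

lemma IsCentral.whiskerRight_id (hc : IsCentral deg χ σ) (V W : TransCat deg χ σ) :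
    𝟙 V ▷ W = 𝟙 (V ⊗ W) := by
  rw [← incl_id, hc.incl_whiskerRight]
  simp
  rfl

lemma IsCentral.whiskerLeft_id (hc : IsCentral deg χ σ) (V W : TransCat deg χ σ) :
    V ◁ 𝟙 W = 𝟙 (V ⊗ W) := by
  rw [← incl_id, hc.whiskerLeft_incl]
  simp
  rfl

lemma IsCentral.associator_left (hc : IsCentral deg χ σ) {U U' : TransCat deg χ σ}
    (f : U ⟶ U') (V W : TransCat deg χ σ) :
    f ▷ V ▷ W ≫ (α_ U' V W).hom = (α_ U V W).hom ≫ f ▷ (V ⊗ W) := by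
  induction f using hom_induction with
  | h0 => simp only [zero_whiskerRight, Limits.zero_comp, Limits.comp_zero]
  | ha f f' hf hf' =>
    simp only [add_whiskerRight, Preadditive.add_comp, Preadditive.comp_add, hf, hf']
  | h a f =>
    rw [hc.whiskerRight_homOf, hc.whiskerRight_homOf, hc.whiskerRight_homOf, associator_eq,
      associator_eq]
    refine (homOf_comp_incl _ _).trans (Eq.trans ?_ (incl_comp_homOf _ _).symm)
    exact congrArg (homOf a) (homWhiskerRight_whiskerRight f V.base W.base)

lemma IsCentral.associator_middle (hc : IsCentral deg χ σ) (U : TransCat deg χ σ)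
    {V V' : TransCat deg χ σ} (f : V ⟶ V') (W : TransCat deg χ σ) :
    (U ◁ f) ▷ W ≫ (α_ U V' W).hom = (α_ U V W).hom ≫ U ◁ (f ▷ W) := by
  induction f using hom_induction with
  | h0 => simp only [zero_whiskerRight, whiskerLeft_zero, Limits.zero_comp, Limits.comp_zero]
  | ha f f' hf hf' =>
    simp only [add_whiskerRight, whiskerLeft_add, Preadditive.add_comp, Preadditive.comp_add, hf,
      hf']
  | h a f =>
    rw [hc.whiskerRight_homOf, whiskerLeft_homOf, hc.whiskerRight_homOf, whiskerLeft_homOf,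
      associator_eq, associator_eq]
    refine (homOf_comp_incl _ _).trans (Eq.trans ?_ (incl_comp_homOf _ _).symm)
    exact congrArg (homOf a) (homWhiskerRight_whiskerLeft U.base f W.base)

lemma IsCentral.associator_right (hc : IsCentral deg χ σ) (U V : TransCat deg χ σ)
    {W W' : TransCat deg χ σ} (f : W ⟶ W') :
    (U ⊗ V) ◁ f ≫ (α_ U V W').hom = (α_ U V W).hom ≫ U ◁ (V ◁ f) := by
  induction f using hom_induction with
  | h0 => simp only [whiskerLeft_zero, Limits.zero_comp, Limits.comp_zero]
  | ha f f' hf hf' =>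
    simp only [whiskerLeft_add, Preadditive.add_comp, Preadditive.comp_add, hf, hf']
  | h a f =>
    rw [whiskerLeft_homOf, whiskerLeft_homOf, whiskerLeft_homOf, associator_eq,
      associator_eq]
    refine (homOf_comp_incl _ _).trans (Eq.trans ?_ (incl_comp_homOf _ _).symm)
    exact congrArg (homOf a) (homWhiskerLeft_whiskerLeft hc.graded hc.bilinear U.base V.base f)

lemma IsCentral.leftUnitor_naturality (hc : IsCentral deg χ σ) {V V' : TransCat deg χ σ}
    (f : V ⟶ V') : 𝟙_ (TransCat deg χ σ) ◁ f ≫ (λ_ V').hom = (λ_ V).hom ≫ f := by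
  induction f using hom_induction with
  | h0 => simp only [whiskerLeft_zero, Limits.zero_comp, Limits.comp_zero]
  | ha f f' hf hf' =>
    simp only [whiskerLeft_add, Preadditive.add_comp, Preadditive.comp_add, hf, hf']
  | h a f =>
    rw [whiskerLeft_homOf, leftUnitor_eq, leftUnitor_eq]
    refine (homOf_comp_incl _ _).trans (Eq.trans ?_ (incl_comp_homOf _ _).symm)
    exact congrArg (homOf a) (homWhiskerLeft_leftUnitor hc.graded hc.bilinear f)

lemma IsCentral.rightUnitor_naturality (hc : IsCentral deg χ σ) {V V' : TransCat deg χ σ}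
    (f : V ⟶ V') : f ▷ 𝟙_ (TransCat deg χ σ) ≫ (ρ_ V').hom = (ρ_ V).hom ≫ f := by
  induction f using hom_induction with
  | h0 => simp only [zero_whiskerRight, Limits.zero_comp, Limits.comp_zero]
  | ha f f' hf hf' =>
    simp only [add_whiskerRight, Preadditive.add_comp, Preadditive.comp_add, hf, hf']
  | h a f =>
    rw [hc.whiskerRight_homOf, rightUnitor_eq, rightUnitor_eq]
    refine (homOf_comp_incl _ _).trans (Eq.trans ?_ (incl_comp_homOf _ _).symm)
    exact congrArg (homOf a) (homWhiskerRight_rightUnitor f)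

/-- The monoidal category `C^Z`. -/
@[reducible]
noncomputable def IsCentral.monoidalCategory (hc : IsCentral deg χ σ) :
    MonoidalCategory (TransCat deg χ σ) where
  tensorHom_def := hc.tensorHom_def
  id_tensorHom_id := hc.whiskerLeft_id
  tensorHom_comp_tensorHom f₁ f₂ g₁ g₂ := by
    rw [hc.tensorHom_def, hc.tensorHom_def, hc.tensorHom_def, hc.comp_whiskerRight,
      hc.whiskerLeft_comp, Category.assoc, Category.assoc, ← Category.assoc (_ ◁ f₂),
      hc.whisker_exchange, Category.assoc]
  whiskerLeft_id := hc.whiskerLeft_id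
  id_whiskerRight := hc.whiskerRight_id
  associator_naturality f₁ f₂ f₃ := by
    rw [hc.tensorHom_def, hc.tensorHom_def, hc.tensorHom_def, hc.tensorHom_def,
      hc.comp_whiskerRight, Category.assoc, Category.assoc, hc.associator_right,
      ← Category.assoc ((_ ◁ f₂) ▷ _), hc.associator_middle, Category.assoc,
      ← Category.assoc (f₁ ▷ _ ▷ _), hc.associator_left, Category.assoc, hc.whiskerLeft_comp]
  leftUnitor_naturality := hc.leftUnitor_naturality
  rightUnitor_naturality := hc.rightUnitor_naturality
  -- The structure isomorphisms have degree zero, so pentagon and triangle are images of those of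
  -- `C`.
  pentagon U V W T := by
    rw [associator_eq, associator_eq, associator_eq, associator_eq, associator_eq,
      hc.incl_whiskerRight, hc.whiskerLeft_incl]
    simp only [← incl_comp]
    exact congrArg incl (MonoidalCategory.pentagon U.base V.base W.base T.base)
  triangle U V := by
    rw [associator_eq, leftUnitor_eq, rightUnitor_eq, hc.incl_whiskerRight, hc.whiskerLeft_incl]
    exact (incl_comp _ _).symm.trans
      (congrArg incl (MonoidalCategory.triangle U.base V.base))

end Tensor

end Calculus

end TransCat

/-- The zigzag identities for both families of duality morphisms. -/
structure HasZigzags (D : Type u) [Category.{v} D] [MonoidalCategoryStruct D] [PivotalStruct D] :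
    Prop where
  zigzagR : ∀ V : D, (λ_ V).inv ≫ coevR V ▷ V ≫ (α_ V (dual V) V).hom ≫ V ◁ evR V ≫
    (ρ_ V).hom = 𝟙 V
  zigzagR_dual : ∀ V : D, (ρ_ (dual V)).inv ≫ dual V ◁ coevR V ≫
    (α_ (dual V) V (dual V)).inv ≫ evR V ▷ dual V ≫ (λ_ (dual V)).hom = 𝟙 (dual V)
  zigzagL : ∀ V : D, (ρ_ V).inv ≫ V ◁ coevL V ≫ (α_ V (dual V) V).inv ≫ evL V ▷ V ≫
    (λ_ V).hom = 𝟙 V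
  zigzagL_dual : ∀ V : D, (λ_ (dual V)).inv ≫ coevL V ▷ dual V ≫
    (α_ (dual V) V (dual V)).hom ≫ dual V ◁ evL V ≫ (ρ_ (dual V)).hom = 𝟙 (dual V)

lemma IsPivotalCategory.hasZigzags {k : Type w} [Field k] {C : Type u} [Category.{v} C]
    [Preadditive C] [Linear k C] [MonoidalCategoryStruct C] [PivotalStruct C]
    (hC : IsPivotalCategory k C) : HasZigzags C :=
  ⟨hC.zigzagR, hC.zigzagR_dual, hC.zigzagL, hC.zigzagL_dual⟩

/-! ### Calculus of the two dualities in a monoidal category -/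

section Duality

variable {D : Type u} [Category.{v} D] [MonoidalCategory D] [PivotalStruct D]

/-- The exact pairing given by `coevR` and `evR`. -/
@[reducible]
def HasZigzags.pairingR (h : HasZigzags D) (V : D) : ExactPairing V (dual V) where
  coevaluation' := coevR V
  evaluation' := evR V
  coevaluation_evaluation' := by
    rw [← Iso.inv_comp_eq, ← cancel_mono (λ_ (dual V)).hom]
    simpa using h.zigzagR_dual V
  evaluation_coevaluation' := by
    rw [← Iso.inv_comp_eq, ← cancel_mono (ρ_ V).hom]
    simpa using h.zigzagR V

/-- The exact pairing given by `coevL` and `evL`. -/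
@[reducible]
def HasZigzags.pairingL (h : HasZigzags D) (V : D) : ExactPairing (dual V) V where
  coevaluation' := coevL V
  evaluation' := evL V
  coevaluation_evaluation' := by
    rw [← Iso.inv_comp_eq, ← cancel_mono (λ_ V).hom]
    simpa using h.zigzagL V
  evaluation_coevaluation' := by
    rw [← Iso.inv_comp_eq, ← cancel_mono (ρ_ (dual V)).hom]
    simpa using h.zigzagL_dual V

/-- The morphism to the dual corresponding to a pairing `A ⊗ T ⟶ 𝟙`, with respect to `coevR`. -/
def curryR {A T : D} (n : A ⊗ T ⟶ 𝟙_ D) : A ⟶ dual T :=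
  (ρ_ A).inv ≫ A ◁ coevR T ≫ (α_ A T (dual T)).inv ≫ n ▷ dual T ≫ (λ_ (dual T)).hom

/-- The morphism to the dual corresponding to a pairing `T ⊗ A ⟶ 𝟙`, with respect to `coevL`. -/
def curryL {A T : D} (n : T ⊗ A ⟶ 𝟙_ D) : A ⟶ dual T :=
  (λ_ A).inv ≫ coevL T ▷ A ≫ (α_ (dual T) T A).hom ≫ dual T ◁ n ≫ (ρ_ (dual T)).hom

lemma HasZigzags.curryR_evR (h : HasZigzags D) {A T : D} (n : A ⊗ T ⟶ 𝟙_ D) :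
    curryR n ▷ T ≫ evR T = n := by
  calc _ = 𝟙 _ ⊗≫ A ◁ coevR T ▷ T ⊗≫ (n ▷ (dual T ⊗ T) ≫ 𝟙_ D ◁ evR T) ⊗≫ 𝟙 _ := by
        simp only [curryR]; monoidal
    _ = 𝟙 _ ⊗≫ A ◁ ((λ_ T).inv ≫ coevR T ▷ T ≫ (α_ T (dual T) T).hom ≫ T ◁ evR T ≫
          (ρ_ T).hom) ⊗≫ n := by
        rw [← whisker_exchange]; monoidal
    _ = n := by rw [h.zigzagR]; monoidal

lemma HasZigzags.curryL_evL (h : HasZigzags D) {A T : D} (n : T ⊗ A ⟶ 𝟙_ D) :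
    T ◁ curryL n ≫ evL T = n := by
  calc _ = 𝟙 _ ⊗≫ T ◁ coevL T ▷ A ⊗≫ ((T ⊗ dual T) ◁ n ≫ evL T ▷ 𝟙_ D) ⊗≫ 𝟙 _ := by
        simp only [curryL]; monoidal
    _ = 𝟙 _ ⊗≫ ((ρ_ T).inv ≫ T ◁ coevL T ≫ (α_ T (dual T) T).inv ≫ evL T ▷ T ≫
          (λ_ T).hom) ▷ A ⊗≫ n := by
        rw [whisker_exchange]; monoidal
    _ = n := by rw [h.zigzagL]; monoidal

lemma HasZigzags.curryR_of_evR (h : HasZigzags D) {A T : D} (f : A ⟶ dual T) :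
    curryR (f ▷ T ≫ evR T) = f := by
  calc _ = 𝟙 _ ⊗≫ (A ◁ coevR T ≫ f ▷ (T ⊗ dual T)) ⊗≫ evR T ▷ dual T ⊗≫ 𝟙 _ := by
        simp only [curryR]; monoidal
    _ = f ⊗≫ ((ρ_ (dual T)).inv ≫ dual T ◁ coevR T ≫ (α_ (dual T) T (dual T)).inv ≫
          evR T ▷ dual T ≫ (λ_ (dual T)).hom) := by
        rw [whisker_exchange]; monoidal
    _ = f := by rw [h.zigzagR_dual]; monoidal

lemma HasZigzags.curryL_of_evL (h : HasZigzags D) {A T : D} (f : A ⟶ dual T) :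
    curryL (T ◁ f ≫ evL T) = f := by
  calc _ = 𝟙 _ ⊗≫ (coevL T ▷ A ≫ (dual T ⊗ T) ◁ f) ⊗≫ dual T ◁ evL T ⊗≫ 𝟙 _ := by
        simp only [curryL]; monoidal
    _ = f ⊗≫ ((λ_ (dual T)).inv ≫ coevL T ▷ dual T ≫ (α_ (dual T) T (dual T)).hom ≫
          dual T ◁ evL T ≫ (ρ_ (dual T)).hom) := by
        rw [← whisker_exchange]; monoidal
    _ = f := by rw [h.zigzagL_dual]; monoidal

/-- Currying inverts evaluation, so maps into a dual are determined by their pairings. Identities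
between dual morphisms are checked in this way. -/
lemma HasZigzags.evR_ext (h : HasZigzags D) {A T : D} {f g : A ⟶ dual T}
    (hfg : f ▷ T ≫ evR T = g ▷ T ≫ evR T) : f = g := by
  rw [← h.curryR_of_evR f, hfg, h.curryR_of_evR]

lemma HasZigzags.evL_ext (h : HasZigzags D) {A T : D} {f g : A ⟶ dual T}
    (hfg : T ◁ f ≫ evL T = T ◁ g ≫ evL T) : f = g := by
  rw [← h.curryL_of_evL f, hfg, h.curryL_of_evL]

lemma dualR_eq_curryR {V W : D} (f : V ⟶ W) : dualR f = curryR (dual W ◁ f ≫ evR W) := by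
  simp [dualR, curryR]

lemma dualL_eq_curryL {V W : D} (f : V ⟶ W) : dualL f = curryL (f ▷ dual W ≫ evL W) := by
  simp [dualL, curryL]

lemma HasZigzags.dualR_evR (h : HasZigzags D) {V W : D} (f : V ⟶ W) :
    dualR f ▷ V ≫ evR V = dual W ◁ f ≫ evR W := by
  rw [dualR_eq_curryR, h.curryR_evR]

lemma HasZigzags.dualL_evL (h : HasZigzags D) {V W : D} (f : V ⟶ W) :
    V ◁ dualL f ≫ evL V = f ▷ dual W ≫ evL W := by
  rw [dualL_eq_curryL, h.curryL_evL]

lemma HasZigzags.dualTensorR_evR (h : HasZigzags D) (V W : D) :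
    dualTensorR V W ▷ (V ⊗ W) ≫ evR (V ⊗ W) = nestedEvR V W :=
  h.curryR_evR _

lemma HasZigzags.dualTensorL_evL (h : HasZigzags D) (V W : D) :
    (V ⊗ W) ◁ dualTensorL V W ≫ evL (V ⊗ W) = nestedEvL V W :=
  h.curryL_evL _

lemma HasZigzags.dualR_comp (h : HasZigzags D) {U V W : D} (f : U ⟶ V) (g : V ⟶ W) :
    dualR (f ≫ g) = dualR g ≫ dualR f := by
  refine h.evR_ext ?_
  rw [h.dualR_evR, comp_whiskerRight, Category.assoc, h.dualR_evR, ← whisker_exchange_assoc,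
    h.dualR_evR, MonoidalCategory.whiskerLeft_comp, Category.assoc]

lemma HasZigzags.dualL_comp (h : HasZigzags D) {U V W : D} (f : U ⟶ V) (g : V ⟶ W) :
    dualL (f ≫ g) = dualL g ≫ dualL f := by
  refine h.evL_ext ?_
  rw [h.dualL_evL, MonoidalCategory.whiskerLeft_comp, Category.assoc, h.dualL_evL,
    whisker_exchange_assoc, h.dualL_evL, comp_whiskerRight, Category.assoc]

lemma HasZigzags.dualTensorR_naturality (h : HasZigzags D) {V V' : D} (f : V ⟶ V') (W : D) :
    dualTensorR V' W ≫ dualR (f ▷ W) = dual W ◁ dualR f ≫ dualTensorR V W := by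
  refine h.evR_ext ?_
  rw [comp_whiskerRight, comp_whiskerRight, Category.assoc, Category.assoc, h.dualR_evR,
    h.dualTensorR_evR, ← whisker_exchange_assoc, h.dualTensorR_evR]
  calc _ = 𝟙 _ ⊗≫ dual W ◁ (dual V' ◁ f ≫ evR V') ▷ W ⊗≫ evR W := by
        simp only [nestedEvR]; monoidal
    _ = _ := by
        rw [← h.dualR_evR]; simp only [nestedEvR]; monoidal

lemma HasZigzags.dualTensorL_naturality (h : HasZigzags D) {V V' : D} (f : V ⟶ V') (W : D) :
    dualTensorL V' W ≫ dualL (f ▷ W) = dual W ◁ dualL f ≫ dualTensorL V W := by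
  refine h.evL_ext ?_
  rw [MonoidalCategory.whiskerLeft_comp, MonoidalCategory.whiskerLeft_comp, Category.assoc,
    Category.assoc, h.dualL_evL, h.dualTensorL_evL, whisker_exchange_assoc, h.dualTensorL_evL]
  calc _ = 𝟙 _ ⊗≫ (f ▷ ((W ⊗ dual W) ⊗ dual V') ≫ V' ◁ (evL W ▷ dual V')) ⊗≫ evL V' := by
        simp only [nestedEvL]; monoidal
    _ = 𝟙 _ ⊗≫ V ◁ evL W ▷ dual V' ⊗≫ f ▷ dual V' ≫ evL V' := by
        rw [← whisker_exchange]; monoidal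
    _ = 𝟙 _ ⊗≫ V ◁ (evL W ▷ dual V' ≫ 𝟙_ D ◁ dualL f) ⊗≫ evL V := by
        rw [← h.dualL_evL]; monoidal
    _ = _ := by
        rw [← whisker_exchange]; simp only [nestedEvL]; monoidal

/-- With the nested evaluation, W^* ⊗ V^* is another right dual of V ⊗ W, and the comparison is the
canonical isomorphism between two right duals of one object. -/
lemma HasZigzags.isIso_dualTensorR (h : HasZigzags D) (V W : D) : IsIso (dualTensorR V W) := by
  let _ := h.pairingR V
  let _ := h.pairingR W
  let e := rightDualIso (ExactPairing.tensor (X₁ := V) (X₂ := W) (Y₁ := dual V) (Y₂ := dual W))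
    (h.pairingR (V ⊗ W))
  have hn : nestedEvR V W = 𝟙 _ ⊗≫ dual W ◁ (evR V ▷ W) ⊗≫ evR W := by
    simp only [nestedEvR]; monoidal
  have : dualTensorR V W = e.hom := by
    refine h.evR_ext ?_
    rw [h.dualTensorR_evR, hn]
    exact ((@rightAdjointMate_comp_evaluation D _ _ (V ⊗ W) (V ⊗ W)
      (@HasRightDual.mk _ _ _ _ _ (h.pairingR (V ⊗ W)))
      (@HasRightDual.mk _ _ _ _ _ ExactPairing.tensor) (𝟙 (V ⊗ W))).trans
        ((whiskerLeft_id_assoc _ _ _).trans rfl)).symm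
  rw [this]
  infer_instance

/-- Each dual of f ▷ W is intertwined with the corresponding dual of f by comparison maps, which
agree by assumption and are invertible. -/
lemma HasZigzags.dual_whiskerRight_eq (h : HasZigzags D) {V V' : D} (f : V ⟶ V') (W : D)
    (hf : dualR f = dualL f) (h₁ : dualTensorR V W = dualTensorL V W)
    (h₂ : dualTensorR V' W = dualTensorL V' W) : dualR (f ▷ W) = dualL (f ▷ W) := by
  have := h.isIso_dualTensorR V' W
  rw [← cancel_epi (dualTensorR V' W), h.dualTensorR_naturality, h₂, h.dualTensorL_naturality,
    hf, h₁]

lemma HasZigzags.coevR_dualR (h : HasZigzags D) {V W : D} (f : V ⟶ W) :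
    coevR W ≫ W ◁ dualR f = coevR V ≫ f ▷ dual V := by
  let _ : HasRightDual V := @HasRightDual.mk _ _ _ V (dual V) (h.pairingR V)
  let _ : HasRightDual W := @HasRightDual.mk _ _ _ W (dual W) (h.pairingR W)
  exact coevaluation_comp_rightAdjointMate f

/-- Insert the identity `evL B ≫ coevR B` and slide e along the strand; e cancels against its
inverse and leaves a closed loop on A, equal to 1. The intended case is σ_a ≅ 𝟙 in `C^Z`. -/
lemma HasZigzags.dual_eq_of_iso (h : HasZigzags D) {A B : D} (e : A ≅ B)
    (hA : coevR A ≫ evL A = 𝟙 _) (hB : evL B ≫ coevR B = 𝟙 _) : dualR e.hom = dualL e.hom := by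
  refine h.evL_ext ?_
  rw [h.dualL_evL]
  have key : e.inv ▷ dual B ≫ A ◁ dualR e.hom ≫ evL A = evL B := by
    calc _ = (evL B ≫ coevR B) ≫ e.inv ▷ dual B ≫ A ◁ dualR e.hom ≫ evL A := by
          rw [hB, Category.id_comp]
      _ = evL B ≫ (coevR B ≫ B ◁ dualR e.hom) ≫ e.inv ▷ dual A ≫ evL A := by
          rw [← whisker_exchange_assoc]; simp
      _ = evL B := by
          rw [h.coevR_dualR, Category.assoc, ← comp_whiskerRight_assoc, e.hom_inv_id]
          simp [hA]
  rw [← key, ← comp_whiskerRight_assoc, e.hom_inv_id]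
  simp

end Duality

/-! ### Trivializing the translation objects: the shift isomorphisms -/

namespace TransCat

section CastHom

variable {C : Type u} [Category.{v} C] [Preadditive C] [MonoidalCategory C]
  [MonoidalPreadditive C] {Z : Type y} [AddCommGroup Z] {σ : Discrete Z ⥤ C}

lemma castHom_refl (a : Z) : castHom σ (rfl : a = a) = 𝟙 _ := rfl

lemma castHom_trans {a b c : Z} (h : a = b) (h' : b = c) :
    castHom σ h ≫ castHom σ h' = castHom σ (h.trans h') := by
  subst h h'
  simp [castHom]

variable [σ.Monoidal]

lemma whiskerLeft_castHom_mul (a : Z) {b b' : Z} (h : b = b') :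
    σ.obj ⟨a⟩ ◁ castHom σ h ≫ (mulIso σ a b').hom =
      (mulIso σ a b).hom ≫ castHom σ (congrArg (a + ·) h) := by
  subst h
  simp [castHom]

lemma castHom_whiskerRight_mul {a a' : Z} (h : a = a') (b : Z) :
    castHom σ h ▷ σ.obj ⟨b⟩ ≫ (mulIso σ a' b).hom =
      (mulIso σ a b).hom ≫ castHom σ (congrArg (· + b) h) := by
  subst h
  simp [castHom]

lemma mul_unit' (a : Z) : σ.obj ⟨a⟩ ◁ (unitIso σ).hom ≫ (mulIso σ a 0).hom =
    (ρ_ _).hom ≫ castHom σ (add_zero a).symm := by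
  rw [← mul_unit a, Category.assoc, Category.assoc, castHom_trans, castHom_refl, Category.comp_id]

lemma unit_mul' (b : Z) : (unitIso σ).hom ▷ σ.obj ⟨b⟩ ≫ (mulIso σ 0 b).hom =
    (λ_ _).hom ≫ castHom σ (zero_add b).symm := by
  rw [← unit_mul b, Category.assoc, Category.assoc, castHom_trans, castHom_refl, Category.comp_id]

/-- Associativity of σ regroups σ_a ⊗ σ_{-a} ⊗ σ_a, after which the unit laws finish. This is one
half of the invertibility of σ_a → 𝟙. -/
lemma mul_coevTrans (a : Z) :
    (ρ_ (σ.obj ⟨a⟩)).inv ≫ σ.obj ⟨a⟩ ◁ coevTrans σ a ≫ (α_ _ _ _).inv ≫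
      (mulIso σ a (-a)).hom ▷ σ.obj ⟨a⟩ ≫ castHom σ (add_neg_cancel a) ▷ σ.obj ⟨a⟩ =
      (λ_ _).inv ≫ (unitIso σ).hom ▷ σ.obj ⟨a⟩ := by
  rw [← cancel_mono (mulIso σ 0 a).hom]
  simp only [Category.assoc, castHom_whiskerRight_mul, unit_mul', Iso.inv_hom_id_assoc]
  have h := mul_assoc_eq (σ := σ) a (-a) a
  have h' : (mulIso σ a (-a)).hom ▷ σ.obj ⟨a⟩ ≫ (mulIso σ (a + -a) a).hom =
      (α_ _ _ _).hom ≫ σ.obj ⟨a⟩ ◁ (mulIso σ (-a) a).hom ≫ (mulIso σ a (-a + a)).hom ≫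
        castHom σ (add_assoc a (-a) a).symm := by
    rw [← reassoc_of% h, castHom_trans, castHom_refl, Category.comp_id]
  rw [reassoc_of% h']
  simp only [coevTrans, MonoidalCategory.whiskerLeft_comp, Category.assoc,
    Iso.inv_hom_id_assoc, whiskerLeft_inv_hom_assoc, castHom_trans]
  rw [reassoc_of% (whiskerLeft_castHom_mul (σ := σ)), castHom_trans]
  have := mul_unit' (σ := σ) a
  rw [reassoc_of% this, castHom_trans, Iso.inv_hom_id_assoc]

end CastHom

section Trans

variable {k : Type w} [Field k] {C : Type u} [Category.{v} C] [Preadditive C] [Linear k C]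
  [MonoidalCategory C] [MonoidalPreadditive C] [MonoidalLinear k C]
  {G : Type x} {Z : Type y} [AddCommGroup Z] [DecidableEq Z]
  {deg : G → ObjectProperty C} {χ : G → Z → kˣ} {σ : Discrete Z ⥤ C} [σ.Monoidal]

variable [BraidedCategory C]

/-- In `C^Z`, the object `σ_a` is isomorphic to the unit object, by a morphism of degree `a`. -/
noncomputable def transIso (deg : G → ObjectProperty C) (χ : G → Z → kˣ) (σ : Discrete Z ⥤ C)
    [σ.Monoidal] (a : Z) : (⟨σ.obj ⟨a⟩⟩ : TransCat deg χ σ) ≅ 𝟙_ (TransCat deg χ σ) where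
  hom := homOf (V := (⟨σ.obj ⟨a⟩⟩ : TransCat deg χ σ)) (W := 𝟙_ (TransCat deg χ σ)) a
    (ρ_ (σ.obj ⟨a⟩)).inv
  inv := homOf (V := 𝟙_ (TransCat deg χ σ)) (W := (⟨σ.obj ⟨a⟩⟩ : TransCat deg χ σ)) (-a)
    (coevTrans σ a)
  hom_inv_id := by
    rw [homOf_comp_homOf]
    refine homOf_eq (add_neg_cancel a) _ _ ?_
    refine Eq.trans ?_ ((mul_coevTrans a).trans (Category.id_comp _).symm)
    simp only [homComp, Category.assoc]
  inv_hom_id := by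
    rw [homOf_comp_homOf]
    refine homOf_eq (neg_add_cancel a) _ _ ?_
    change homComp (coevTrans σ a) (ρ_ (σ.obj ⟨a⟩)).inv ≫ _ ▷ 𝟙_ C =
      𝟙 (𝟙_ C) ≫ (λ_ (𝟙_ C)).inv ≫ (unitIso σ).hom ▷ 𝟙_ C
    simp only [homComp, coevTrans, Category.assoc, MonoidalCategory.whiskerLeft_rightUnitor_inv,
      Iso.hom_inv_id_assoc, rightUnitor_inv_naturality_assoc, ← comp_whiskerRight,
      Iso.inv_hom_id_assoc, castHom_trans]
    rw [castHom_refl, unitors_inv_equal, ← rightUnitor_inv_naturality]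
    simp

variable [AddCommGroup G]

/-- In `C^Z`, the objects `σ_a ⊗ W` and `W` are isomorphic, by a morphism of degree `a`. -/
noncomputable def shiftIso (hc : IsCentral deg χ σ) (a : Z) (W : TransCat deg χ σ) :
    (⟨σ.obj ⟨a⟩ ⊗ W.base⟩ : TransCat deg χ σ) ≅ W :=
  letI := hc.monoidalCategory
  whiskerRightIso (transIso deg χ σ a) W ≪≫ λ_ W

lemma shiftIso_hom_eq (hc : IsCentral deg χ σ) (a : Z) (W : TransCat deg χ σ) :
    letI := hc.monoidalCategory
    (shiftIso hc a W).hom = (transIso deg χ σ a).hom ▷ W ≫ (λ_ W).hom := rfl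

lemma shiftIso_hom (hc : IsCentral deg χ σ) (a : Z) (W : TransCat deg χ σ) :
    (shiftIso hc a W).hom = homOf a (𝟙 _) := by
  refine (congrArg (· ≫ incl (λ_ W.base).hom)
    (hc.whiskerRight_homOf (V := ⟨σ.obj ⟨a⟩⟩) (V' := 𝟙_ (TransCat deg χ σ))
      (ρ_ (σ.obj ⟨a⟩)).inv W)).trans ?_
  refine (homOf_comp_incl _ _).trans (congrArg (homOf a) ?_)
  simp only [homWhiskerRight]
  monoidal

lemma shiftIso_inv (hc : IsCentral deg χ σ) (a : Z) (W : TransCat deg χ σ) :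
    (shiftIso hc a W).inv =
      homOf (-a) ((λ_ W.base).inv ≫ coevTrans σ a ▷ W.base ≫ (α_ _ _ _).hom) := by
  refine (congrArg (incl (λ_ W.base).inv ≫ ·)
    (hc.whiskerRight_homOf (V := 𝟙_ (TransCat deg χ σ)) (V' := ⟨σ.obj ⟨a⟩⟩)
      (coevTrans σ a) W)).trans ?_
  exact (incl_comp_homOf _ _)

/-- The shift carries the whole degree, so additive statements about `C^Z` reduce to morphisms of
`C` and shifts. -/
lemma homOf_eq_incl_comp (hc : IsCentral deg χ σ) {V W : TransCat deg χ σ} {a : Z}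
    (f : V.base ⟶ σ.obj ⟨a⟩ ⊗ W.base) :
    homOf a f = (incl f : V ⟶ ⟨σ.obj ⟨a⟩ ⊗ W.base⟩) ≫ (shiftIso hc a W).hom := by
  rw [shiftIso_hom, incl_comp_homOf, Category.comp_id]

lemma shiftIso_naturality (hc : IsCentral deg χ σ) {V W : TransCat deg χ σ} (a : Z)
    (f : V.base ⟶ W.base) :
    (shiftIso hc a V).hom ≫ incl f = incl (σ.obj ⟨a⟩ ◁ f) ≫ (shiftIso hc a W).hom := by
  rw [← homOf_eq_incl_comp, shiftIso_hom, homOf_comp_incl, Category.id_comp]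

lemma shiftIso_add (hc : IsCentral deg χ σ) (W : TransCat deg χ σ) (a b : Z) :
    (shiftIso hc a ⟨σ.obj ⟨b⟩ ⊗ W.base⟩).hom ≫ (shiftIso hc b W).hom =
      incl ((α_ _ _ _).inv ≫ (mulIso σ a b).hom ▷ W.base) ≫ (shiftIso hc (a + b) W).hom := by
  rw [← homOf_eq_incl_comp, shiftIso_hom, shiftIso_hom, homOf_comp_homOf]
  simp [homComp]

lemma shiftIso_zero (hc : IsCentral deg χ σ) (W : TransCat deg χ σ) :
    (shiftIso hc 0 W).inv = incl ((λ_ W.base).inv ≫ (unitIso σ).hom ▷ W.base) := by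
  rw [← cancel_mono (shiftIso hc 0 W).hom, Iso.inv_hom_id, ← homOf_eq_incl_comp, ← incl_id]
  rw [incl_eq]
  simp [homEmbed]

lemma shiftIso_whiskerRight (hc : IsCentral deg χ σ) (a : Z) (V W : TransCat deg χ σ) :
    (shiftIso hc a V).hom ▷ W =
      incl (α_ _ _ _).hom ≫ (shiftIso hc a (V ⊗ W)).hom := by
  rw [← homOf_eq_incl_comp, shiftIso_hom, hc.whiskerRight_homOf]
  simp [homWhiskerRight]

/-- Moving a shift out past V costs a half braiding, whereas whiskering on the right costs only an
associator. The unitarity of half braidings enters the dagger axioms through this formula. -/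
lemma whiskerLeft_shiftIso (hc : IsCentral deg χ σ) (a : Z) (V W : TransCat deg χ σ) :
    V ◁ (shiftIso hc a W).hom =
      incl ((α_ _ _ _).inv ≫ halfBraiding deg χ σ V.base a ▷ W.base ≫ (α_ _ _ _).hom) ≫
        (shiftIso hc a (V ⊗ W)).hom := by
  rw [← homOf_eq_incl_comp, shiftIso_hom, whiskerLeft_homOf]
  simp [homWhiskerLeft]

end Trans

end TransCat

/-! ### Unitarity of the half braidings and the dagger of `C^Z` -/

section Dag

variable {k : Type w} [Field k] [StarRing k] {C : Type u} [Category.{v} C] [Preadditive C]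
  [Linear k C] [MonoidalCategory C] [PivotalStruct C] [DaggerStruct C]

lemma IsHermitianPivotal.dag_whiskerRight (hC : IsHermitianPivotal k C) {V V' : C} (f : V ⟶ V')
    (W : C) : dag (f ▷ W) = dag f ▷ W := by
  rw [← tensorHom_id, hC.dag_tensor, hC.dag_id, tensorHom_id]

lemma IsHermitianPivotal.dag_whiskerLeft (hC : IsHermitianPivotal k C) (W : C) {V V' : C}
    (f : V ⟶ V') : dag (W ◁ f) = W ◁ dag f := by
  rw [← id_tensorHom, hC.dag_tensor, hC.dag_id, id_tensorHom]

lemma IsHermitianPivotal.dag_associator_inv (hC : IsHermitianPivotal k C) (U V W : C) :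
    dag (α_ U V W).inv = (α_ U V W).hom := by
  rw [← hC.dag_associator, hC.dag_dag]

lemma IsHermitianPivotal.dag_leftUnitor_inv (hC : IsHermitianPivotal k C) (V : C) :
    dag (λ_ V).inv = (λ_ V).hom := by
  rw [← hC.dag_leftUnitor, hC.dag_dag]

variable [MonoidalPreadditive C] [MonoidalLinear k C] [BraidedCategory C]
  {G : Type x} [AddCommGroup G] {Z : Type y} [AddCommGroup Z]
  {deg : G → ObjectProperty C} {χ : G → Z → kˣ} {σ : Discrete Z ⥤ C}

lemma dag_halfBraiding (hC : IsHermitianRibbon k C) (hG : IsGraded deg)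
    (hχ : ∀ g a, star (χ g a : k) * (χ g a : k) = 1) (V : C) (a : Z) :
    dag (halfBraiding deg χ σ V a) =
      (β_ V (σ.obj ⟨a⟩)).inv ≫ degreeScalar deg (fun g => (χ g a : k)) V ▷ σ.obj ⟨a⟩ := by
  have h : (fun g => star (((χ g a)⁻¹ : kˣ) : k)) = fun g => (χ g a : k) := by
    funext g
    rw [Units.val_inv_eq_inv_val, star_inv₀]
    exact inv_eq_of_mul_eq_one_right (hχ g a)
  rw [halfBraiding, hC.dag_comp, hC.dag_braiding, hC.dag_whiskerRight,
    dag_degreeScalar hC.toIsHermitianPivotal hG, h]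

/-- The braiding cancels against its dagger, and the remaining scalars χ⁻¹ and χ are inverse because
conjugation inverts χ. -/
lemma halfBraiding_comp_dag (hC : IsHermitianRibbon k C) (hG : IsGraded deg)
    (hχ : ∀ g a, star (χ g a : k) * (χ g a : k) = 1) (V : C) (a : Z) :
    halfBraiding deg χ σ V a ≫ dag (halfBraiding deg χ σ V a) = 𝟙 _ := by
  rw [dag_halfBraiding hC hG hχ, halfBraiding, Category.assoc, Iso.hom_inv_id_assoc,
    ← comp_whiskerRight, degreeScalar_mul hG]
  simp [degreeScalar_one hG]

end Dag

namespace TransCat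

section Dagger

variable {k : Type w} [Field k] [StarRing k] {C : Type u} [Category.{v} C] [Preadditive C]
  [Linear k C] [MonoidalCategory C] [MonoidalPreadditive C] [MonoidalLinear k C]
  [BraidedCategory C] [PivotalStruct C] [DaggerStruct C]
  {G : Type x} [AddCommGroup G] {Z : Type y} [AddCommGroup Z] [DecidableEq Z]
  {deg : G → ObjectProperty C} {χ : G → Z → kˣ} {σ : Discrete Z ⥤ C} [σ.Monoidal]

/-- Inserting `A' ≫ A` in front of `s.inv ≫ y` cancels s and then x. It converts a formula for a
shift into one for the inverse shift, with the structure map x replaced by its dagger. -/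
lemma retraction_eq {D : Type*} [Category* D] {P Q R : D} (s : Q ≅ R) {A : P ⟶ R}
    (A' : R ⟶ P) (x : P ⟶ Q) {y : Q ⟶ P} (h : A' ≫ A = 𝟙 R) (hA : A = x ≫ s.hom)
    (hxy : x ≫ y = 𝟙 P) : A' = s.inv ≫ y := by
  rw [← Category.id_comp s.inv, ← h, hA]
  simp [hxy]

/-- The coevaluation in the definition of the dagger is the one occurring in the inverse shift. In
this form the definition says that shifts are unitary. -/
lemma dag_homOf (hc : IsCentral deg χ σ) {V W : TransCat deg χ σ} {a : Z}
    (f : V.base ⟶ σ.obj ⟨a⟩ ⊗ W.base) :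
    dag (homOf a f : V ⟶ W) =
      (shiftIso hc a W).inv ≫ (incl (dag f) : ⟨σ.obj ⟨a⟩ ⊗ W.base⟩ ⟶ V) := by
  have : dag (homOf a f : V ⟶ W) = homOf (-a) (homDag f) :=
    DirectSum.toAddMonoid_of (β := fun c : Z => (V.base ⟶ σ.obj ⟨c⟩ ⊗ W.base)) _ a f
  rw [this, shiftIso_inv, homOf_comp_incl]
  simp [homDag]

/-- The conditions under which the dagger makes `C^Z` a Hermitian category. -/
structure IsUnitaryCentral (k : Type w) [Field k] [StarRing k] {C : Type u} [Category.{v} C]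
    [Preadditive C] [Linear k C] [MonoidalCategory C] [BraidedCategory C] [PivotalStruct C]
    [DaggerStruct C] {G : Type x} [AddCommGroup G] {Z : Type y} [AddCommGroup Z]
    (deg : G → ObjectProperty C) (χ : G → Z → kˣ) (σ : Discrete Z ⥤ C) [σ.Monoidal] : Prop where
  hermitian : IsHermitianPivotal k C
  central : IsCentral deg χ σ
  dag_unit : dag (unitIso σ).hom = (unitIso σ).inv
  dag_mul : ∀ a b, dag (mulIso σ a b).hom = (mulIso σ a b).inv
  half_comp_dag : ∀ V a, halfBraiding deg χ σ V a ≫ dag (halfBraiding deg χ σ V a) = 𝟙 _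

namespace IsUnitaryCentral

lemma dag_incl (h : IsUnitaryCentral k deg χ σ) {V W : TransCat deg χ σ}
    (f : V.base ⟶ W.base) : dag (incl f : V ⟶ W) = incl (dag f) := by
  rw [incl_eq, dag_homOf h.central, shiftIso_zero, ← incl_comp, homEmbed, h.hermitian.dag_comp,
    h.hermitian.dag_comp, h.hermitian.dag_whiskerRight, h.hermitian.dag_leftUnitor_inv, h.dag_unit]
  simp

lemma dag_shiftIso (h : IsUnitaryCentral k deg χ σ) (a : Z) (W : TransCat deg χ σ) :
    dag (shiftIso h.central a W).hom = (shiftIso h.central a W).inv := by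
  rw [shiftIso_hom, dag_homOf h.central, h.hermitian.dag_id]
  exact Category.comp_id _

lemma dag_comp (h : IsUnitaryCentral k deg χ σ) {U V W : TransCat deg χ σ} (f : U ⟶ V)
    (g : V ⟶ W) : dag (f ≫ g) = dag g ≫ dag f := by
  induction f using hom_induction with
  | h0 => simp
  | ha f f' hf hf' => rw [Preadditive.add_comp, map_add, map_add, Preadditive.comp_add, hf, hf']
  | h a f =>
    induction g using hom_induction with
    | h0 => simp
    | ha g g' hg hg' => rw [Preadditive.comp_add, map_add, map_add, Preadditive.add_comp, hg, hg']
    | h b g =>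
      -- Inverse shifts compose up to the inverse multiplication of σ, which is also what the dagger
      -- of a composite produces.
      have key : (shiftIso h.central b W).inv ≫ (shiftIso h.central a ⟨σ.obj ⟨b⟩ ⊗ W.base⟩).inv =
          (shiftIso h.central (a + b) W).inv ≫
            incl ((mulIso σ a b).inv ▷ W.base ≫ (α_ _ _ _).hom) :=
        retraction_eq _ _ _ (by simp) (shiftIso_add h.central W a b) (by
          rw [← incl_comp, ← incl_id]; simp)
      have key' : incl (dag g) ≫ (shiftIso h.central a V).inv =
          (shiftIso h.central a ⟨σ.obj ⟨b⟩ ⊗ W.base⟩).inv ≫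
            (incl (σ.obj ⟨a⟩ ◁ dag g) : _ ⟶ ⟨σ.obj ⟨a⟩ ⊗ V.base⟩) := by
        rw [Iso.comp_inv_eq, Category.assoc, Iso.eq_inv_comp]
        exact shiftIso_naturality h.central (V := ⟨σ.obj ⟨b⟩ ⊗ W.base⟩) a (dag g)
      rw [homOf_comp_homOf, dag_homOf h.central, dag_homOf h.central, dag_homOf h.central, homComp,
        h.hermitian.dag_comp, h.hermitian.dag_comp, h.hermitian.dag_comp,
        h.hermitian.dag_whiskerRight, h.hermitian.dag_whiskerLeft, h.dag_mul,
        h.hermitian.dag_associator_inv]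
      have e : (shiftIso h.central b W).inv ≫ incl (dag g) ≫ (shiftIso h.central a V).inv ≫
          incl (dag f) = ((shiftIso h.central b W).inv ≫
            (shiftIso h.central a ⟨σ.obj ⟨b⟩ ⊗ W.base⟩).inv) ≫ incl (σ.obj ⟨a⟩ ◁ dag g) ≫
              (incl (dag f) : ⟨σ.obj ⟨a⟩ ⊗ V.base⟩ ⟶ U) := by
        rw [reassoc_of% key', Category.assoc]
      simp only [Category.assoc]
      rw [e, key, Category.assoc, ← incl_comp, ← incl_comp]
      simp only [Category.assoc]

lemma dag_id (h : IsUnitaryCentral k deg χ σ) (V : TransCat deg χ σ) : dag (𝟙 V) = 𝟙 V := by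
  rw [← incl_id, h.dag_incl, h.hermitian.dag_id]

lemma dag_shiftIso_inv (h : IsUnitaryCentral k deg χ σ) (a : Z) (W : TransCat deg χ σ) :
    dag (shiftIso h.central a W).inv = (shiftIso h.central a W).hom := by
  rw [← cancel_mono (shiftIso h.central a W).inv, Iso.hom_inv_id, ← h.dag_shiftIso,
    ← h.dag_comp, h.dag_shiftIso, Iso.hom_inv_id, h.dag_id]

lemma dag_dag (h : IsUnitaryCentral k deg χ σ) {V W : TransCat deg χ σ} (f : V ⟶ W) :
    dag (dag f) = f := by
  induction f using hom_induction with
  | h0 => simp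
  | ha f f' hf hf' => rw [map_add, map_add, hf, hf']
  | h a f =>
    rw [dag_homOf h.central, h.dag_comp, h.dag_shiftIso_inv, h.dag_incl, h.hermitian.dag_dag,
      ← homOf_eq_incl_comp]

lemma dag_smul (h : IsUnitaryCentral k deg χ σ) {V W : TransCat deg χ σ} (r : k) (f : V ⟶ W) :
    dag (r • f) = star r • dag f := by
  induction f using hom_induction with
  | h0 => simp
  | ha f f' hf hf' => rw [smul_add, map_add, map_add, smul_add, hf, hf']
  | h a f =>
    rw [smul_homOf, dag_homOf h.central, dag_homOf h.central, h.hermitian.dag_smul, incl_smul,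
      Linear.comp_smul]

lemma dag_whiskerRight (h : IsUnitaryCentral k deg χ σ) {V V' : TransCat deg χ σ} (f : V ⟶ V')
    (W : TransCat deg χ σ) : dag (f ▷ W) = dag f ▷ W := by
  induction f using hom_induction with
  | h0 => simp [zero_whiskerRight]
  | ha f f' hf hf' => rw [add_whiskerRight, map_add, map_add, add_whiskerRight, hf, hf']
  | h a f =>
    have key : (shiftIso h.central a V').inv ▷ W =
        (shiftIso h.central a (V' ⊗ W)).inv ≫ incl (α_ _ _ _).inv := by
      refine retraction_eq _ _ _ ?_ (shiftIso_whiskerRight h.central a V' W) ?_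
      · rw [← h.central.comp_whiskerRight, Iso.inv_hom_id, h.central.whiskerRight_id]
      · rw [← incl_comp, ← incl_id, Iso.hom_inv_id]
    rw [homOf_eq_incl_comp h.central, h.central.comp_whiskerRight, h.dag_comp, h.dag_comp,
      h.central.comp_whiskerRight, h.central.incl_whiskerRight, h.dag_incl, h.dag_incl,
      h.hermitian.dag_whiskerRight, h.central.incl_whiskerRight, shiftIso_whiskerRight,
      h.dag_comp, h.dag_shiftIso, h.dag_shiftIso, h.dag_incl, h.hermitian.dag_associator, key]

/-- Pulling the inverse shift past W produces an inverse half braiding, the dagger a daggered one;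
they agree by unitarity. -/
lemma dag_whiskerLeft (h : IsUnitaryCentral k deg χ σ) (W : TransCat deg χ σ)
    {V V' : TransCat deg χ σ} (f : V ⟶ V') : dag (W ◁ f) = W ◁ dag f := by
  induction f using hom_induction with
  | h0 => simp [whiskerLeft_zero]
  | ha f f' hf hf' => rw [whiskerLeft_add, map_add, map_add, whiskerLeft_add, hf, hf']
  | h a f =>
    have key : W ◁ (shiftIso h.central a V').inv =
        (shiftIso h.central a (W ⊗ V')).inv ≫ incl ((α_ _ _ _).inv ≫
          dag (halfBraiding deg χ σ W.base a) ▷ V'.base ≫ (α_ _ _ _).hom) := by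
      refine retraction_eq _ _ _ ?_ (whiskerLeft_shiftIso h.central a W V') ?_
      · rw [← h.central.whiskerLeft_comp, Iso.inv_hom_id, h.central.whiskerLeft_id]
      · rw [← incl_comp, ← incl_id]
        have := congrArg (· ▷ V'.base) (h.half_comp_dag W.base a)
        simp only [MonoidalCategory.comp_whiskerRight] at this
        simp only [Category.assoc, Iso.hom_inv_id_assoc, reassoc_of% this]
        simp
    rw [homOf_eq_incl_comp h.central, h.central.whiskerLeft_comp, h.dag_comp, h.dag_comp,
      h.central.whiskerLeft_comp, h.central.whiskerLeft_incl, h.dag_incl, h.dag_incl,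
      h.hermitian.dag_whiskerLeft, h.central.whiskerLeft_incl, whiskerLeft_shiftIso,
      h.dag_comp, h.dag_shiftIso, h.dag_shiftIso, h.dag_incl, h.hermitian.dag_comp,
      h.hermitian.dag_comp, h.hermitian.dag_associator, h.hermitian.dag_associator_inv,
      h.hermitian.dag_whiskerRight, Category.assoc, key, Category.assoc,
      Category.assoc]

lemma dag_tensorHom (h : IsUnitaryCentral k deg χ σ) {V V' W W' : TransCat deg χ σ} (f : V ⟶ V')
    (g : W ⟶ W') : dag (f ⊗ₘ g) = dag f ⊗ₘ dag g := by
  rw [h.central.tensorHom_def, h.dag_comp, h.dag_whiskerLeft, h.dag_whiskerRight,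
    h.central.tensorHom_def, h.central.whisker_exchange]

end IsUnitaryCentral

end Dagger

end TransCat

/-! ### Dimension one of the translation objects and pivotality of `C^Z` -/

section Dimension

variable {D : Type u} [Category.{v} D] [MonoidalCategory D] [PivotalStruct D]

/-- Slide e around the loop: it travels as one kind of dual and returns as the other, so both must
agree for it to meet its inverse. Used to pass from σ_0 to the unit. -/
lemma HasZigzags.dimR_eq_of_iso (h : HasZigzags D) {A B : D} (e : A ≅ B)
    (he : dualR e.hom = dualL e.hom) : coevR A ≫ evL A = coevR B ≫ evL B := by
  calc _ = (coevR A ≫ e.hom ▷ dual A) ≫ e.inv ▷ dual A ≫ evL A := by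
        rw [Category.assoc, ← comp_whiskerRight_assoc, e.hom_inv_id]; simp
    _ = coevR B ≫ B ◁ dualR e.hom ≫ B ◁ dualL e.inv ≫ evL B := by
        rw [← h.coevR_dualR, Category.assoc, h.dualL_evL]
    _ = coevR B ≫ B ◁ dualL (e.inv ≫ e.hom) ≫ evL B := by
        rw [he, h.dualL_comp]; simp
    _ = _ := by
        rw [e.inv_hom_id, h.dualL_evL]; simp

/-- A zigzag makes the coevaluation of the unit a split epimorphism, so it may be cancelled on the
left, where the assumption applies. -/
lemma HasZigzags.evL_coevR_unit (h : HasZigzags D) (hd : coevR (𝟙_ D) ≫ evL (𝟙_ D) = 𝟙 _) :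
    evL (𝟙_ D) ≫ coevR (𝟙_ D) = 𝟙 _ := by
  let c : 𝟙_ D ⟶ dual (𝟙_ D) := coevR (𝟙_ D) ≫ (λ_ _).hom
  let e : dual (𝟙_ D) ⟶ 𝟙_ D := (ρ_ _).inv ≫ evR (𝟙_ D)
  have hec : e ≫ c = 𝟙 _ := by
    calc _ = (ρ_ (dual (𝟙_ D))).inv ≫ evR (𝟙_ D) ≫ coevR (𝟙_ D) ≫ (λ_ _).hom := by simp [c, e]
      _ = 𝟙 _ ⊗≫ (evR (𝟙_ D) ▷ 𝟙_ D ≫ 𝟙_ D ◁ coevR (𝟙_ D)) ⊗≫ 𝟙 _ := by monoidal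
      _ = (ρ_ (dual (𝟙_ D))).inv ≫ dual (𝟙_ D) ◁ coevR (𝟙_ D) ≫
          (α_ _ _ _).inv ≫ evR (𝟙_ D) ▷ dual (𝟙_ D) ≫ (λ_ (dual (𝟙_ D))).hom := by
          rw [← whisker_exchange]; monoidal
      _ = 𝟙 _ := h.zigzagR_dual _
  have hc : coevR (𝟙_ D) = c ≫ (λ_ _).inv := by simp [c]
  have hs : e ≫ c ≫ (λ_ _).inv = (λ_ (dual (𝟙_ D))).inv := by
    rw [reassoc_of% hec]
  rw [← cancel_epi ((λ_ (dual (𝟙_ D))).inv), ← hs]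
  simp only [Category.assoc, ← hc]
  rw [reassoc_of% hd]
  simp

end Dimension

namespace TransCat

section Linear

variable {k : Type w} [Field k] {C : Type u} [Category.{v} C] [Preadditive C]
  [Linear k C] [MonoidalCategory C] [MonoidalPreadditive C] [MonoidalLinear k C]
  [BraidedCategory C] {G : Type x} [AddCommGroup G] {Z : Type y} [AddCommGroup Z] [DecidableEq Z]
  {deg : G → ObjectProperty C} {χ : G → Z → kˣ} {σ : Discrete Z ⥤ C} [σ.Monoidal]

/-- In `C^Z` the shifts conjugate σ_a ◁ f into f, and `C` embeds faithfully. -/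
lemma IsCentral.whiskerLeft_trans_injective (hc : IsCentral deg χ σ) (a : Z) {V W : C}
    {f g : V ⟶ W} (h : σ.obj ⟨a⟩ ◁ f = σ.obj ⟨a⟩ ◁ g) : f = g := by
  apply incl_injective (deg := deg) (χ := χ) (σ := σ) (V := ⟨V⟩) (W := ⟨W⟩)
  rw [← cancel_epi (shiftIso hc a ⟨V⟩).hom, shiftIso_naturality, shiftIso_naturality, h]

lemma IsCentral.whiskerRight_trans_injective (hc : IsCentral deg χ σ) (a : Z) {V W : C}
    {f g : V ⟶ W} (h : f ▷ σ.obj ⟨a⟩ = g ▷ σ.obj ⟨a⟩) : f = g := by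
  apply hc.whiskerLeft_trans_injective a
  rw [← cancel_epi (β_ V (σ.obj ⟨a⟩)).hom, ← BraidedCategory.braiding_naturality_left, h,
    BraidedCategory.braiding_naturality_left]

lemma braiding_trans (hσ : BraidsTrivially σ) (a : Z) :
    (β_ (σ.obj ⟨a⟩) (σ.obj ⟨a⟩)).hom = 𝟙 _ := by
  rw [← cancel_mono (mulIso σ a a).hom, hσ a a, Category.id_comp]
  exact Category.comp_id _

lemma IsCentral.monoidalPreadditive (hc : IsCentral deg χ σ) :
    @MonoidalPreadditive (TransCat deg χ σ) _ _ hc.monoidalCategory := by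
  let _ := hc.monoidalCategory
  exact
    { whiskerLeft_zero := whiskerLeft_zero _
      zero_whiskerRight := zero_whiskerRight _
      whiskerLeft_add := whiskerLeft_add _
      add_whiskerRight := fun f g => add_whiskerRight f g _ }

lemma whiskerRight_smul (hc : IsCentral deg χ σ) (r : k) {V V' : TransCat deg χ σ} (f : V ⟶ V')
    (W : TransCat deg χ σ) : (r • f) ▷ W = r • f ▷ W := by
  induction f using hom_induction with
  | h0 => simp [zero_whiskerRight]
  | ha f f' hf hf' => rw [smul_add, add_whiskerRight, add_whiskerRight, smul_add, hf, hf']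
  | h a f =>
    rw [smul_homOf, hc.whiskerRight_homOf, hc.whiskerRight_homOf, smul_homOf]
    simp [homWhiskerRight]

lemma whiskerLeft_smul (W : TransCat deg χ σ) (r : k) {V V' : TransCat deg χ σ} (f : V ⟶ V') :
    W ◁ (r • f) = r • W ◁ f := by
  induction f using hom_induction with
  | h0 => simp [whiskerLeft_zero]
  | ha f f' hf hf' => rw [smul_add, whiskerLeft_add, whiskerLeft_add, smul_add, hf, hf']
  | h a f =>
    rw [smul_homOf, whiskerLeft_homOf, whiskerLeft_homOf, smul_homOf]
    simp [homWhiskerLeft]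

lemma isSimpleObj_of_base {V : TransCat deg χ σ} (hV : IsSimpleObj k V.base)
    (h : ∀ a : Z, a ≠ 0 → ∀ f : V.base ⟶ σ.obj ⟨a⟩ ⊗ V.base, f = 0) : IsSimpleObj k V := by
  refine ⟨fun r s hrs => hV.1 ?_, fun f => ?_⟩
  · apply incl_injective (V := V) (W := V)
    simpa only [incl_smul, incl_id] using hrs
  · induction f using hom_induction with
    | h0 => exact ⟨0, zero_smul _ _⟩
    | ha f g hf hg =>
      obtain ⟨r, rfl⟩ := hf
      obtain ⟨s, rfl⟩ := hg
      exact ⟨r + s, add_smul _ _ _⟩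
    | h a f =>
      by_cases ha : a = 0
      · subst ha
        rw [homOf_zero_eq_incl]
        obtain ⟨r, hr⟩ := hV.2 (f ≫ (unitIso σ).inv ▷ V.base ≫ (λ_ V.base).hom)
        exact ⟨r, by simp only [← hr, incl_smul, incl_id]⟩
      · exact ⟨0, by simp only [h a ha f, map_zero, zero_smul]⟩

lemma IsCentral.isTensorCategory (hc : IsCentral deg χ σ) (hu : IsSimpleObj k (𝟙_ C))
    (h : ∀ a : Z, a ≠ 0 → ∀ f : 𝟙_ C ⟶ σ.obj ⟨a⟩ ⊗ 𝟙_ C, f = 0) :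
    IsTensorCategory k (TransCat deg χ σ) where
  monoidal := by
    refine ⟨hc.monoidalCategory, rfl, hc.monoidalPreadditive, ?_⟩
    let _ := hc.monoidalCategory
    let _ := hc.monoidalPreadditive
    exact
      { whiskerLeft_smul := fun W _ _ r f => whiskerLeft_smul W r f
        smul_whiskerRight := fun r _ _ f W => whiskerRight_smul hc r f W }
  end_unit := isSimpleObj_of_base (V := 𝟙_ (TransCat deg χ σ)) hu h

end Linear

section Pivotal

variable {k : Type w} [Field k] {C : Type u} [Category.{v} C] [Preadditive C]
  [Linear k C] [MonoidalCategory C] [MonoidalPreadditive C] [MonoidalLinear k C]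
  [BraidedCategory C] [PivotalStruct C]
  {G : Type x} [AddCommGroup G] {Z : Type y} [AddCommGroup Z] [DecidableEq Z]
  {deg : G → ObjectProperty C} {χ : G → Z → kˣ} {σ : Discrete Z ⥤ C} [σ.Monoidal]

/-- With trivial self-braiding the twist is the partial trace of an identity, that is, σ_a tensored
with its own dimension; tensoring with σ_a is faithful. -/
lemma IsCentral.dimR_trans (hc : IsCentral deg χ σ) (a : Z) (h : twistR (σ.obj ⟨a⟩) = 𝟙 _) :
    coevR (σ.obj ⟨a⟩) ≫ evL (σ.obj ⟨a⟩) = 𝟙 _ := by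
  apply hc.whiskerLeft_trans_injective a
  rw [twistR, ptrR, braiding_trans hc.braids] at h
  simp only [id_whiskerRight, Category.id_comp, Iso.inv_hom_id_assoc, Iso.inv_comp_eq,
    Category.comp_id] at h
  rw [← cancel_mono (ρ_ _).hom]
  simpa using h

lemma IsCentral.dimL_trans (hc : IsCentral deg χ σ) (a : Z) (h : twistL (σ.obj ⟨a⟩) = 𝟙 _) :
    coevL (σ.obj ⟨a⟩) ≫ evR (σ.obj ⟨a⟩) = 𝟙 _ := by
  apply hc.whiskerRight_trans_injective a
  rw [twistL, ptrL, braiding_trans hc.braids] at h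
  simp only [MonoidalCategory.whiskerLeft_id, Category.id_comp, Iso.hom_inv_id_assoc, Iso.inv_comp_eq,
    Category.comp_id] at h
  rw [← cancel_mono (λ_ _).hom]
  simpa using h

lemma coevR_eq (V : TransCat deg χ σ) : coevR V = incl (coevR V.base) := rfl

lemma evR_eq (V : TransCat deg χ σ) : evR V = incl (evR V.base) := rfl

lemma coevL_eq (V : TransCat deg χ σ) : coevL V = incl (coevL V.base) := rfl

lemma evL_eq (V : TransCat deg χ σ) : evL V = incl (evL V.base) := rfl

lemma IsCentral.hasZigzags (hc : IsCentral deg χ σ) (h : HasZigzags C) :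
    HasZigzags (TransCat deg χ σ) where
  zigzagR V := by
    simp only [coevR_eq, evR_eq, associator_eq, leftUnitor_inv_eq, rightUnitor_eq,
      hc.incl_whiskerRight, hc.whiskerLeft_incl, ← incl_comp]
    exact congrArg incl (h.zigzagR V.base)
  zigzagR_dual V := by
    simp only [coevR_eq, evR_eq, associator_inv_eq, rightUnitor_inv_eq, leftUnitor_eq,
      hc.incl_whiskerRight, hc.whiskerLeft_incl, ← incl_comp]
    exact congrArg incl (h.zigzagR_dual V.base)
  zigzagL V := by
    simp only [coevL_eq, evL_eq, associator_inv_eq, rightUnitor_inv_eq, leftUnitor_eq,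
      hc.incl_whiskerRight, hc.whiskerLeft_incl, ← incl_comp]
    exact congrArg incl (h.zigzagL V.base)
  zigzagL_dual V := by
    simp only [coevL_eq, evL_eq, associator_eq, leftUnitor_inv_eq, rightUnitor_eq,
      hc.incl_whiskerRight, hc.whiskerLeft_incl, ← incl_comp]
    exact congrArg incl (h.zigzagL_dual V.base)

lemma IsCentral.dualR_incl (hc : IsCentral deg χ σ) {V W : TransCat deg χ σ}
    (f : V.base ⟶ W.base) : dualR (incl f : V ⟶ W) = incl (dualR f) := by
  simp only [dualR, coevR_eq, evR_eq, associator_inv_eq, rightUnitor_inv_eq, leftUnitor_eq,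
    hc.incl_whiskerRight, hc.whiskerLeft_incl, ← incl_comp]
  rfl

lemma IsCentral.dualL_incl (hc : IsCentral deg χ σ) {V W : TransCat deg χ σ}
    (f : V.base ⟶ W.base) : dualL (incl f : V ⟶ W) = incl (dualL f) := by
  simp only [dualL, coevL_eq, evL_eq, associator_eq, leftUnitor_inv_eq, rightUnitor_eq,
    hc.incl_whiskerRight, hc.whiskerLeft_incl, ← incl_comp]
  rfl

lemma IsCentral.dualTensorR_eq (hc : IsCentral deg χ σ) (V W : TransCat deg χ σ) :
    dualTensorR V W = incl (dualTensorR V.base W.base) := by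
  simp only [dualTensorR, nestedEvR, coevR_eq, evR_eq, associator_eq, associator_inv_eq,
    rightUnitor_inv_eq, leftUnitor_eq, hc.incl_whiskerRight, hc.whiskerLeft_incl, ← incl_comp]
  rfl

lemma IsCentral.dualTensorL_eq (hc : IsCentral deg χ σ) (V W : TransCat deg χ σ) :
    dualTensorL V W = incl (dualTensorL V.base W.base) := by
  simp only [dualTensorL, nestedEvL, coevL_eq, evL_eq, associator_eq, associator_inv_eq,
    leftUnitor_inv_eq, leftUnitor_eq, rightUnitor_eq, hc.incl_whiskerRight, hc.whiskerLeft_incl,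
    ← incl_comp]
  rfl

lemma dualR_add {V W : TransCat deg χ σ} (f g : V ⟶ W) : dualR (f + g) = dualR f + dualR g := by
  simp only [dualR, add_whiskerRight, whiskerLeft_add, Preadditive.add_comp, Preadditive.comp_add]

lemma dualL_add {V W : TransCat deg χ σ} (f g : V ⟶ W) : dualL (f + g) = dualL f + dualL g := by
  simp only [dualL, add_whiskerRight, whiskerLeft_add, Preadditive.add_comp, Preadditive.comp_add]

lemma IsCentral.dual_transIso (hc : IsCentral deg χ σ) (hC : IsPivotalCategory k C)
    (ht : ∀ a, twistR (σ.obj ⟨a⟩) = 𝟙 _) (a : Z) :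
    dualR (transIso deg χ σ a).hom = dualL (transIso deg χ σ a).hom := by
  let _ := hc.monoidalCategory
  -- The unit has dimension one because it is isomorphic to σ_0.
  have h1 : coevR (𝟙_ C) ≫ evL (𝟙_ C) = 𝟙 _ := by
    rw [hC.hasZigzags.dimR_eq_of_iso (unitIso σ) (hC.dual_eq _)]
    exact hc.dimR_trans 0 (ht 0)
  refine (hc.hasZigzags hC.hasZigzags).dual_eq_of_iso (transIso deg χ σ a) ?_ ?_
  · rw [coevR_eq, evL_eq, ← incl_comp]
    exact congrArg incl (hc.dimR_trans a (ht a))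
  · rw [coevR_eq, evL_eq, ← incl_comp]
    exact congrArg incl (hC.hasZigzags.evL_coevR_unit h1)

lemma IsCentral.dual_eq (hc : IsCentral deg χ σ) (hC : IsPivotalCategory k C)
    (ht : ∀ a, twistR (σ.obj ⟨a⟩) = 𝟙 _) {V W : TransCat deg χ σ} (f : V ⟶ W) :
    dualR f = dualL f := by
  have hT : ∀ V W : TransCat deg χ σ, dualTensorR V W = dualTensorL V W := fun V W => by
    rw [hc.dualTensorR_eq, hc.dualTensorL_eq, hC.dualTensor_eq]
  let _ := hc.monoidalCategory
  have hz := hc.hasZigzags hC.hasZigzags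
  induction f using hom_induction with
  | h0 =>
    rw [← incl_zero, hc.dualR_incl, hc.dualL_incl, hC.dual_eq]
  | ha f g hf hg => rw [dualR_add, dualL_add, hf, hg]
  | h a f =>
    -- The morphism is now a composite of two morphisms of `C` and, between them, `transIso`
    -- whiskered by W; only the middle factor needs an argument.
    rw [homOf_eq_incl_comp hc, shiftIso_hom_eq, leftUnitor_eq]
    refine (hz.dualR_comp _ _).trans (Eq.trans ?_ (hz.dualL_comp _ _).symm)
    rw [hc.dualR_incl, hc.dualL_incl, hC.dual_eq]
    refine congrArg (· ≫ _) ?_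
    refine (hz.dualR_comp _ _).trans (Eq.trans ?_ (hz.dualL_comp _ _).symm)
    rw [hc.dualR_incl, hc.dualL_incl, hC.dual_eq]
    refine congrArg (_ ≫ ·) ?_
    exact hz.dual_whiskerRight_eq _ _ (hc.dual_transIso hC ht a) (hT _ _) (hT _ _)

end Pivotal

section Hermitian

variable {k : Type w} [Field k] [StarRing k] {C : Type u} [Category.{v} C] [Preadditive C]
  [Linear k C] [MonoidalCategory C] [MonoidalPreadditive C] [MonoidalLinear k C]
  [BraidedCategory C] [PivotalStruct C] [DaggerStruct C]
  {G : Type x} [AddCommGroup G] {Z : Type y} [AddCommGroup Z] [DecidableEq Z]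
  {deg : G → ObjectProperty C} {χ : G → Z → kˣ} {σ : Discrete Z ⥤ C} [σ.Monoidal]

lemma IsUnitaryCentral.isHermitianPivotal (h : IsUnitaryCentral k deg χ σ)
    (ht : ∀ a, twistR (σ.obj ⟨a⟩) = 𝟙 _)
    (h0 : ∀ a : Z, a ≠ 0 → ∀ f : 𝟙_ C ⟶ σ.obj ⟨a⟩ ⊗ 𝟙_ C, f = 0) :
    IsHermitianPivotal k (TransCat deg χ σ) where
  toIsTensorCategory := h.central.isTensorCategory h.hermitian.end_unit h0
  zigzagR := (h.central.hasZigzags h.hermitian.hasZigzags).zigzagR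
  zigzagR_dual := (h.central.hasZigzags h.hermitian.hasZigzags).zigzagR_dual
  zigzagL := (h.central.hasZigzags h.hermitian.hasZigzags).zigzagL
  zigzagL_dual := (h.central.hasZigzags h.hermitian.hasZigzags).zigzagL_dual
  dual_eq f := h.central.dual_eq h.hermitian.toIsPivotalCategory ht f
  dualTensor_eq V W := by
    rw [h.central.dualTensorR_eq, h.central.dualTensorL_eq, h.hermitian.dualTensor_eq]
  dag_smul := h.dag_smul
  dag_comp := h.dag_comp
  dag_tensor := h.dag_tensorHom
  dag_dag := h.dag_dag
  dag_coevR V := (h.dag_incl _).trans (congrArg incl (h.hermitian.dag_coevR V.base))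
  dag_evR V := (h.dag_incl _).trans (congrArg incl (h.hermitian.dag_evR V.base))
  dag_coevL V := (h.dag_incl _).trans (congrArg incl (h.hermitian.dag_coevL V.base))
  dag_evL V := (h.dag_incl _).trans (congrArg incl (h.hermitian.dag_evL V.base))
  dag_associator U V W :=
    (h.dag_incl _).trans (congrArg incl (h.hermitian.dag_associator U.base V.base W.base))
  dag_leftUnitor V := (h.dag_incl _).trans (congrArg incl (h.hermitian.dag_leftUnitor V.base))
  dag_rightUnitor V := (h.dag_incl _).trans (congrArg incl (h.hermitian.dag_rightUnitor V.base))

end Hermitian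

end TransCat

/-! ### Projectivity of generic objects -/

section Simple

variable {k : Type w} [Field k] {C : Type u} [Category.{v} C] [Preadditive C] [Linear k C]

lemma IsSimpleObj.of_iso {V W : C} (hV : IsSimpleObj k V) (e : V ≅ W) : IsSimpleObj k W := by
  refine ⟨fun r s hrs => hV.1 ?_, fun f => ?_⟩
  · have := congrArg (fun q => e.hom ≫ q ≫ e.inv) hrs
    simpa using this
  · obtain ⟨r, hr⟩ := hV.2 (e.hom ≫ f ≫ e.inv)
    refine ⟨r, ?_⟩
    have := congrArg (fun q => e.inv ≫ q ≫ e.hom) hr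
    simpa using this

lemma IsSimpleObj.id_ne_zero {V : C} (hV : IsSimpleObj k V) : 𝟙 V ≠ 0 := fun h =>
  one_ne_zero (α := k) (hV.1 (by simp [h]))

variable [MonoidalCategoryStruct C] {G : Type x} [AddCommGroup G] {deg : G → ObjectProperty C}
  {g : G}

/-- Only simple summands of A isomorphic to S can map nontrivially to S, and these are reached from
S. -/
lemma IsSemisimple.eq_zero_of_precomp (hG : IsGraded deg) (hs : IsSemisimple k (deg g)) {S A : C}
    (hS : IsSimpleObj k S) (hgS : deg g S) (f : A ⟶ S) (hf : ∀ z : S ⟶ A, z ≫ f = 0) : f = 0 := by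
  obtain ⟨d⟩ := hG.decomp A
  rw [← Category.id_comp f, ← d.total, Preadditive.sum_comp]
  refine Finset.sum_eq_zero fun g' hg' => ?_
  rw [Category.assoc]
  by_cases hgg : g' = g
  · subst hgg
    obtain ⟨n, T, i, p, hT, -, -, htot⟩ := hs.sum_of_simples _ (d.deg_component g' hg')
    suffices d.incl g' ≫ f = 0 by rw [this, Limits.comp_zero]
    rw [← Category.id_comp (d.incl g'), ← htot, Preadditive.sum_comp, Preadditive.sum_comp]
    refine Finset.sum_eq_zero fun j _ => ?_
    rw [Category.assoc, Category.assoc]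
    suffices i j ≫ d.incl g' ≫ f = 0 by rw [this, Limits.comp_zero]
    by_cases he : Nonempty (T j ≅ S)
    · obtain ⟨e⟩ := he
      have := hf (e.inv ≫ i j ≫ d.incl g')
      rw [← cancel_epi e.inv, Limits.comp_zero, ← this]
      simp
    · exact hs.hom_eq_zero _ _ (hT j).2 hgS (hT j).1 hS (not_nonempty_iff.mp he) _
  · rw [hG.hom_eq_zero g' g _ _ (d.deg_component g' hg') hgS hgg (d.incl g' ≫ f), Limits.comp_zero]

/-- On a summand isomorphic to S the maps from S form a line, so the functional is there a multiple
of the inverse isomorphism; other summands contribute nothing. -/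
lemma IsSemisimple.exists_functional_of_deg (hs : IsSemisimple k (deg g)) {S B : C}
    (hS : IsSimpleObj k S) (hgS : deg g S) (hB : deg g B) (φ : (S ⟶ B) →ₗ[k] k) :
    ∃ h : B ⟶ S, ∀ y : S ⟶ B, y ≫ h = φ y • 𝟙 S := by
  classical
  obtain ⟨n, T, i, p, hT, -, -, htot⟩ := hs.sum_of_simples _ hB
  have key : ∀ j, ∃ h : T j ⟶ S, ∀ y : S ⟶ T j, y ≫ h = φ (y ≫ i j) • 𝟙 S := by
    intro j
    by_cases he : Nonempty (S ≅ T j)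
    · obtain ⟨e⟩ := he
      refine ⟨φ (e.hom ≫ i j) • e.inv, fun y => ?_⟩
      obtain ⟨c, hc⟩ := hS.2 (y ≫ e.inv)
      have hy : y = c • e.hom := by
        rw [← cancel_mono e.inv, ← hc]
        simp
      rw [hy]
      simp [mul_smul, smul_comm c]
    · refine ⟨0, fun y => ?_⟩
      rw [hs.hom_eq_zero _ _ hgS (hT j).2 hS (hT j).1 (not_nonempty_iff.mp he) y]
      simp
  choose h hh using key
  refine ⟨∑ j, p j ≫ h j, fun y => ?_⟩
  conv_rhs => rw [← Category.comp_id y, ← htot, Preadditive.comp_sum, map_sum, Finset.sum_smul]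
  rw [Preadditive.comp_sum]
  refine Finset.sum_congr rfl fun j _ => ?_
  rw [← Category.assoc, hh, Category.assoc]

lemma IsSemisimple.exists_functional (hG : IsGraded deg) (hs : IsSemisimple k (deg g)) {S B : C}
    (hS : IsSimpleObj k S) (hgS : deg g S) (φ : (S ⟶ B) →ₗ[k] k) :
    ∃ h : B ⟶ S, ∀ y : S ⟶ B, y ≫ h = φ y • 𝟙 S := by
  obtain ⟨d⟩ := hG.decomp B
  have hproj : ∀ g' ∈ d.degrees, g' ≠ g → ∀ y : S ⟶ B, y ≫ d.proj g' = 0 := fun g' hg' hne y =>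
    hG.hom_eq_zero g g' _ _ hgS (d.deg_component g' hg') hne.symm _
  by_cases hg : g ∈ d.degrees
  · obtain ⟨h, hh⟩ := hs.exists_functional_of_deg hS hgS (d.deg_component g hg)
      (φ.comp (Linear.rightComp k S (d.incl g)))
    refine ⟨d.proj g ≫ h, fun y => ?_⟩
    rw [← Category.assoc, hh]
    congr 1
    change φ ((y ≫ d.proj g) ≫ d.incl g) = φ y
    conv_rhs => rw [← Category.comp_id y, ← d.total, Preadditive.comp_sum]
    rw [Finset.sum_eq_single_of_mem g hg, Category.assoc]
    intro g' hg' hne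
    rw [← Category.assoc, hproj g' hg' hne, Limits.zero_comp]
  · refine ⟨0, fun y => ?_⟩
    have : y = 0 := by
      rw [← Category.comp_id y, ← d.total, Preadditive.comp_sum]
      refine Finset.sum_eq_zero fun g' hg' => ?_
      rw [← Category.assoc, hproj g' hg' (fun h => hg (h ▸ hg')), Limits.zero_comp]
    simp [this]

/-- Suppose a map x from a simple S to B does not lift along e. Some functional on Hom(S, B)
vanishes on all liftable maps but not on x, and it is given by some h : B → S. Then e ≫ h is killed
by every map from S, so it vanishes, and h = 0 since e is epic: a contradiction. No kernels or
exactness are needed. -/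
lemma IsSemisimple.projective (hG : IsGraded deg) (hs : IsSemisimple k (deg g)) {V : C}
    (hV : deg g V) : Projective V := by
  have simple : ∀ S : C, deg g S → IsSimpleObj k S → ∀ (A B : C) (x : S ⟶ B) (e : A ⟶ B) [Epi e],
      ∃ y : S ⟶ A, y ≫ e = x := by
    intro S hgS hS A B x e _
    by_contra hx
    have hx' : x ∉ LinearMap.range (Linear.rightComp k S e) := fun ⟨y, hy⟩ => hx ⟨y, hy⟩
    obtain ⟨φ, hφx, hφ⟩ := Submodule.exists_le_ker_of_notMem hx'
    obtain ⟨h, hh⟩ := hs.exists_functional hG hS hgS φ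
    have h0 : e ≫ h = 0 := hs.eq_zero_of_precomp hG hS hgS _ fun z => by
      rw [← Category.assoc, hh, show φ (z ≫ e) = 0 from hφ ⟨z, rfl⟩, zero_smul]
    have h1 : h = 0 := by rw [← cancel_epi e, h0, Limits.comp_zero]
    have := hh x
    rw [h1, Limits.comp_zero] at this
    exact hφx (hS.1 (by simpa using this.symm))
  refine ⟨fun {A B} x e _ => ?_⟩
  obtain ⟨n, T, i, p, hT, -, -, htot⟩ := hs.sum_of_simples _ hV
  choose y hy using fun j => simple (T j) (hT j).2 (hT j).1 A B (i j ≫ x) e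
  refine ⟨∑ j, p j ≫ y j, ?_⟩
  rw [Preadditive.sum_comp, ← Category.id_comp x, ← htot, Preadditive.sum_comp]
  refine Finset.sum_congr rfl fun j _ => ?_
  rw [Category.assoc, hy, Category.assoc]

end Simple

section ProjectiveTensor

variable {C : Type u} [Category.{v} C] [MonoidalCategory C] [PivotalStruct C]

/-- Tensoring with W is left adjoint to tensoring with W^*, and the latter preserves epimorphisms
because the other duality makes it a left adjoint too. -/
lemma HasZigzags.projective_tensor (h : HasZigzags C) (W : C) {P : C} (hP : Projective P) :
    Projective (W ⊗ P) := by
  let _ := h.pairingL W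
  let _ := h.pairingR W
  have : (tensorLeft (dual W)).PreservesEpimorphisms :=
    Functor.preservesEpimorphisms_of_adjunction (tensorLeftAdjunction W (dual W))
  exact (tensorLeftAdjunction (dual W) W).map_projective P hP

lemma HasZigzags.epi_whiskerRight (h : HasZigzags C) {V W : C} (f : V ⟶ W) [Epi f] (P : C) :
    Epi (f ▷ P) := by
  let _ := h.pairingR P
  have : (tensorRight P).PreservesEpimorphisms :=
    Functor.preservesEpimorphisms_of_adjunction (tensorRightAdjunction P (dual P))
  exact inferInstanceAs (Epi ((tensorRight P).map f))

end ProjectiveTensor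

lemma ptrL_whiskerLeft {D : Type u} [Category.{v} D] [MonoidalCategory D] [PivotalStruct D]
    {A V : D} (hd : coevL A ≫ evR A = 𝟙 _) (f : V ⟶ V) : ptrL (A ◁ f) = f := by
  calc _ = 𝟙 _ ⊗≫ (coevL A ▷ V ≫ (dual A ⊗ A) ◁ f) ⊗≫ evR A ▷ V ⊗≫ 𝟙 _ := by
        rw [ptrL]; monoidal
    _ = f ⊗≫ (coevL A ≫ evR A) ▷ V ⊗≫ 𝟙 _ := by
        rw [← whisker_exchange]; monoidal
    _ = f := by
        rw [hd]; monoidal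

/-! ### Grading and semisimplicity of `C^Z` -/

namespace TransCat

section Shift

variable {k : Type w} [Field k] {C : Type u} [Category.{v} C] [Preadditive C]
  [Linear k C] [MonoidalCategory C] [MonoidalPreadditive C] [MonoidalLinear k C]
  [BraidedCategory C] {G : Type x} [AddCommGroup G] {Z : Type y} [AddCommGroup Z] [DecidableEq Z]
  {deg : G → ObjectProperty C} {χ : G → Z → kˣ} {σ : Discrete Z ⥤ C} [σ.Monoidal]

/-- An isomorphism of `C`, as an isomorphism of `C^Z`. -/
noncomputable def inclIso {V W : TransCat deg χ σ} (e : V.base ≅ W.base) : V ≅ W where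
  hom := incl e.hom
  inv := incl e.inv
  hom_inv_id := by rw [← incl_comp, e.hom_inv_id, incl_id]
  inv_hom_id := by rw [← incl_comp, e.inv_hom_id, incl_id]

lemma exists_homOf_conj (hc : IsCentral deg χ σ) (a : Z) {V W : TransCat deg χ σ} {b : Z}
    (y : V.base ⟶ σ.obj ⟨b⟩ ⊗ W.base) :
    ∃ f : σ.obj ⟨a⟩ ⊗ V.base ⟶ σ.obj ⟨a + b + -a⟩ ⊗ (σ.obj ⟨a⟩ ⊗ W.base),
      (shiftIso hc a V).hom ≫ homOf b y ≫ (shiftIso hc a W).inv = homOf (a + b + -a) f := by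
  rw [shiftIso_hom, shiftIso_inv, ← Category.assoc, homOf_comp_homOf]
  exact ⟨_, homOf_comp_homOf _ _⟩

/-- Conjugation by the shifts gives a morphism of degree -a + a = 0, that is, one of `C`. With
faithfulness, σ_a ⊗ V inherits simplicity from V. -/
lemma IsCentral.whiskerLeft_trans_surjective (hc : IsCentral deg χ σ) (a : Z) {V W : C}
    (f : σ.obj ⟨a⟩ ⊗ V ⟶ σ.obj ⟨a⟩ ⊗ W) : ∃ f₀ : V ⟶ W, σ.obj ⟨a⟩ ◁ f₀ = f := by
  have h : ∃ f₀ : V ⟶ W, (shiftIso hc a (⟨V⟩ : TransCat deg χ σ)).inv ≫ incl f ≫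
      (shiftIso hc a ⟨W⟩).hom = incl f₀ := by
    rw [← homOf_eq_incl_comp, shiftIso_inv, homOf_comp_homOf]
    refine ⟨(homComp ((λ_ V).inv ≫ coevTrans σ a ▷ V ≫ (α_ _ _ _).hom) f ≫
      castHom σ (neg_add_cancel a) ▷ W) ≫ (unitIso σ).inv ▷ W ≫ (λ_ W).hom, ?_⟩
    rw [← homOf_zero_eq_incl]
    exact homOf_eq (neg_add_cancel a) _ _ rfl
  obtain ⟨f₀, h₀⟩ := h
  refine ⟨f₀, ?_⟩
  apply incl_injective (deg := deg) (χ := χ) (σ := σ) (V := ⟨σ.obj ⟨a⟩ ⊗ V⟩)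
    (W := ⟨σ.obj ⟨a⟩ ⊗ W⟩)
  have := shiftIso_naturality hc (V := (⟨V⟩ : TransCat deg χ σ)) (W := ⟨W⟩) a f₀
  rw [← cancel_mono (shiftIso hc a ⟨W⟩).hom, ← this, ← h₀, Iso.hom_inv_id_assoc]

lemma IsCentral.isSimpleObj_trans_tensor (hc : IsCentral deg χ σ) (a : Z) {V : C}
    (hV : IsSimpleObj k V) : IsSimpleObj k (σ.obj ⟨a⟩ ⊗ V) := by
  refine ⟨fun r s hrs => hV.1 (hc.whiskerLeft_trans_injective a (by simpa using hrs)), fun f => ?_⟩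
  obtain ⟨f₀, rfl⟩ := hc.whiskerLeft_trans_surjective a f
  obtain ⟨r, rfl⟩ := hV.2 f₀
  exact ⟨r, by simp⟩

lemma IsCentral.isSimpleObj_tensor_trans (hc : IsCentral deg χ σ) (a : Z) {V : C}
    (hV : IsSimpleObj k V) : IsSimpleObj k (V ⊗ σ.obj ⟨a⟩) :=
  (hc.isSimpleObj_trans_tensor a hV).of_iso (β_ (σ.obj ⟨a⟩) V)

lemma IsCentral.deg_trans_tensor (hc : IsCentral deg χ σ) (a : Z) {g : G} {V : C}
    (hV : deg g V) : deg g (σ.obj ⟨a⟩ ⊗ V) := by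
  have := hc.graded.tensor 0 g _ _ (hc.deg_zero a) hV
  rwa [zero_add] at this

lemma IsCentral.deg_tensor_trans (hc : IsCentral deg χ σ) (a : Z) {g : G} {V : C}
    (hV : deg g V) : deg g (V ⊗ σ.obj ⟨a⟩) := by
  have := hc.graded.tensor g 0 _ _ hV (hc.deg_zero a)
  rwa [add_zero] at this

lemma isSimpleObj_base {V : TransCat deg χ σ} (hV : IsSimpleObj k V) : IsSimpleObj k V.base := by
  refine ⟨fun r s hrs => hV.1 ?_, fun f => ?_⟩
  · have := congrArg (incl (V := V) (W := V)) hrs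
    simpa only [incl_smul, incl_id] using this
  · obtain ⟨r, hr⟩ := hV.2 (incl f)
    refine ⟨r, incl_injective (V := V) (W := V) ?_⟩
    simpa only [incl_smul, incl_id] using hr

lemma IsCentral.hom_eq_zero (hc : IsCentral deg χ σ) {g h : G} {V W : TransCat deg χ σ}
    (hV : deg g V.base) (hW : deg h W.base) (hgh : g ≠ h) (f : V ⟶ W) : f = 0 := by
  induction f using hom_induction with
  | h0 => rfl
  | ha f f' hf hf' => rw [hf, hf', add_zero]
  | h a f =>
    rw [hc.graded.hom_eq_zero g h _ _ hV (hc.deg_trans_tensor a hW) hgh f, map_zero]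

lemma incl_ne_zero {V W : TransCat deg χ σ} {f : V.base ⟶ W.base} (hf : f ≠ 0) :
    (incl f : V ⟶ W) ≠ 0 := fun h => hf (incl_injective (V := V) (W := W) (h.trans incl_zero.symm))

/-- An isomorphism of `C^Z` need not come from `C`, but it still kills the projections of W to
degrees other than g, so W is its own component of degree g. -/
lemma IsCentral.deg_of_iso (hc : IsCentral deg χ σ) {g : G} {V W : TransCat deg χ σ} (e : V ≅ W)
    (hV : deg g V.base) : deg g W.base := by
  obtain ⟨d⟩ := hc.graded.decomp W.base
  have hproj : ∀ h ∈ d.degrees, h ≠ g → d.proj h = 0 := by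
    intro h hh hne
    apply incl_injective (V := W) (W := ⟨d.component h⟩)
    rw [← cancel_epi e.hom]
    exact (hc.hom_eq_zero hV (W := ⟨d.component h⟩) (d.deg_component h hh) hne.symm _).trans
      (by rw [incl_zero, Limits.comp_zero])
  by_cases hg : g ∈ d.degrees
  · refine hc.graded.of_iso g ⟨d.incl g, d.proj g, d.incl_proj g hg, ?_⟩ (d.deg_component g hg)
    rw [← d.total, Finset.sum_eq_single_of_mem g hg]
    intro h hh hne
    rw [hproj h hh hne, Limits.zero_comp]
  -- Without a component of degree g the object W is zero, hence so is V, and zero maps are mutually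
  -- inverse in `C`.
  · have hW : 𝟙 W.base = 0 := by
      rw [← d.total]
      exact Finset.sum_eq_zero fun h hh => by
        rw [hproj h hh (fun h' => hg (h' ▸ hh)), Limits.zero_comp]
    have hV' : 𝟙 V.base = 0 := by
      apply incl_injective (V := V) (W := V)
      rw [incl_id, ← e.hom_inv_id, ← Category.id_comp e.inv, ← incl_id W, hW]
      simp [incl_zero]
    exact hc.graded.of_iso g ⟨0, 0, by simp [hV'], by simp [hW]⟩ hV

lemma IsCentral.isGraded_degree (hc : IsCentral deg χ σ) : IsGraded (degree deg χ σ) where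
  of_iso _ _ _ e hV := hc.deg_of_iso e hV
  exists_nonzero g := by
    obtain ⟨V, hV, h⟩ := hc.graded.exists_nonzero g
    exact ⟨⟨V⟩, hV, incl_ne_zero (V := ⟨V⟩) (W := ⟨V⟩) h⟩
  unit := hc.graded.unit
  decomp V := by
    obtain ⟨d⟩ := hc.graded.decomp V.base
    exact ⟨{
      degrees := d.degrees
      component := fun g => ⟨d.component g⟩
      incl := fun g => incl (d.incl g)
      proj := fun g => incl (d.proj g)
      deg_component := d.deg_component
      incl_proj := fun g hg => by rw [← incl_comp, d.incl_proj g hg]; rfl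
      incl_proj_ne := fun g hg h hh hgh => by
        rw [← incl_comp, d.incl_proj_ne g hg h hh hgh, incl_zero]
      total := by
        simp only [← incl_comp]
        rw [← incl_sum, d.total, incl_id] }⟩
  tensor g h V W hV hW := hc.graded.tensor g h V.base W.base hV hW
  hom_eq_zero g h V W hV hW hgh f := hc.hom_eq_zero hV hW hgh f

/-- Both objects are simple of the same degree, and freeness forbids an isomorphism, so
semisimplicity applies. Hence S has no endomorphisms of nonzero degree in `C^Z`. -/
lemma IsCentral.hom_trans_eq_zero (hc : IsCentral deg χ σ) {g : G} (hs : IsSemisimple k (deg g))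
    (hf : ∀ (a : Z) (V : C), IsSimpleObj k V → Nonempty (V ⊗ σ.obj ⟨a⟩ ≅ V) → a = 0) {S : C}
    (hS : IsSimpleObj k S) (hgS : deg g S) (a : Z) (ha : a ≠ 0) (f : S ⟶ σ.obj ⟨a⟩ ⊗ S) :
    f = 0 := by
  refine hs.hom_eq_zero _ _ hgS (hc.deg_trans_tensor a hgS) hS (hc.isSimpleObj_trans_tensor a hS)
    ⟨fun e => ha (hf a S hS ⟨β_ _ _ ≪≫ e.symm⟩)⟩ f

lemma IsCentral.isSemisimple_degree (hc : IsCentral deg χ σ) {g : G}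
    (hs : IsSemisimple k (deg g))
    (hf : ∀ (a : Z) (V : C), IsSimpleObj k V → Nonempty (V ⊗ σ.obj ⟨a⟩ ≅ V) → a = 0) :
    IsSemisimple k (degree deg χ σ g) where
  sum_of_simples V hV := by
    obtain ⟨n, T, i, p, hT, hip, hne, htot⟩ := hs.sum_of_simples V.base hV
    refine ⟨n, fun j => ⟨T j⟩, fun j => incl (i j), fun j => incl (p j), fun j => ⟨?_, (hT j).2⟩,
      fun j => ?_, fun j l hjl => ?_, ?_⟩
    · exact isSimpleObj_of_base (hT j).1 (hc.hom_trans_eq_zero hs hf (hT j).1 (hT j).2)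
    · rw [← incl_comp, hip]; rfl
    · rw [← incl_comp, hne j l hjl, incl_zero]
    · simp only [← incl_comp]
      rw [← incl_sum, htot, incl_id]
  hom_eq_zero S T hgS hgT hS hT hST f := by
    induction f using hom_induction with
    | h0 => rfl
    | ha f f' hf hf' => rw [hf, hf', add_zero]
    | h a f =>
      -- An isomorphism S ≅ σ_a ⊗ T in `C` would, followed by the shift, identify S and T in `C^Z`.
      rw [hs.hom_eq_zero _ _ hgS (hc.deg_trans_tensor a hgT) (isSimpleObj_base hS)
        (hc.isSimpleObj_trans_tensor a (isSimpleObj_base hT)) ⟨fun e => hST.elim ?_⟩ f, map_zero]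
      exact inclIso (W := ⟨σ.obj ⟨a⟩ ⊗ T.base⟩) e ≪≫ shiftIso hc a T

end Shift

/-! ### The modified trace of `C^Z` -/

section Trace

variable {k : Type w} [Field k] {C : Type u} [Category.{v} C] [Preadditive C]
  [Linear k C] [MonoidalCategory C] [MonoidalPreadditive C] [MonoidalLinear k C]
  [BraidedCategory C] [PivotalStruct C]
  {G : Type x} [AddCommGroup G] {Z : Type y} [AddCommGroup Z] [DecidableEq Z]
  {deg : G → ObjectProperty C} {χ : G → Z → kˣ} {σ : Discrete Z ⥤ C} [σ.Monoidal]

lemma epi_incl {V W : TransCat deg χ σ} (f : V.base ⟶ W.base) [Epi f] :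
    Epi (incl f : V ⟶ W) := by
  rw [Preadditive.epi_iff_cancel_zero]
  intro T g hg
  refine DFinsupp.ext fun a => ?_
  rw [← cancel_epi f]
  exact (incl_comp_apply f g a).symm.trans
    ((congrArg (fun q => (show GrHom σ V.base T.base from q) a) hg).trans
      (Limits.comp_zero (f := f) (Z := σ.obj ⟨a⟩ ⊗ T.base)).symm)

/-- Lift in `C^Z`, where e is still epic, and keep the component of degree zero. This makes the
trace axioms of `C` applicable to projectives of `C^Z`. -/
lemma projective_base {V : TransCat deg χ σ} (hV : Projective V) : Projective V.base := by
  refine ⟨fun {A B} x e _ => ?_⟩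
  have := epi_incl (deg := deg) (χ := χ) (σ := σ) (V := ⟨A⟩) (W := ⟨B⟩) e
  obtain ⟨y, hy⟩ := hV.factors (incl (V := V) (W := ⟨B⟩) x) (incl (V := ⟨A⟩) (W := ⟨B⟩) e)
  refine ⟨zeroComponent y, ?_⟩
  rw [← zeroComponent_incl (deg := deg) (χ := χ) (V := V) (W := ⟨B⟩) x, ← hy,
    zeroComponent_comp_incl]

/-- The trace on `C^Z`: the trace of the component of degree zero. -/
noncomputable def zeroTrace (t : ∀ V : C, (V ⟶ V) →ₗ[k] k) (V : TransCat deg χ σ) :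
    (V ⟶ V) →ₗ[k] k :=
  (t V.base).comp zeroComponent

variable {t : ∀ V : C, (V ⟶ V) →ₗ[k] k}

lemma zeroTrace_incl (V : TransCat deg χ σ) (f : V.base ⟶ V.base) :
    zeroTrace t V (incl f) = t V.base f :=
  congrArg (t V.base) (zeroComponent_incl f)

lemma zeroTrace_homOf (V : TransCat deg χ σ) {a : Z} (ha : a ≠ 0)
    (f : V.base ⟶ σ.obj ⟨a⟩ ⊗ V.base) : zeroTrace t V (homOf a f) = 0 :=
  (congrArg (t V.base) (zeroComponent_homOf_ne ha f)).trans (map_zero _)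

/-- `f` is homogeneous of degree `a`. -/
def IsHomogeneous (a : Z) {V W : TransCat deg χ σ} (f : V ⟶ W) : Prop :=
  ∃ f', f = homOf a f'

lemma IsHomogeneous.incl_comp {a : Z} {U V W : TransCat deg χ σ} (f : U.base ⟶ V.base)
    {g : V ⟶ W} (hg : IsHomogeneous a g) : IsHomogeneous a (incl f ≫ g) := by
  obtain ⟨g', rfl⟩ := hg
  exact ⟨_, incl_comp_homOf f g'⟩

lemma IsHomogeneous.comp_incl {a : Z} {U V W : TransCat deg χ σ} {f : U ⟶ V}
    (hf : IsHomogeneous a f) (g : V.base ⟶ W.base) : IsHomogeneous a (f ≫ incl g) := by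
  obtain ⟨f', rfl⟩ := hf
  exact ⟨_, homOf_comp_incl f' g⟩

lemma IsCentral.ptrR_incl (hc : IsCentral deg χ σ) {V W : TransCat deg χ σ}
    (f : V.base ⊗ W.base ⟶ V.base ⊗ W.base) :
    ptrR (incl f : V ⊗ W ⟶ V ⊗ W) = incl (ptrR f) := by
  simp only [ptrR, coevR_eq, evL_eq, associator_eq, associator_inv_eq, rightUnitor_inv_eq,
    rightUnitor_eq, hc.incl_whiskerRight, hc.whiskerLeft_incl, ← incl_comp]
  rfl

lemma IsCentral.ptrL_incl (hc : IsCentral deg χ σ) {V W : TransCat deg χ σ}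
    (f : V.base ⊗ W.base ⟶ V.base ⊗ W.base) :
    ptrL (incl f : V ⊗ W ⟶ V ⊗ W) = incl (ptrL f) := by
  simp only [ptrL, coevL_eq, evR_eq, associator_eq, associator_inv_eq, leftUnitor_inv_eq,
    leftUnitor_eq, hc.incl_whiskerRight, hc.whiskerLeft_incl, ← incl_comp]
  rfl

lemma IsCentral.isHomogeneous_ptrR (hc : IsCentral deg χ σ) {V W : TransCat deg χ σ} {a : Z}
    (f : V.base ⊗ W.base ⟶ σ.obj ⟨a⟩ ⊗ (V.base ⊗ W.base)) :
    IsHomogeneous a (ptrR (homOf a f : V ⊗ W ⟶ V ⊗ W)) := by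
  simp only [ptrR, coevR_eq, evL_eq, associator_eq, associator_inv_eq, rightUnitor_inv_eq,
    rightUnitor_eq, hc.whiskerRight_homOf, hc.whiskerLeft_incl, ← incl_comp]
  exact .incl_comp _ (.incl_comp _ (.incl_comp _ (.comp_incl ⟨_, rfl⟩ _)))

lemma IsCentral.isHomogeneous_ptrL (hc : IsCentral deg χ σ) {V W : TransCat deg χ σ} {a : Z}
    (f : V.base ⊗ W.base ⟶ σ.obj ⟨a⟩ ⊗ (V.base ⊗ W.base)) :
    IsHomogeneous a (ptrL (homOf a f : V ⊗ W ⟶ V ⊗ W)) := by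
  simp only [ptrL, coevL_eq, evR_eq, associator_eq, associator_inv_eq, leftUnitor_inv_eq,
    leftUnitor_eq, whiskerLeft_homOf, hc.incl_whiskerRight, ← incl_comp]
  exact .incl_comp _ (.incl_comp _ (.incl_comp _ (.comp_incl ⟨_, rfl⟩ _)))

lemma ptrR_add {V W : TransCat deg χ σ} (f g : V ⊗ W ⟶ V ⊗ W) :
    ptrR (f + g) = ptrR f + ptrR g := by
  simp only [ptrR, add_whiskerRight, Preadditive.add_comp, Preadditive.comp_add]

lemma ptrL_add {V W : TransCat deg χ σ} (f g : V ⊗ W ⟶ V ⊗ W) :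
    ptrL (f + g) = ptrL f + ptrL g := by
  simp only [ptrL, whiskerLeft_add, Preadditive.add_comp, Preadditive.comp_add]

lemma zeroTrace_incl_comp (ht : IsModifiedTrace k t) {V W : TransCat deg χ σ}
    (hV : Projective V.base) (hW : Projective W.base) (f : V.base ⟶ W.base) (g : W ⟶ V) :
    zeroTrace t V (incl f ≫ g) = zeroTrace t W (g ≫ incl f) := by
  induction g using hom_induction with
  | h0 => simp
  | ha g g' hg hg' => rw [Preadditive.comp_add, Preadditive.add_comp, map_add, map_add, hg, hg']
  | h a g =>
    by_cases ha : a = 0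
    · subst ha
      rw [homOf_zero_eq_incl, ← incl_comp, ← incl_comp, zeroTrace_incl, zeroTrace_incl]
      exact ht.cyclic _ _ hW hV _ _
    · rw [incl_comp_homOf, homOf_comp_incl, zeroTrace_homOf V ha, zeroTrace_homOf W ha]

/-- Conjugation by a shift preserves the degree, and in degree zero it tensors with σ_a; the left
partial trace then removes a loop on σ_a, which is 1. -/
lemma zeroTrace_shift (hc : IsCentral deg χ σ) (ht : IsModifiedTrace k t) (a : Z)
    (hd : coevL (σ.obj ⟨a⟩) ≫ evR (σ.obj ⟨a⟩) = 𝟙 _) {V : TransCat deg χ σ}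
    (hV : Projective V.base) (f : V ⟶ V) :
    zeroTrace t ⟨σ.obj ⟨a⟩ ⊗ V.base⟩ ((shiftIso hc a V).hom ≫ f ≫ (shiftIso hc a V).inv) =
      zeroTrace t V f := by
  induction f using hom_induction with
  | h0 => simp
  | ha g g' hg hg' => rw [Preadditive.add_comp, Preadditive.comp_add, map_add, map_add, hg, hg']
  | h b f =>
    by_cases hb : b = 0
    · subst hb
      rw [homOf_zero_eq_incl, ← Category.assoc, shiftIso_naturality, Category.assoc,
        Iso.hom_inv_id, Category.comp_id, zeroTrace_incl, zeroTrace_incl]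
      refine (ht.left V.base (σ.obj ⟨a⟩) hV _).trans (congrArg (t V.base) ?_)
      exact ptrL_whiskerLeft hd _
    · obtain ⟨f', hf'⟩ := exists_homOf_conj hc a f
      rw [hf', zeroTrace_homOf V hb]
      exact zeroTrace_homOf ⟨σ.obj ⟨a⟩ ⊗ V.base⟩ (by simpa using hb) f'

lemma isModifiedTrace_zeroTrace (hc : IsCentral deg χ σ) (ht : IsModifiedTrace k t)
    (hz : HasZigzags C) (hd : ∀ a, coevL (σ.obj ⟨a⟩) ≫ evR (σ.obj ⟨a⟩) = 𝟙 _) :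
    IsModifiedTrace k (zeroTrace (deg := deg) (χ := χ) (σ := σ) t) where
  right U W hU f := by
    induction f using hom_induction with
    | h0 => rw [← incl_zero, hc.ptrR_incl, zeroTrace_incl, zeroTrace_incl]
            exact ht.right _ _ (projective_base hU) _
    | ha f f' hf hf' => rw [ptrR_add, map_add, map_add, hf, hf']
    | h a f =>
      by_cases ha : a = 0
      · subst ha
        rw [homOf_zero_eq_incl, zeroTrace_incl]
        exact (ht.right _ _ (projective_base hU) _).trans
          ((zeroTrace_incl U _).symm.trans (congrArg (zeroTrace t U) (hc.ptrR_incl _).symm))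
      · obtain ⟨f', hf'⟩ := hc.isHomogeneous_ptrR f
        rw [zeroTrace_homOf _ ha, hf', zeroTrace_homOf _ ha]
  left U W hU f := by
    induction f using hom_induction with
    | h0 => rw [← incl_zero, hc.ptrL_incl, zeroTrace_incl, zeroTrace_incl]
            exact ht.left _ _ (projective_base hU) _
    | ha f f' hf hf' => rw [ptrL_add, map_add, map_add, hf, hf']
    | h a f =>
      by_cases ha : a = 0
      · subst ha
        rw [homOf_zero_eq_incl, zeroTrace_incl]
        exact (ht.left _ _ (projective_base hU) _).trans
          ((zeroTrace_incl U _).symm.trans (congrArg (zeroTrace t U) (hc.ptrL_incl _).symm))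
      · obtain ⟨f', hf'⟩ := hc.isHomogeneous_ptrL f
        rw [zeroTrace_homOf _ ha, hf', zeroTrace_homOf _ ha]
  cyclic U V hU hV f g := by
    induction f using hom_induction with
    | h0 => simp
    | ha f f' hf hf' => rw [Preadditive.add_comp, Preadditive.comp_add, map_add, map_add, hf, hf']
    | h a f =>
      -- The factor from `C` is moved around by cyclicity in `C`, the shift by conjugation
      -- invariance; σ_a ⊗ U must be projective in between.
      rw [homOf_eq_incl_comp hc, Category.assoc, zeroTrace_incl_comp ht (projective_base hV)
        (hz.projective_tensor _ (projective_base hU)), Category.assoc,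
        ← zeroTrace_shift hc ht a (hd a) (projective_base hU)]
      simp

end Trace

section RealTrace

variable {k : Type w} [Field k] [StarRing k] {C : Type u} [Category.{v} C] [Preadditive C]
  [Linear k C] [MonoidalCategory C] [MonoidalPreadditive C] [MonoidalLinear k C]
  [BraidedCategory C] [PivotalStruct C] [DaggerStruct C]
  {G : Type x} [AddCommGroup G] {Z : Type y} [AddCommGroup Z] [DecidableEq Z]
  {deg : G → ObjectProperty C} {χ : G → Z → kˣ} {σ : Discrete Z ⥤ C} [σ.Monoidal]
  {t : ∀ V : C, (V ⟶ V) →ₗ[k] k}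

lemma IsUnitaryCentral.isRealTrace_zeroTrace (h : IsUnitaryCentral k deg χ σ)
    (ht : IsRealTrace t) : IsRealTrace (zeroTrace (deg := deg) (χ := χ) (σ := σ) t) := by
  intro V hV f
  induction f using hom_induction with
  | h0 => simp
  | ha f f' hf hf' => rw [map_add, map_add, map_add, star_add, hf, hf']
  | h a f =>
    by_cases ha : a = 0
    · subst ha
      rw [homOf_zero_eq_incl, h.dag_incl, zeroTrace_incl, zeroTrace_incl,
        ht _ (projective_base hV)]
    · rw [dag_homOf h.central, shiftIso_inv, homOf_comp_incl,
        zeroTrace_homOf V (neg_ne_zero.mpr ha), zeroTrace_homOf V ha, star_zero]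

end RealTrace

end TransCat

/-! ### Consequences of the finite orbit condition -/

open TransCat

lemma IsSymmetricSmall.exists_notMem {G : Type x} [AddCommGroup G] {X : Set G}
    (h : IsSymmetricSmall X) : ∃ g, g ∉ X := by
  obtain ⟨g, hg⟩ := h.small {0}
  exact ⟨g, fun hX => hg 0 (Finset.mem_singleton_self 0) g hX (zero_add g).symm⟩

namespace IsRelativeHermitianPremodular

variable {k : Type w} [Field k] [StarRing k] {C : Type u} [Category.{v} C] [Preadditive C]
  [Linear k C] [MonoidalCategory C] [MonoidalPreadditive C] [MonoidalLinear k C]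
  [BraidedCategory C] [PivotalStruct C] [DaggerStruct C]
  {G : Type x} [AddCommGroup G] {Z : Type y} [AddCommGroup Z] [DecidableEq Z]
  {X : Set G} {deg : G → ObjectProperty C} {σ : Discrete Z ⥤ C} [σ.Monoidal]
  {ψ χ : G → Z → kˣ} {t : ∀ V : C, (V ⟶ V) →ₗ[k] k}

lemma isCentral (hC : IsRelativeHermitianPremodular k X deg σ ψ t) (hχ : IsUnitSquareRoot ψ χ)
    (hσ : BraidsTrivially σ) : IsCentral deg χ σ where
  graded := hC.graded
  bilinear := hχ.bilinear
  deg_zero := hC.freeRealization.deg_zero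
  braids := hσ

lemma isUnitaryCentral (hC : IsRelativeHermitianPremodular k X deg σ ψ t)
    (hχ : IsUnitSquareRoot ψ χ) (hσ : BraidsTrivially σ) : IsUnitaryCentral k deg χ σ where
  hermitian := hC.toIsHermitianPivotal
  central := hC.isCentral hχ hσ
  dag_unit := hC.freeRealization.dag_unit
  dag_mul := hC.freeRealization.dag_mul
  half_comp_dag := halfBraiding_comp_dag hC.toIsHermitianRibbon hC.graded hχ.unit

/-- Otherwise every map from W to a simple object V ⊗ σ_a with V in Θ would vanish, and the identity
of W would lie in the span of zero. -/
lemma exists_iso_of_dominated (hC : IsRelativeHermitianPremodular k X deg σ ψ t)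
    (hc : IsCentral deg χ σ) {g : G} (hg : g ∉ X) {Θ : Finset C}
    (hΘ : ∀ V ∈ Θ, deg g V ∧ IsSimpleObj k V) {W : C} (hgW : deg g W) (hW : IsSimpleObj k W)
    (hspan : 𝟙 W ∈ Submodule.span k {f : W ⟶ W | ∃ V ∈ Θ, ∃ (a : Z) (r : W ⟶ V ⊗ σ.obj ⟨a⟩)
      (s : V ⊗ σ.obj ⟨a⟩ ⟶ W), f = r ≫ s}) :
    ∃ V ∈ Θ, ∃ a : Z, Nonempty (W ≅ V ⊗ σ.obj ⟨a⟩) := by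
  by_contra! hno
  refine hW.id_ne_zero ((Submodule.mem_bot k).mp (Submodule.span_le.mpr ?_ hspan))
  rintro f ⟨V, hV, a, r, s, rfl⟩
  have hr : r = 0 := (hC.semisimple g hg).hom_eq_zero _ _ hgW (hc.deg_tensor_trans a (hΘ V hV).1)
    hW (hc.isSimpleObj_tensor_trans a (hΘ V hV).2) (hno V hV a) r
  simp [hr]

/-- Degree 0 may lie in X, so semisimplicity is not available for the unit. Tensoring with a generic
simple V in Θ kills f by freeness, and the epic evaluation of V brings this back to f. -/
lemma unit_hom_trans_eq_zero (hC : IsRelativeHermitianPremodular k X deg σ ψ t)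
    (hc : IsCentral deg χ σ) (a : Z) (ha : a ≠ 0) (f : 𝟙_ C ⟶ σ.obj ⟨a⟩ ⊗ 𝟙_ C) : f = 0 := by
  obtain ⟨g, hg⟩ := hC.small.exists_notMem
  obtain ⟨Θ, hΘ, hspan⟩ := hC.finite_orbits g hg
  obtain ⟨W, hgW, hW⟩ := hC.graded.exists_nonzero g
  obtain ⟨V, hV⟩ : Θ.Nonempty := by
    by_contra hΘ0
    rw [Finset.not_nonempty_iff_eq_empty] at hΘ0
    have := hspan W hgW
    simp [hΘ0] at this
    exact hW this
  obtain ⟨hgV, hsV, -, hepi⟩ := hΘ V hV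
  have h1 : V ◁ (f ≫ (ρ_ _).hom) = 0 := by
    rw [← cancel_epi (ρ_ V).inv, Limits.comp_zero]
    exact (hC.semisimple g hg).hom_eq_zero _ _ hgV (hc.deg_tensor_trans a hgV) hsV
      (hc.isSimpleObj_tensor_trans a hsV)
      ⟨fun e => ha (hC.freeRealization.free a V hsV ⟨e.symm⟩)⟩ _
  have h2 : (dual V ⊗ V) ◁ (f ≫ (ρ_ _).hom) = 0 := by
    rw [MonoidalCategory.tensor_whiskerLeft, h1]
    simp
  -- By interchange, the evaluation followed by f is (V^* ⊗ V) ◁ f followed by the evaluation, up to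
  -- unitors.
  have h3 : evR V ≫ (λ_ _).inv ≫ 𝟙_ C ◁ (f ≫ (ρ_ _).hom) = 0 := by
    have := MonoidalCategory.whisker_exchange (evR V) (f ≫ (ρ_ (σ.obj ⟨a⟩)).hom)
    rw [h2, Limits.zero_comp] at this
    rw [unitors_inv_equal, rightUnitor_inv_naturality_assoc, ← this, Limits.comp_zero]
  rw [← Limits.comp_zero (f := evR V), cancel_epi, ← leftUnitor_inv_naturality] at h3
  rw [← cancel_mono (ρ_ (σ.obj ⟨a⟩)).hom, Limits.zero_comp, ← cancel_mono (λ_ _).inv, h3,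
    Limits.zero_comp]

/-- A projective P with nonzero trace splits off V^* ⊗ V ⊗ P, and cyclicity transports the trace of
f there. Partial traces over V^* and P leave an endomorphism of V, a scalar; so the trace of f would
be a multiple of that of 𝟙 V. -/
lemma trace_id_ne_zero_of_epi (hC : IsRelativeHermitianPremodular k X deg σ ψ t) {V : C}
    (hsV : IsSimpleObj k V) (hpV : Projective V) (hepi : Epi (evR V)) : t V (𝟙 V) ≠ 0 := by
  intro h0
  have hz : HasZigzags C := hC.hasZigzags
  obtain ⟨P, hP, htP⟩ := hC.trace_ne_zero
  refine htP (LinearMap.ext fun f => ?_)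
  have := hz.epi_whiskerRight (evR V) P
  have hQ := hz.projective_tensor V hP
  let q : dual V ⊗ (V ⊗ P) ⟶ P := (α_ _ _ _).inv ≫ evR V ▷ P ≫ (λ_ P).hom
  have hq : Epi q := inferInstance
  obtain ⟨s, hs⟩ := hP.factors (𝟙 P) q
  obtain ⟨r, hr⟩ := hsV.2 (ptrR (ptrL (q ≫ f ≫ s)))
  calc t P f = t P (s ≫ q ≫ f) := by rw [reassoc_of% hs]
    _ = t (dual V ⊗ (V ⊗ P)) ((q ≫ f) ≫ s) :=
        hC.trace.cyclic _ _ (hz.projective_tensor _ hQ) hP s (q ≫ f)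
    _ = t V (ptrR (ptrL (q ≫ f ≫ s))) := by
        rw [Category.assoc, hC.trace.left _ _ hQ, hC.trace.right _ _ hpV]
    _ = 0 := by rw [← hr, map_smul, h0, smul_zero]

/-- V is isomorphic to some T ⊗ σ_a with T in Θ, and tracing out σ_a, of dimension one, reduces to
T, whose evaluation is epic. -/
lemma trace_id_ne_zero (hC : IsRelativeHermitianPremodular k X deg σ ψ t)
    (hc : IsCentral deg χ σ) {g : G} (hg : g ∉ X) {V : C} (hgV : deg g V)
    (hsV : IsSimpleObj k V) : t V (𝟙 V) ≠ 0 := by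
  obtain ⟨Θ, hΘ, hspan⟩ := hC.finite_orbits g hg
  obtain ⟨T, hT, a, ⟨e⟩⟩ := hC.exists_iso_of_dominated hc hg
    (fun T hT => ⟨(hΘ T hT).1, (hΘ T hT).2.1⟩) hgV hsV (hspan V hgV)
  obtain ⟨hgT, hsT, hpT, hepi⟩ := hΘ T hT
  have hproj {W : C} (hW : deg g W) : Projective W :=
    (hC.semisimple g hg).projective hC.graded hW
  have h1 : t V (𝟙 V) = t (T ⊗ σ.obj ⟨a⟩) (𝟙 _) := by
    rw [← e.hom_inv_id, ← e.inv_hom_id]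
    exact hC.trace.cyclic _ _ (hproj (hc.deg_tensor_trans a hgT)) (hproj hgV) _ _
  have hd := hc.dimR_trans a (hC.freeRealization.twist a)
  have h2 : ptrR (𝟙 (T ⊗ σ.obj ⟨a⟩)) = 𝟙 T := by
    rw [ptrR, id_whiskerRight, Category.id_comp, Iso.inv_hom_id_assoc,
      ← MonoidalCategory.whiskerLeft_comp_assoc, hd]
    simp
  rw [h1, hC.trace.right _ _ hpT, h2]
  exact hC.trace_id_ne_zero_of_epi hsT hpT hepi

lemma exists_isRepresentingSet (hC : IsRelativeHermitianPremodular k X deg σ ψ t)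
    (hc : IsCentral deg χ σ) {g : G} (hg : g ∉ X) :
    ∃ R : Finset (TransCat deg χ σ), IsRepresentingSet k (degree deg χ σ g) R := by
  classical
  obtain ⟨Θ, hΘ, hspan⟩ := hC.finite_orbits g hg
  -- Distinct elements of Θ may be isomorphic in `C^Z`, for instance when they lie in one orbit;
  -- choosing one object per isomorphism class removes the repetitions.
  let rep : TransCat deg χ σ → TransCat deg χ σ := fun V =>
    (Quotient.mk (isIsomorphicSetoid (TransCat deg χ σ)) V).out
  have hrep (V : TransCat deg χ σ) : Nonempty (rep V ≅ V) :=
    Quotient.mk_out (s := isIsomorphicSetoid (TransCat deg χ σ)) V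
  refine ⟨Θ.image fun V => rep ⟨V⟩, ?_, ?_, ?_⟩
  · intro W hW
    obtain ⟨V, hV, rfl⟩ := Finset.mem_image.mp hW
    obtain ⟨e⟩ := hrep ⟨V⟩
    exact ⟨(isSimpleObj_of_base (V := ⟨V⟩) (hΘ V hV).2.1 (hc.hom_trans_eq_zero (hC.semisimple g hg)
      hC.freeRealization.free (hΘ V hV).2.1 (hΘ V hV).1)).of_iso e.symm,
      hc.deg_of_iso e.symm (hΘ V hV).1⟩
  · intro V hV W hW h
    obtain ⟨V, -, rfl⟩ := Finset.mem_image.mp hV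
    obtain ⟨W, -, rfl⟩ := Finset.mem_image.mp hW
    obtain ⟨e⟩ := h
    obtain ⟨e₁⟩ := hrep ⟨V⟩
    obtain ⟨e₂⟩ := hrep ⟨W⟩
    exact congrArg Quotient.out (Quotient.sound
      (s := isIsomorphicSetoid (TransCat deg χ σ)) ⟨e₁.symm ≪≫ e ≪≫ e₂⟩)
  · intro W hW hgW
    have hsW := isSimpleObj_base hW
    obtain ⟨T, hT, a, ⟨e⟩⟩ := hC.exists_iso_of_dominated hc hg
      (fun T hT => ⟨(hΘ T hT).1, (hΘ T hT).2.1⟩) hgW hsW (hspan W.base hgW)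
    obtain ⟨e'⟩ := hrep ⟨T⟩
    exact ⟨rep ⟨T⟩, Finset.mem_image_of_mem _ hT, ⟨inclIso (W := ⟨σ.obj ⟨a⟩ ⊗ T⟩) (e ≪≫ β_ _ _) ≪≫
      shiftIso hc a ⟨T⟩ ≪≫ e'.symm⟩⟩

end IsRelativeHermitianPremodular

end HermCat

theorem theoremT {k : Type w} [Field k] [StarRing k]
    {C : Type u} [Category.{v} C] [Preadditive C] [Linear k C] [MonoidalCategory C]
    [MonoidalPreadditive C] [MonoidalLinear k C] [BraidedCategory C]
    [HermCat.PivotalStruct C] [HermCat.DaggerStruct C]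
    {G : Type x} [AddCommGroup G] {Z : Type y} [AddCommGroup Z] [DecidableEq Z]
    (X : Set G) (deg : G → ObjectProperty C) (σ : Discrete Z ⥤ C) [σ.Monoidal]
    (ψ : G → Z → kˣ) (t : ∀ V : C, (V ⟶ V) →ₗ[k] k)
    (hC : HermCat.IsRelativeHermitianPremodular k X deg σ ψ t)
    (χ : G → Z → kˣ) (hχ : HermCat.IsUnitSquareRoot ψ χ) (hσ : HermCat.BraidsTrivially σ)
    (hb : ∃ b : HermCat.TransCat deg χ σ → k,
      HermCat.IsBMap k X (HermCat.TransCat.degree deg χ σ) b) :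
    HermCat.IsRelativeHermitianSpherical k X (HermCat.TransCat.degree deg χ σ) := by
  have hu := hC.isUnitaryCentral hχ hσ
  have hc := hC.isCentral hχ hσ
  have hss (g : G) (hg : g ∉ X) :=
    hc.isSemisimple_degree (hC.semisimple g hg) hC.freeRealization.free
  exact
    { toIsHermitianPivotal := hu.isHermitianPivotal hC.freeRealization.twist
        (hC.unit_hom_trans_eq_zero hc)
      graded := hc.isGraded_degree
      small := hC.small
      semisimple := hss
      finite := fun g hg => hC.exists_isRepresentingSet hc hg
      exists_trace := ⟨HermCat.TransCat.zeroTrace t,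
        HermCat.TransCat.isModifiedTrace_zeroTrace hc hC.trace hC.hasZigzags fun a =>
          -- The left partial trace needs the other loop on σ_a; the ribbon condition makes the left
          -- twist trivial as well.
          hc.dimL_trans a ((hC.ribbon _).symm.trans (hC.freeRealization.twist a)),
        hu.isRealTrace_zeroTrace hC.trace_real,
        fun V ⟨hV, g, hg, hgV⟩ => ⟨(hss g hg).projective hc.isGraded_degree hgV, by
          rw [← HermCat.TransCat.incl_id, HermCat.TransCat.zeroTrace_incl]
          exact hC.trace_id_ne_zero hc hg hgV (HermCat.TransCat.isSimpleObj_base hV)⟩⟩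
      exists_b := hb }
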